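/- Let $\Omega\subset\mathbb R^2$ be a polygonal domain and let $\mathcal T_H$ be a finite conforming triangulation of $\overline\Omega$ into closed triangles, such that $\partial\Omega$ is a union of element edges. Let $d_T$ be the diameter of the inscribed circle of $T$, and assume that there are $H$ and $\gamma$ with $\operatorname{diam}T\le H$, $H/d_T\le\gamma$ and $d_{T'}/d_T\le\gamma$ for all $T,T'\in\mathcal T_H$. Let $\Gamma=\bigcup\mathcal E_H^\Gamma$ be the union of a set $\mathcal E_H^\Gamma$ of closed element edges. Let $V=H_0^1(\Omega)\cap H^1(\Gamma)$ be the space of all $v\in H^1_0(\Omega)$ whose trace on $\Gamma$ is continuous and has a weak tangential gradient $\nabla_{\boldsymbol\tau}v\in L^2(\Gamma)$ (edge by edge). Let $V_H$ be the space of continuous, piecewise linear functions on $\mathcal T_H$ that vanish on $\partial\Omega$. Nodes (vertices of triangles) are called fixed if they lie on $\partial\Omega$ and free otherwise; $\lambda_N$ is the nodal basis function of $N$. For a set $\omega$ let $U(\omega)=\bigcup\{T'\in\mathcal T_H: T'\cap \omega\neq\emptyset\}$, and put $U_\Gamma(T)=U(T)\cap\Gamma$, $\Gamma_T=\Gamma\cap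 T$. We write $\|\cdot\|_\omega$ for the $L^2(\omega)$-norm (with respect to arc length if $\omega\subset\Gamma$). For a free node $N$ let $\mathcal T(N)=\{T\in\mathcal T_H: N\in T\}$ and $$\mathcal T^\Gamma(N)=\{T\in\mathcal T(N): N\in E\text{ and }E\subset T\text{ for some }E\in\mathcal E_H^\Gamma\},$$ and let $\mathcal N^\Gamma$ and $\mathcal N^\Omega$ be the sets of free nodes with $\mathcal T^\Gamma(N)\ne\emptyset$ and $\mathcal T^\Gamma(N)=\emptyset$, respectively. For $\sigma=T$ with $T\in\mathcal T(N)$, and for $\sigma=\Gamma_T$ with $T\in\mathcal T^\Gamma(N)$, there is a unique (a.e. on $\sigma$) restriction $\psi_{N,\sigma}$ to $\sigma$ of a continuous piecewise linear function on $\mathcal T_H$ such that $\int_\sigma\psi_{N,\sigma}\lambda_{N'}=\delta_{NN'}$ for all fixed and free nodes $N'$. Define, for $v\in V$, $$\mathcal I_Hv=\sum_{N\in\mathcal N^\Gamma}\frac1{\operatorname{card}\mathcal T^\Gamma(N)}\sum_{T\in\mathcal T^\Gamma(N)}\Bigl(\int_{\Gamma_T}\psi_{N,\Gamma_T}v\Bigr)\lambda_N+\sum_{N\in\mathcal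 N^\Omega}\frac1{\operatorname{card}\mathcal T(N)}\sum_{T\in\mathcal T(N)}\Bigl(\int_T\psi_{N,T}v\Bigr)\lambda_N .$$ Then $\mathcal I_Hv\in V_H$ for all $v\in V$, and there is a constant $C$ that depends only on $\gamma$ such that, for all $v\in V$ and all $T\in\mathcal T_H$, $$\|v-\mathcal I_Hv\|_T+\|v-\mathcal I_Hv\|_{\Gamma_T}\le CH\bigl(\|\nabla v\|_{U(T)}+\|\nabla_{\boldsymbol\tau}v\|_{U_\Gamma(T)}\bigr),$$ $$\|\nabla\mathcal I_Hv\|_T+\|\nabla_{\boldsymbol\tau}\mathcal I_Hv\|_{\Gamma_T}\le C\bigl(\|\nabla v\|_{U(T)}+\|\nabla_{\boldsymbol\tau}v\|_{U_\Gamma(T)}\bigr).$$ -/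

import Mathlib

open MeasureTheory Filter Set
open scoped Topology ContDiff ENNReal Gradient MeasureTheory

noncomputable section

namespace FractureSZ

/-- The Euclidean plane. -/
abbrev Plane := EuclideanSpace ℝ (Fin 2)

/-! ### Triangulations -/

/-- A finite conforming triangulation in the plane: a finite simplicial complex in which every
face is a face of a triangle. Simplices are represented by their vertex sets; "conforming"
(two simplices meet in a common face) is part of `Geometry.SimplicialComplex`. -/
structure Triangulation where
  complex : Geometry.SimplicialComplex ℝ Plane
  finite : complex.faces.Finite
  pure : ∀ s ∈ complex.faces, ∃ t ∈ complex.faces, s ⊆ t ∧ t.card = 3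

/-- The closed simplex spanned by a vertex set. -/
def hull (s : Finset Plane) : Set Plane := convexHull ℝ (s : Set Plane)

/-- `d_T`, the diameter of the inscribed circle of `T`, i.e. of the largest disc contained
in `T`. -/
def inDiam (T : Finset Plane) : ℝ :=
  sSup {d : ℝ | 0 ≤ d ∧ ∃ x, Metric.closedBall x (d / 2) ⊆ hull T}

/-- The union of a set of closed simplices (used for edges). -/
def edgeUnion (S : Finset (Finset Plane)) : Set Plane := ⋃ e ∈ S, hull e

namespace Triangulation

variable (M : Triangulation)

open Classical in
/-- The elements (closed triangles) of the triangulation. -/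
def elements : Finset (Finset Plane) := {s ∈ M.finite.toFinset | s.card = 3}

open Classical in
/-- The closed element edges. -/
def edges : Finset (Finset Plane) := {s ∈ M.finite.toFinset | s.card = 2}

open Classical in
/-- All nodes, fixed and free. -/
def nodes : Finset Plane := M.elements.biUnion id

/-- `M` triangulates the open set `Ω`: the triangles cover the closure of `Ω`, and the boundary
of `Ω` is a union of element edges (so that `Ω` is polygonal). -/
def Triangulates (Ω : Set Plane) : Prop :=
  M.complex.space = closure Ω ∧ ∃ S ⊆ M.edges, frontier Ω = edgeUnion S

/-- Shape regularity and quasi-uniformity with mesh size parameter `H` and constant `γ`: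
`diam T ≤ H`, `H / d_T ≤ γ` and `d_{T'} / d_T ≤ γ`. -/
structure QuasiUniform (H γ : ℝ) : Prop where
  diam_le : ∀ T ∈ M.elements, Metric.diam (hull T) ≤ H
  le_inDiam : ∀ T ∈ M.elements, H ≤ γ * inDiam T
  inDiam_le : ∀ T ∈ M.elements, ∀ T' ∈ M.elements, inDiam T' ≤ γ * inDiam T

/-- `U(T)`, the union of all elements that intersect `T`. -/
def patch (T : Finset Plane) : Set Plane :=
  ⋃ T' ∈ {T' | T' ∈ M.elements ∧ (hull T' ∩ hull T).Nonempty}, hull T'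

open Classical in
/-- `λ_N`, the finite element basis function of the node `N`: on an element `T` with vertex `N`
it is the barycentric coordinate with respect to `N`, elsewhere it vanishes. -/
def hat (N x : Plane) : ℝ :=
  if h : ∃ (T : Finset Plane) (c : Plane → ℝ), T ∈ M.elements ∧ N ∈ T ∧
      (∀ y ∈ T, 0 ≤ c y) ∧ ∑ y ∈ T, c y = 1 ∧ ∑ y ∈ T, c y • y = x
  then h.choose_spec.choose N else 0

/-- The space of continuous piecewise linear functions on the triangulation, without boundary
condition. -/
def IsP1 (f : Plane → ℝ) : Prop :=
  ContinuousOn f M.complex.space ∧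
    ∀ T ∈ M.elements, ∃ A : Plane →ᵃ[ℝ] ℝ, EqOn f A (hull T)

/-- `V_H`: continuous piecewise linear functions that vanish on the boundary of `Ω`. -/
def IsVH (Ω : Set Plane) (f : Plane → ℝ) : Prop :=
  M.IsP1 f ∧ ∀ x ∈ frontier Ω, f x = 0

open Classical in
/-- The free nodes: those that do not lie on the boundary of `Ω`. -/
def freeNodes (Ω : Set Plane) : Finset Plane := {N ∈ M.nodes | N ∉ frontier Ω}

open Classical in
/-- `𝒯(N)`, the elements that contain the node `N`. -/
def adjacent (N : Plane) : Finset (Finset Plane) := {T ∈ M.elements | N ∈ T}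

open Classical in
/-- `𝒯^Γ(N)`: the elements `T ∈ 𝒯(N)` with an edge `E ⊆ T` that contains `N` and is one of the
fracture edges. -/
def fracAdjacent (EΓ : Finset (Finset Plane)) (N : Plane) : Finset (Finset Plane) :=
  {T ∈ M.adjacent N | ∃ E ∈ EΓ, N ∈ E ∧ E ⊆ T}

/-! ### The Scott–Zhang type operator -/

open Classical in
/-- `ψ` is an `L²(σ)`-dual basis function of the node `N`: it is (the restriction to `σ` of) a
continuous piecewise linear function with `∫_σ ψ λ_{N'} = δ_{NN'}` for all fixed and free nodes
`N'`. Here `μ` is the surface, respectively arc length, measure on `σ`. -/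
def IsDual (μ : Measure Plane) (N : Plane) (ψ : Plane → ℝ) : Prop :=
  M.IsP1 ψ ∧ ∀ N' ∈ M.nodes, ∫ x, ψ x * M.hat N' x ∂μ = if N' = N then 1 else 0

/-- The `L²(σ)`-dual basis function of `N` exists and is unique as a function on `σ`. -/
def HasUniqueDual (μ : Measure Plane) (N : Plane) : Prop :=
  ∃ ψ, M.IsDual μ N ψ ∧ ∀ ψ', M.IsDual μ N ψ' → ψ' =ᵐ[μ] ψ

open Classical in
/-- `ψ_{N,σ}`, the dual basis function. -/
def dual (μ : Measure Plane) (N : Plane) : Plane → ℝ :=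
  if h : ∃ ψ, M.IsDual μ N ψ then h.choose else 0

end Triangulation

/-- Surface measure on the element `T`. -/
def areaOn (T : Finset Plane) : Measure Plane := volume.restrict (hull T)

/-- Arc length measure on a set (a union of segments). -/
def arcOn (s : Set Plane) : Measure Plane := (μH[1] : Measure Plane).restrict s

open Classical in
/-- The Scott–Zhang type operator `I_H`. Free nodes with an adjacent fracture edge average over
`Γ_T = Γ ∩ T`, `T ∈ 𝒯^Γ(N)`; the other free nodes average over all adjacent triangles. -/
def interp (M : Triangulation) (Ω : Set Plane) (EΓ : Finset (Finset Plane)) (v : Plane → ℝ) :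
    Plane → ℝ := fun x =>
  (∑ N ∈ M.freeNodes Ω with (M.fracAdjacent EΓ N).Nonempty,
    ((1 / ((M.fracAdjacent EΓ N).card : ℝ)) * ∑ T ∈ M.fracAdjacent EΓ N,
      ∫ y, M.dual (arcOn (edgeUnion EΓ ∩ hull T)) N y * v y ∂(arcOn (edgeUnion EΓ ∩ hull T)))
        * M.hat N x) +
  ∑ N ∈ M.freeNodes Ω with ¬ (M.fracAdjacent EΓ N).Nonempty,
    ((1 / ((M.adjacent N).card : ℝ)) * ∑ T ∈ M.adjacent N,
      ∫ y, M.dual (areaOn T) N y * v y ∂(areaOn T)) * M.hat N x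

/-! ### Function spaces -/

/-- Smooth functions with compact support in an open set. -/
def IsTest {E : Type*} [NormedAddCommGroup E] [NormedSpace ℝ E] (U : Set E) (φ : E → ℝ) : Prop :=
  ContDiff ℝ ∞ φ ∧ HasCompactSupport φ ∧ tsupport φ ⊆ U

/-- `g ∈ L²(Γ)` is the weak tangential gradient `∇_τ f` on the union `Γ` of the edges in `EΓ`:
on every edge `[a, b]` it is parallel to `b - a`, and its component along the edge is the weak
derivative of `f` along the edge. -/
def HasTangentialGradient (EΓ : Finset (Finset Plane)) (f : Plane → ℝ) (g : Plane → Plane) :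
    Prop :=
  MemLp g 2 (arcOn (edgeUnion EΓ)) ∧
  ∀ e ∈ EΓ, ∀ a ∈ e, ∀ b ∈ e, a ≠ b →
    (∀ᵐ x ∂(arcOn (hull e)), g x ∈ Submodule.span ℝ {b - a}) ∧
    ∀ φ : ℝ → ℝ, IsTest (Ioo 0 1) φ →
      ∫ s in (0 : ℝ)..1, f (AffineMap.lineMap a b s) * deriv φ s =
        -∫ s in (0 : ℝ)..1, inner ℝ (g (AffineMap.lineMap a b s)) (b - a) * φ s

/-- `v ∈ V = H¹₀(Ω) ∩ H¹(Γ)`, with gradient `∇v = G` in `Ω` and tangential gradient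
`∇_τ v = g` on `Γ`, where `Γ` is the union of the edges in `EΓ`.

The first field and `approx` say that `v ∈ H¹₀(Ω)` (closure of the test functions in `H¹(Ω)`)
has weak gradient `G`, and that the values of `v` on the null set `Γ` are those of its trace,
the `L²(Γ)` limit of the approximating test functions. The remaining fields say that this trace
is in `H¹` of the edges and is represented by a continuous function on `Γ`. -/
structure MemV (Ω : Set Plane) (EΓ : Finset (Finset Plane)) (v : Plane → ℝ)
    (G g : Plane → Plane) : Prop where
  memLp : MemLp v 2 (volume.restrict Ω) ∧ MemLp G 2 (volume.restrict Ω)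
  approx : ∃ φ : ℕ → Plane → ℝ, (∀ n, IsTest Ω (φ n)) ∧
    Tendsto (fun n => eLpNorm (φ n - v) 2 (volume.restrict Ω)) atTop (𝓝 0) ∧
    Tendsto (fun n => eLpNorm (∇ (φ n) - G) 2 (volume.restrict Ω)) atTop (𝓝 0) ∧
    Tendsto (fun n => eLpNorm (φ n - v) 2 (arcOn (edgeUnion EΓ))) atTop (𝓝 0)
  continuousOn : ContinuousOn v (edgeUnion EΓ)
  tangential : HasTangentialGradient EΓ v g

end FractureSZ

end

/-!
Each nodal functional of the operator reproduces constants and is bounded in `L²` of its averaging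
set: the dual basis function of a node `N` satisfies `∫ ψ f = f(N)` for affine `f` and
`∫ ψ² = ψ(N) ≤ 1 / κ` as soon as `κ f(N)² ≤ ∫ f²` (`Controls`, `Controls.hasUniqueDual`,
`Controls.enorm_integral_dual_sub_sq_le`). Here `κ` is of order `H²` on triangles and of order `H`
on edges, because every triangle contains a disc of radius `ρ = H / (4 γ)` (`QuasiUniform.fat`).
So all estimates reduce to showing that a function and its nodal values are close to one constant
on each element. The ratio `H / ρ = 4 γ` is the only parameter in the constants.

*Elements.* For a test function `φ`, the Poincaré and the trace inequality (`exists_poincare`,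
`lintegral_trace_le`) give a constant for each element. The constants of the elements that share a
node `N` have to be compared without a chain of adjacent elements, since the elements at `N` may be
connected only through `N`. Instead, `φ` is cut off to the open star of `N`
(`Triangulation.starPart`). In the disc of radius `ρ` about `N` the result is still smooth,
because `φ` vanishes near the boundary of `Ω`, and its gradient is supported in the star. The
Poincaré inequality on the disc then gives one constant for all elements at `N`. If `N` is a
boundary node, this function vanishes along a radius of the disc, so the trace inequality bounds the
constant itself, which accounts for the zero value of the interpolation at `N`
(`Triangulation.exists_star_estimate`, `Triangulation.exists_test_estimate`). Both sides are
continuous in `H¹(Ω)` and `L²(Γ)`, and so the estimate passes to all of `V`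
(`Triangulation.element_estimates`).

*Fracture.* Along a fracture edge, the continuous trace is the integral of its weak tangential
gradient, so that it oscillates by at most `√H ‖∇_τ v‖`
(`HasTangentialGradient.enorm_sub_sq_le`). At free fracture nodes the average over `Γ_T` is
therefore close to `v(N)`. At boundary nodes the interpolation vanishes, and so does `v`: on segments
of length `r` at `N` the mean square of `v` is bounded by the energy of `v` in the disc of radius
`r`, which tends to zero with `r` (`Triangulation.eq_zero_of_mem_frontier`). Thus the interpolation
is close to `v` on the fracture, pointwise (`Triangulation.enorm_interp_sub_le`). Its tangential
gradient is constant on every edge (`Triangulation.edgeGradient`).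
-/

noncomputable section

namespace FractureSZ

/-! ### Estimates on convex sets: the Poincaré and the trace inequality -/

section Lintegral

variable {α : Type*} [MeasurableSpace α]

/-- Cauchy–Schwarz for the lower Lebesgue integral, in squared form. -/
lemma lintegral_mul_sq_le {μ : Measure α} {f g : α → ℝ≥0∞} (hf : AEMeasurable f μ)
    (hg : AEMeasurable g μ) :
    (∫⁻ x, f x * g x ∂μ) ^ 2 ≤ (∫⁻ x, f x ^ 2 ∂μ) * ∫⁻ x, g x ^ 2 ∂μ := by
  have h := ENNReal.lintegral_mul_le_Lp_mul_Lq μ (p := 2) (q := 2)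
    (by norm_num [Real.holderConjugate_iff]) hf hg
  have h2 := pow_le_pow_left' h 2
  refine h2.trans (le_of_eq ?_)
  rw [mul_pow, ← ENNReal.rpow_natCast, ← ENNReal.rpow_natCast, ← ENNReal.rpow_mul,
    ← ENNReal.rpow_mul]
  norm_num

lemma lintegral_sq_le_mul {μ : Measure α} {f : α → ℝ≥0∞} (hf : AEMeasurable f μ) :
    (∫⁻ x, f x ∂μ) ^ 2 ≤ μ univ * ∫⁻ x, f x ^ 2 ∂μ := by
  simpa using lintegral_mul_sq_le (μ := μ) (f := fun _ => 1) (g := f) aemeasurable_const hf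

lemma eLpNorm_two_sq {F : Type*} [NormedAddCommGroup F] (μ : Measure α) (f : α → F) :
    eLpNorm f 2 μ ^ 2 = ∫⁻ x, ‖f x‖ₑ ^ 2 ∂μ := by
  rw [eLpNorm_eq_lintegral_rpow_enorm_toReal (by norm_num) (by norm_num),
    ← ENNReal.rpow_natCast, ← ENNReal.rpow_mul]
  norm_num

/-- Passage from squared to plain `L²` estimates. -/
lemma eLpNorm_two_le_of_sq_le {μ : Measure α} {F : Type*} [NormedAddCommGroup F] {f : α → F}
    {a : ℝ≥0∞} (h : ∫⁻ x, ‖f x‖ₑ ^ 2 ∂μ ≤ a ^ 2) : eLpNorm f 2 μ ≤ a := by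
  rw [← eLpNorm_two_sq] at h
  exact (ENNReal.pow_le_pow_left_iff two_ne_zero).1 h

end Lintegral

lemma lintegral_comp_smul_add (f : Plane → ℝ≥0∞) (hf : Measurable f) (c : Plane) {r : ℝ}
    (hr : r ≠ 0) :
    ∫⁻ y, f (c + r • y) = ENNReal.ofReal (r ^ 2)⁻¹ * ∫⁻ y, f y := by
  have h1 : ∫⁻ y, f (c + r • y) = ∫⁻ z, f (c + z) ∂(Measure.map (fun y : Plane => r • y) volume) :=
    (lintegral_map (hf.comp (measurable_const_add c)) (measurable_const_smul r)).symm
  rw [h1, Measure.map_addHaar_smul _ hr, lintegral_smul_measure, lintegral_add_left_eq_self]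
  simp [abs_of_nonneg (sq_nonneg r)]

lemma hasDerivAt_comp_line {u : Plane → ℝ} {x w : Plane} {t : ℝ}
    (hu : DifferentiableAt ℝ u (x + t • w)) :
    HasDerivAt (fun s : ℝ => u (x + s • w)) (inner ℝ (∇ u (x + t • w)) w) t := by
  have h1 : HasDerivAt (fun s : ℝ => x + s • w) w t := by
    simpa using ((hasDerivAt_id t).smul_const w).const_add x
  have h2 := hu.hasGradientAt.hasFDerivAt.comp_hasDerivAt t h1
  exact h2.congr_deriv (by simp)

lemma continuousAt_gradient {u : Plane → ℝ} {x : Plane} (hu : ContDiffAt ℝ 1 u x) :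
    ContinuousAt (∇ u) x := by
  have h := hu.continuousAt_fderiv (by norm_num)
  exact (InnerProductSpace.toDual ℝ Plane).symm.continuous.continuousAt.comp h

lemma enorm_sub_sq_le_lintegral {u : Plane → ℝ} {x w : Plane}
    (hu : ∀ t ∈ Icc (0 : ℝ) 1, ContDiffAt ℝ 1 u (x + t • w)) :
    ‖u (x + w) - u x‖ₑ ^ 2 ≤ ‖w‖ₑ ^ 2 * ∫⁻ t in Ioc (0 : ℝ) 1, ‖∇ u (x + t • w)‖ₑ ^ 2 := by
  have hc : ContinuousOn (fun t : ℝ => ∇ u (x + t • w)) (Icc 0 1) := fun t ht =>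
    ((continuousAt_gradient (hu t ht)).comp (f := fun t : ℝ => x + t • w)
      (by fun_prop)).continuousWithinAt
  have hci : ContinuousOn (fun t : ℝ => inner ℝ (∇ u (x + t • w)) w) (uIcc 0 1) := by
    rw [uIcc_of_le zero_le_one]
    exact hc.inner continuousOn_const
  have hftc := intervalIntegral.integral_eq_sub_of_hasDerivAt
    (f := fun s : ℝ => u (x + s • w)) (a := 0) (b := 1)
    (fun t ht => hasDerivAt_comp_line
      ((hu t (by rwa [uIcc_of_le zero_le_one] at ht)).differentiableAt (by norm_num)))
    hci.intervalIntegrable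
  simp only [one_smul, zero_smul, add_zero] at hftc
  rw [← hftc, intervalIntegral.integral_of_le zero_le_one]
  have hm : AEMeasurable (fun t : ℝ => ‖∇ u (x + t • w)‖ₑ) (volume.restrict (Ioc 0 1)) :=
    ((hc.mono Ioc_subset_Icc_self).aemeasurable measurableSet_Ioc).enorm
  calc ‖∫ t in Ioc (0 : ℝ) 1, inner ℝ (∇ u (x + t • w)) w‖ₑ ^ 2
      ≤ (∫⁻ t in Ioc (0 : ℝ) 1, ‖w‖ₑ * ‖∇ u (x + t • w)‖ₑ) ^ 2 := by
        gcongr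
        refine (enorm_integral_le_lintegral_enorm _).trans (lintegral_mono fun t => ?_)
        have := norm_inner_le_norm (𝕜 := ℝ) (∇ u (x + t • w)) w
        rw [mul_comm, enorm_eq_nnnorm, enorm_eq_nnnorm, enorm_eq_nnnorm, ← ENNReal.coe_mul,
          ENNReal.coe_le_coe]
        exact this
    _ = ‖w‖ₑ ^ 2 * (∫⁻ t in Ioc (0 : ℝ) 1, ‖∇ u (x + t • w)‖ₑ) ^ 2 := by
        rw [lintegral_const_mul'' _ hm, mul_pow]
    _ ≤ _ := by
        gcongr
        simpa using lintegral_sq_le_mul hm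

/-- The square of a function, cut off to a closed set on which it is continuous, is measurable. -/
lemma measurable_indicator_enorm_sq {F : Type*} [NormedAddCommGroup F] {K : Set Plane}
    (hK : IsClosed K) {w : Plane → F} (hw : ContinuousOn w K) :
    Measurable (K.indicator fun x => ‖w x‖ₑ ^ 2) := by
  classical
  rw [← Set.piecewise_eq_indicator]
  refine ContinuousOn.measurable_piecewise ?_ continuousOn_const hK.measurableSet
  exact (ENNReal.continuous_pow 2).comp_continuousOn (continuous_enorm.comp_continuousOn hw)

/-- The triple integral that controls the oscillation of a function on a convex set. In the half
`t ≥ 1/2` one integrates over `y` first, in the other half over `x`, so that the Jacobian of the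
substitution `z = x + t (y - x)` is bounded below by `1/4`. -/
lemma lintegral_segment_le (K : Set Plane) {F : Plane → ℝ≥0∞}
    (hF : Measurable F) :
    ∫⁻ x in K, ∫⁻ y in K, ∫⁻ t in Ioc (0 : ℝ) 1, F (x + t • (y - x)) ≤
      4 * volume K * ∫⁻ z, F z := by
  have hmeas : Measurable fun p : (Plane × Plane) × ℝ => F (p.1.1 + p.2 • (p.1.2 - p.1.1)) :=
    hF.comp (by fun_prop)
  have hmeas' : Measurable fun p : ℝ × (Plane × Plane) => F (p.2.1 + p.1 • (p.2.2 - p.2.1)) :=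
    hF.comp (by fun_prop)
  have hone : ∀ t ∈ Ioc (0 : ℝ) 1, ∫⁻ x in K, ∫⁻ y in K, F (x + t • (y - x)) ≤
      4 * volume K * ∫⁻ z, F z := by
    -- the bound for the integration over the variable with the larger coefficient
    have key : ∀ (r : ℝ) (c : Plane), 1 / 2 ≤ r → ∫⁻ y in K, F (c + r • y) ≤ 4 * ∫⁻ z, F z := by
      intro r c hr
      refine (setLIntegral_le_lintegral _ _).trans ?_
      rw [lintegral_comp_smul_add F hF c (by positivity)]
      gcongr
      rw [show (4 : ℝ≥0∞) = ENNReal.ofReal 4 by norm_num]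
      apply ENNReal.ofReal_le_ofReal
      rw [inv_le_comm₀ (by positivity) (by norm_num)]
      nlinarith
    intro t ht
    have outer : ∀ f : Plane → ℝ≥0∞, (∀ x, f x ≤ 4 * ∫⁻ z, F z) →
        ∫⁻ x in K, f x ≤ 4 * volume K * ∫⁻ z, F z := by
      intro f hf
      calc ∫⁻ x in K, f x ≤ ∫⁻ x in K, 4 * ∫⁻ z, F z := lintegral_mono hf
        _ = _ := by rw [setLIntegral_const]; ring
    rcases le_total (1 / 2) t with h | h
    · refine outer _ fun x => ?_
      have := key t ((1 - t) • x) h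
      refine le_trans (le_of_eq ?_) this
      congr 1; ext y; congr 1
      module
    · rw [lintegral_lintegral_swap]
      · refine outer _ fun y => ?_
        have := key (1 - t) (t • y) (by linarith)
        refine le_trans (le_of_eq ?_) this
        congr 1; ext x; congr 1
        module
      · exact (hF.comp (by fun_prop)).aemeasurable
  calc ∫⁻ x in K, ∫⁻ y in K, ∫⁻ t in Ioc (0 : ℝ) 1, F (x + t • (y - x))
      = ∫⁻ p : Plane × Plane, (∫⁻ t in Ioc (0 : ℝ) 1, F (p.1 + t • (p.2 - p.1)))
          ∂((volume.restrict K).prod (volume.restrict K)) := by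
        rw [lintegral_prod _ (hmeas.lintegral_prod_right).aemeasurable]
    _ = ∫⁻ t in Ioc (0 : ℝ) 1, ∫⁻ p : Plane × Plane, F (p.1 + t • (p.2 - p.1))
          ∂((volume.restrict K).prod (volume.restrict K)) :=
        lintegral_lintegral_swap hmeas.aemeasurable
    _ ≤ ∫⁻ t in Ioc (0 : ℝ) 1, 4 * volume K * ∫⁻ z, F z := by
        refine setLIntegral_mono measurable_const fun t ht => ?_
        refine le_trans (le_of_eq ?_) (hone t ht)
        rw [lintegral_prod]
        exact (hF.comp (by fun_prop)).aemeasurable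
    _ = _ := by simp

/-- **Poincaré inequality** on a closed convex set. The constant `m` is a value of the function
instead of its mean, which is all that is needed and makes the proof a single application of the
mean value property of integrals. -/
lemma exists_poincare {K : Set Plane} (hKc : IsClosed K) (hK : Convex ℝ K) (h0 : volume K ≠ 0)
    (hfin : volume K ≠ ⊤) {D : ℝ} (hD : ∀ x ∈ K, ∀ y ∈ K, ‖y - x‖ ≤ D) {u : Plane → ℝ}
    (hu : ∀ p ∈ K, ContDiffAt ℝ 1 u p) :
    ∃ m : ℝ, ∫⁻ x in K, ‖u x - m‖ₑ ^ 2 ≤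
      ENNReal.ofReal (4 * D ^ 2) * ∫⁻ x in K, ‖∇ u x‖ₑ ^ 2 := by
  set F : Plane → ℝ≥0∞ := K.indicator fun x => ‖∇ u x‖ₑ ^ 2 with hFdef
  have hF : Measurable F := measurable_indicator_enorm_sq hKc
    fun x hx => (continuousAt_gradient (hu x hx)).continuousWithinAt
  have hFint : ∫⁻ z, F z = ∫⁻ x in K, ‖∇ u x‖ₑ ^ 2 := lintegral_indicator hKc.measurableSet _
  rcases eq_or_ne (∫⁻ x in K, ‖∇ u x‖ₑ ^ 2) ⊤ with htop | htop
  · obtain ⟨x₀, hx₀⟩ : K.Nonempty := by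
      by_contra h
      rw [not_nonempty_iff_eq_empty] at h
      simp [h] at h0
    rcases eq_or_ne D 0 with rfl | hD0
    · -- a set of diameter zero is a point
      exfalso
      apply h0
      have : K ⊆ {x₀} := fun y hy => by
        have := hD x₀ hx₀ y hy
        rw [norm_le_zero_iff, sub_eq_zero] at this
        simpa using this
      exact measure_mono_null this (by simp)
    · refine ⟨0, ?_⟩
      rw [htop, ENNReal.mul_top]
      · exact le_top
      · rw [ne_eq, ENNReal.ofReal_eq_zero, not_le]
        positivity
  have hptw : ∀ y ∈ K, ∀ x ∈ K, ‖u x - u y‖ₑ ^ 2 ≤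
      ENNReal.ofReal (D ^ 2) * ∫⁻ t in Ioc (0 : ℝ) 1, F (y + t • (x - y)) := by
    intro y hy x hx
    have hseg : ∀ t ∈ Icc (0 : ℝ) 1, y + t • (x - y) ∈ K := fun t ht =>
      hK.add_smul_sub_mem hy hx ht
    have h := enorm_sub_sq_le_lintegral (u := u) (x := y) (w := x - y)
      fun t ht => hu _ (hseg t ht)
    rw [add_sub_cancel] at h
    refine h.trans ?_
    have hle : ‖x - y‖ₑ ^ 2 ≤ ENNReal.ofReal (D ^ 2) := by
      rw [ENNReal.ofReal_pow ((norm_nonneg _).trans (hD y hy x hx)), ← ofReal_norm]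
      gcongr
      exact hD y hy x hx
    refine mul_le_mul' hle (le_of_eq (setLIntegral_congr_fun measurableSet_Ioc fun t ht => ?_))
    rw [hFdef, indicator_of_mem (hseg t (Ioc_subset_Icc_self ht))]
  have hdouble : ∫⁻ y in K, ∫⁻ x in K, ‖u x - u y‖ₑ ^ 2 ≤
      volume K * (ENNReal.ofReal (4 * D ^ 2) * ∫⁻ x in K, ‖∇ u x‖ₑ ^ 2) := by
    calc ∫⁻ y in K, ∫⁻ x in K, ‖u x - u y‖ₑ ^ 2
        ≤ ∫⁻ y in K, ∫⁻ x in K,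
            ENNReal.ofReal (D ^ 2) * ∫⁻ t in Ioc (0 : ℝ) 1, F (y + t • (x - y)) :=
          setLIntegral_mono' hKc.measurableSet fun y hy =>
            setLIntegral_mono' hKc.measurableSet fun x hx => hptw y hy x hx
      _ = ENNReal.ofReal (D ^ 2) *
            ∫⁻ y in K, ∫⁻ x in K, ∫⁻ t in Ioc (0 : ℝ) 1, F (y + t • (x - y)) := by
          rw [← lintegral_const_mul' _ _ ENNReal.ofReal_ne_top]
          congr 1; ext y
          rw [lintegral_const_mul' _ _ ENNReal.ofReal_ne_top]
      _ ≤ ENNReal.ofReal (D ^ 2) * (4 * volume K * ∫⁻ z, F z) := by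
          gcongr
          exact lintegral_segment_le K hF
      _ = _ := by
          rw [hFint, ENNReal.ofReal_mul (by norm_num)]
          norm_num
          ring
  have hum : AEMeasurable u (volume.restrict K) :=
    ContinuousOn.aemeasurable (fun x hx => (hu x hx).continuousAt.continuousWithinAt)
      hKc.measurableSet
  have hprod : AEMeasurable (fun p : Plane × Plane => ‖u p.2 - u p.1‖ₑ ^ 2)
      ((volume.restrict K).prod (volume.restrict K)) :=
    ((hum.comp_quasiMeasurePreserving Measure.quasiMeasurePreserving_snd).sub
      (hum.comp_quasiMeasurePreserving Measure.quasiMeasurePreserving_fst)).enorm.pow_const 2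
  obtain ⟨y, -, hy⟩ := exists_le_setLAverage (μ := volume) (s := K)
    (f := fun y => ∫⁻ x in K, ‖u x - u y‖ₑ ^ 2) h0 hfin hprod.lintegral_prod_right'
  refine ⟨u y, hy.trans ?_⟩
  rw [setLAverage_eq]
  exact ENNReal.div_le_of_le_mul' hdouble

lemma lintegral_plane_eq (F : Plane → ℝ≥0∞) (hF : Measurable F) :
    ∫⁻ z, F z = ∫⁻ t : ℝ, ∫⁻ s : ℝ, F !₂[t, s] := by
  have hm : Measurable fun p : ℝ × ℝ => F !₂[p.1, p.2] := by
    refine hF.comp ?_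
    exact (PiLp.continuous_toLp 2 (fun _ : Fin 2 => ℝ)).measurable.comp
      (measurable_pi_iff.2 fun i => by fin_cases i <;> simp <;> fun_prop)
  rw [← (PiLp.volume_preserving_toLp (Fin 2)).lintegral_comp hF,
    ← lintegral_prod _ hm.aemeasurable, ← Measure.volume_eq_prod,
    ← (volume_preserving_finTwoArrow ℝ).lintegral_comp hm]
  congr 1; ext p
  congr 2
  ext i
  fin_cases i <;> simp

/-- The linear map of the plane with prescribed columns. -/
def colMap (x y : Plane) : Plane →ₗ[ℝ] Plane :=
  Matrix.toLin (EuclideanSpace.basisFun (Fin 2) ℝ).toBasis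
    (EuclideanSpace.basisFun (Fin 2) ℝ).toBasis
    !![x 0, y 0; x 1, y 1]

lemma colMap_apply (x y : Plane) (t s : ℝ) : colMap x y !₂[t, s] = t • x + s • y := by
  ext i
  simp [colMap, Matrix.toLin_apply, Matrix.mulVec, Matrix.vec2_dotProduct]
  fin_cases i <;> simp <;> ring

lemma det_colMap (x y : Plane) : LinearMap.det (colMap x y) = x 0 * y 1 - x 1 * y 0 := by
  rw [colMap, LinearMap.det_toLin, Matrix.det_fin_two_of]
  ring

/-- Integration in the oblique coordinates `P + t x + s y`. -/
lemma lintegral_oblique (F : Plane → ℝ≥0∞) (hF : Measurable F) (P x y : Plane)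
    (hd : x 0 * y 1 - x 1 * y 0 ≠ 0) :
    ∫⁻ t : ℝ, ∫⁻ s : ℝ, F (P + (t • x + s • y)) =
      ENNReal.ofReal |x 0 * y 1 - x 1 * y 0|⁻¹ * ∫⁻ z, F z := by
  have hA : Measurable (colMap x y) := (colMap x y).continuous_of_finiteDimensional.measurable
  have h1 := lintegral_plane_eq (fun z => F (P + colMap x y z)) (hF.comp (hA.const_add P))
  simp only [colMap_apply] at h1
  rw [← h1, ← lintegral_map (f := fun z => F (P + z)) (hF.comp (measurable_const_add P)) hA,
    Measure.map_linearMap_addHaar_eq_smul_addHaar _ (by rwa [det_colMap]), lintegral_smul_measure,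
    lintegral_add_left_eq_self, det_colMap, abs_inv, smul_eq_mul]

/-- **Trace inequality**: the triangle with apex `P` over the segment `P + x + [0,1] y` is
parametrized by `P + t (x + s y)`, and `t² w²` is integrated along the rays from `P`; the weight
makes the boundary term at `P` vanish and matches the Jacobian `t |det (x, y)|`. -/
lemma lintegral_trace_le {K : Set Plane} (hKc : IsClosed K) {P x y : Plane}
    (hd : x 0 * y 1 - x 1 * y 0 ≠ 0)
    (hK : ∀ t ∈ Icc (0 : ℝ) 1, ∀ s ∈ Icc (0 : ℝ) 1, P + t • (x + s • y) ∈ K)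
    {D : ℝ} (hD : ∀ s ∈ Icc (0 : ℝ) 1, ‖x + s • y‖ ≤ D) {w : Plane → ℝ}
    (hw : ∀ p ∈ K, ContDiffAt ℝ 1 w p) :
    ∫⁻ s in Ioc (0 : ℝ) 1, ‖w (P + (x + s • y))‖ₑ ^ 2 ≤
      ENNReal.ofReal |x 0 * y 1 - x 1 * y 0|⁻¹ *
        (3 * (∫⁻ z in K, ‖w z‖ₑ ^ 2) + ENNReal.ofReal (D ^ 2) * ∫⁻ z in K, ‖∇ w z‖ₑ ^ 2) := by
  have hwm := measurable_indicator_enorm_sq hKc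
    fun p hp => (hw p hp).continuousAt.continuousWithinAt
  have hgm := measurable_indicator_enorm_sq hKc
    fun p hp => (continuousAt_gradient (hw p hp)).continuousWithinAt
  set F : Plane → ℝ≥0∞ := fun z => 3 * K.indicator (fun z => ‖w z‖ₑ ^ 2) z +
    ENNReal.ofReal (D ^ 2) * K.indicator (fun z => ‖∇ w z‖ₑ ^ 2) z with hFdef
  have hF : Measurable F := (hwm.const_mul _).add (hgm.const_mul _)
  have hFint : ∫⁻ z, F z =
      3 * (∫⁻ z in K, ‖w z‖ₑ ^ 2) + ENNReal.ofReal (D ^ 2) * ∫⁻ z in K, ‖∇ w z‖ₑ ^ 2 := by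
    rw [hFdef, lintegral_add_left (hwm.const_mul _), lintegral_const_mul _ hwm,
      lintegral_const_mul _ hgm, lintegral_indicator hKc.measurableSet,
      lintegral_indicator hKc.measurableSet]
  have hray : ∀ s ∈ Icc (0 : ℝ) 1, ‖w (P + (x + s • y))‖ₑ ^ 2 ≤
      ∫⁻ t in Ioc (0 : ℝ) 1, ENNReal.ofReal t * F (P + t • (x + s • y)) := by
    intro s hs
    set z := x + s • y with hz
    have hderiv : ∀ t ∈ uIcc (0 : ℝ) 1, HasDerivAt (fun t => t ^ 2 * w (P + t • z) ^ 2)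
        (2 * t * w (P + t • z) ^ 2 +
          t ^ 2 * (2 * w (P + t • z) * inner ℝ (∇ w (P + t • z)) z)) t := by
      intro t ht
      rw [uIcc_of_le zero_le_one] at ht
      have h1 := hasDerivAt_comp_line (x := P) (w := z) (t := t)
        ((hw _ (hK t ht s hs)).differentiableAt (by norm_num))
      exact ((hasDerivAt_pow 2 t).mul (h1.pow 2)).congr_deriv (by simp)
    have hcw : ContinuousOn (fun t : ℝ => w (P + t • z)) (uIcc 0 1) := by
      intro t ht
      rw [uIcc_of_le zero_le_one] at ht
      exact ((hw _ (hK t ht s hs)).continuousAt.comp (f := fun t : ℝ => P + t • z)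
        (by fun_prop)).continuousWithinAt
    have hcg : ContinuousOn (fun t : ℝ => ∇ w (P + t • z)) (uIcc 0 1) := by
      intro t ht
      rw [uIcc_of_le zero_le_one] at ht
      exact ((continuousAt_gradient (hw _ (hK t ht s hs))).comp (f := fun t : ℝ => P + t • z)
        (by fun_prop)).continuousWithinAt
    have hftc := intervalIntegral.integral_eq_sub_of_hasDerivAt hderiv
      (ContinuousOn.intervalIntegrable (((continuousOn_const.mul continuousOn_id).mul
        (hcw.pow 2)).add ((continuousOn_id.pow 2).mul ((continuousOn_const.mul hcw).mul
          (hcg.inner continuousOn_const)))))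
    simp only [one_smul, zero_smul, one_pow, one_mul, ne_eq, OfNat.ofNat_ne_zero,
      not_false_eq_true, zero_pow, zero_mul, sub_zero] at hftc
    rw [intervalIntegral.integral_of_le zero_le_one] at hftc
    rw [← enorm_pow, ← hftc]
    refine (enorm_integral_le_lintegral_enorm _).trans
      (setLIntegral_mono' measurableSet_Ioc fun t ht => ?_)
    have hmem : P + t • z ∈ K := hK t (Ioc_subset_Icc_self ht) s hs
    simp only [hFdef, indicator_of_mem hmem]
    set a := w (P + t • z)
    set g := ∇ w (P + t • z)
    have hin : |inner ℝ g z| ≤ D * ‖g‖ := by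
      refine (abs_real_inner_le_norm g z).trans ?_
      rw [mul_comm]
      gcongr
      exact hD s hs
    have hreal : |2 * t * a ^ 2 + t ^ 2 * (2 * a * inner ℝ g z)| ≤
        t * (3 * a ^ 2 + D ^ 2 * ‖g‖ ^ 2) := by
      have h1 : |2 * a * inner ℝ g z| ≤ a ^ 2 + D ^ 2 * ‖g‖ ^ 2 := by
        rw [abs_mul, abs_mul, abs_two]
        have : |inner ℝ g z| ^ 2 ≤ (D * ‖g‖) ^ 2 := by gcongr
        nlinarith [sq_nonneg (|a| - |inner ℝ g z|), sq_abs a]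
      have h2 : |t ^ 2 * (2 * a * inner ℝ g z)| ≤ t * (a ^ 2 + D ^ 2 * ‖g‖ ^ 2) := by
        rw [abs_mul, abs_of_nonneg (sq_nonneg t)]
        refine mul_le_mul (by nlinarith [ht.1, ht.2]) h1 (abs_nonneg _) ht.1.le
      refine (abs_add_le _ _).trans ?_
      rw [abs_of_nonneg (mul_nonneg (by linarith [ht.1]) (sq_nonneg a))]
      linarith
    rw [Real.enorm_eq_ofReal_abs, Real.enorm_eq_ofReal_abs, ← ofReal_norm,
      ← ENNReal.ofReal_pow (abs_nonneg _), sq_abs, ← ENNReal.ofReal_pow (norm_nonneg _),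
      show (3 : ℝ≥0∞) = ENNReal.ofReal 3 by norm_num, ← ENNReal.ofReal_mul (by norm_num),
      ← ENNReal.ofReal_mul (sq_nonneg D), ← ENNReal.ofReal_add (by positivity) (by positivity),
      ← ENNReal.ofReal_mul ht.1.le]
    exact ENNReal.ofReal_le_ofReal hreal
  calc ∫⁻ s in Ioc (0 : ℝ) 1, ‖w (P + (x + s • y))‖ₑ ^ 2
      ≤ ∫⁻ s in Ioc (0 : ℝ) 1, ∫⁻ t in Ioc (0 : ℝ) 1,
          ENNReal.ofReal t * F (P + t • (x + s • y)) :=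
        setLIntegral_mono' measurableSet_Ioc fun s hs => hray s (Ioc_subset_Icc_self hs)
    _ = ∫⁻ t in Ioc (0 : ℝ) 1, ∫⁻ s in Ioc (0 : ℝ) 1,
          ENNReal.ofReal t * F (P + t • (x + s • y)) :=
        lintegral_lintegral_swap (by fun_prop)
    _ ≤ ∫⁻ t in Ioc (0 : ℝ) 1, ∫⁻ s : ℝ, F (P + (t • x + s • y)) := by
        refine setLIntegral_mono' measurableSet_Ioc fun t ht => ?_
        have hg : Measurable fun s : ℝ => F (P + (t • x + s • y)) := hF.comp (by fun_prop)
        have hmap := lintegral_map hg (measurable_const_mul t) (μ := volume)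
        rw [Real.map_volume_mul_left ht.1.ne', lintegral_smul_measure] at hmap
        calc ∫⁻ s in Ioc (0 : ℝ) 1, ENNReal.ofReal t * F (P + t • (x + s • y))
            ≤ ∫⁻ s : ℝ, ENNReal.ofReal t * F (P + t • (x + s • y)) :=
              setLIntegral_le_lintegral _ _
          _ = ENNReal.ofReal t * ∫⁻ s : ℝ, F (P + (t • x + (t * s) • y)) := by
              rw [lintegral_const_mul _
                (show Measurable fun s : ℝ => F (P + t • (x + s • y)) from hF.comp (by fun_prop))]
              simp only [smul_add, smul_smul]
          _ = ∫⁻ s : ℝ, F (P + (t • x + s • y)) := by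
              rw [← hmap, abs_of_pos (inv_pos.2 ht.1), smul_eq_mul, ← mul_assoc,
                ← ENNReal.ofReal_mul ht.1.le, mul_inv_cancel₀ ht.1.ne', ENNReal.ofReal_one,
                one_mul]
    _ ≤ ∫⁻ t : ℝ, ∫⁻ s : ℝ, F (P + (t • x + s • y)) := setLIntegral_le_lintegral _ _
    _ = _ := by rw [lintegral_oblique F hF P x y hd, hFint]

/-! ### Weak derivatives on an interval -/

/-- Test functions with vanishing integral have a primitive that is a test function. -/
lemma exists_isTest_deriv_eq {ψ : ℝ → ℝ} (hψ : IsTest (Ioo 0 1) ψ)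
    (h0 : ∫ s in (0 : ℝ)..1, ψ s = 0) :
    ∃ φ : ℝ → ℝ, IsTest (Ioo 0 1) φ ∧ deriv φ = ψ := by
  obtain ⟨hsm, hcomp, hsub⟩ := hψ
  have hint : ∀ a b, IntervalIntegrable ψ volume a b := fun a b =>
    hsm.continuous.intervalIntegrable a b
  have hder : ∀ x, HasDerivAt (fun x => ∫ s in (0 : ℝ)..x, ψ s) (ψ x) x := fun x =>
    intervalIntegral.integral_hasDerivAt_right (hint _ _)
      hsm.continuous.stronglyMeasurable.stronglyMeasurableAtFilter hsm.continuous.continuousAt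
  have hderiv : deriv (fun x => ∫ s in (0 : ℝ)..x, ψ s) = ψ := funext fun x => (hder x).deriv
  -- a compact interval that contains the support of `ψ`
  obtain ⟨α, β, hα, hβ, hαβ⟩ : ∃ α β : ℝ, 0 < α ∧ β < 1 ∧ tsupport ψ ⊆ Icc α β := by
    rcases (tsupport ψ).eq_empty_or_nonempty with he | hne
    · exact ⟨1, 0, one_pos, zero_lt_one, by simp [he]⟩
    · obtain ⟨α, hα⟩ := hcomp.isCompact.exists_isLeast hne
      obtain ⟨β, hβ⟩ := hcomp.isCompact.exists_isGreatest hne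
      exact ⟨α, β, (hsub hα.1).1, (hsub hβ.1).2, fun x hx => ⟨hα.2 hx, hβ.2 hx⟩⟩
  have hzero : ∀ x, x ∉ Icc α β → ψ x = 0 := fun x hx =>
    image_eq_zero_of_notMem_tsupport fun h => hx (hαβ h)
  have hsupp : tsupport (fun x => ∫ s in (0 : ℝ)..x, ψ s) ⊆ Icc α β := by
    refine closure_minimal (fun x hx => ?_) isClosed_Icc
    by_contra hx'
    apply hx
    rw [mem_Icc, not_and_or, not_le, not_le] at hx'
    rcases hx' with h | h
    · refine intervalIntegral.integral_zero_ae (Eventually.of_forall fun s hs => hzero s ?_)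
      intro hs'
      have := hs.2
      have := hs'.1
      rcases max_cases 0 x with h' | h' <;> linarith
    · have h1 : ∫ s in x..(1 : ℝ), ψ s = 0 := by
        refine intervalIntegral.integral_zero_ae (Eventually.of_forall fun s hs => hzero s ?_)
        intro hs'
        have := hs.1
        have := hs'.2
        rcases min_cases x 1 with h' | h' <;> linarith
      have := intervalIntegral.integral_add_adjacent_intervals (hint 0 x) (hint x 1)
      rw [h1, h0, add_zero] at this
      exact this
  refine ⟨_, ⟨?_, HasCompactSupport.intro isCompact_Icc
    fun x hx => image_eq_zero_of_notMem_tsupport fun h => hx (hsupp h),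
    hsupp.trans fun x hx => ⟨hα.trans_le hx.1, hx.2.trans_lt hβ⟩⟩, hderiv⟩
  rw [contDiff_infty_iff_deriv, hderiv]
  exact ⟨fun x => (hder x).differentiableAt, hsm⟩

/-- **Lemma of du Bois-Reymond**: a continuous function with vanishing weak derivative is
constant. -/
lemma eqOn_const_of_weakDeriv_eq_zero {u : ℝ → ℝ} (hu : ContinuousOn u (Icc 0 1))
    (h : ∀ φ : ℝ → ℝ, IsTest (Ioo 0 1) φ → ∫ s in (0 : ℝ)..1, u s * deriv φ s = 0) :
    ∃ d : ℝ, ∀ s ∈ Icc (0 : ℝ) 1, u s = d := by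
  let bump : ContDiffBump (1 / 2 : ℝ) := ⟨1 / 8, 1 / 4, by norm_num, by norm_num⟩
  set η : ℝ → ℝ := bump.normed volume with hη
  have hηsub : tsupport η ⊆ Ioo 0 1 := by
    rw [hη, bump.tsupport_normed_eq, Real.closedBall_eq_Icc]
    intro x hx
    simp only [bump, mem_Icc, mem_Ioo] at hx ⊢
    constructor <;> linarith
  have hηtest : IsTest (Ioo 0 1) η :=
    ⟨bump.contDiff_normed (n := ⊤), bump.hasCompactSupport_normed, hηsub⟩
  have hfull : ∀ f : ℝ → ℝ, (∀ x, x ∉ Ioo (0 : ℝ) 1 → f x = 0) →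
      ∫ s in (0 : ℝ)..1, f s = ∫ s, f s := by
    intro f hf
    rw [intervalIntegral.integral_of_le zero_le_one]
    refine setIntegral_eq_integral_of_forall_compl_eq_zero fun x hx => hf x fun h => hx ?_
    exact Ioo_subset_Ioc_self h
  have hη1 : ∫ s in (0 : ℝ)..1, η s = 1 := by
    rw [hfull η fun x hx => image_eq_zero_of_notMem_tsupport fun h => hx (hηsub h)]
    exact bump.integral_normed
  have hui : ∀ ψ : ℝ → ℝ, Continuous ψ → IntervalIntegrable (fun s => u s * ψ s) volume 0 1 := by
    intro ψ hψ
    refine ContinuousOn.intervalIntegrable ?_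
    rw [uIcc_of_le zero_le_one]
    exact hu.mul hψ.continuousOn
  set d : ℝ := ∫ s in (0 : ℝ)..1, u s * η s with hd
  have hae : ∀ᵐ x ∂(volume : Measure ℝ), x ∈ Ioo (0 : ℝ) 1 → u x - d = 0 := by
    refine isOpen_Ioo.ae_eq_zero_of_integral_contDiff_smul_eq_zero ?_ ?_
    · exact ((hu.sub continuousOn_const).mono Ioo_subset_Icc_self).locallyIntegrableOn
        measurableSet_Ioo
    · intro ψ hψ hψc hψs
      set c : ℝ := ∫ s in (0 : ℝ)..1, ψ s with hc
      have htest : IsTest (Ioo 0 1) fun s => ψ s - c * η s := by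
        refine ⟨hψ.sub (contDiff_const.mul hηtest.1), hψc.sub (hηtest.2.1.mul_left), ?_⟩
        refine (tsupport_sub ψ fun s => c * η s).trans (union_subset hψs ?_)
        exact (tsupport_mul_subset_right (f := fun _ => c) (g := η)).trans hηsub
      have hint0 : ∫ s in (0 : ℝ)..1, (ψ s - c * η s) = 0 := by
        rw [intervalIntegral.integral_sub (hψ.continuous.intervalIntegrable _ _)
          ((hηtest.1.continuous.const_mul c).intervalIntegrable _ _),
          intervalIntegral.integral_const_mul, hη1, ← hc, mul_one, sub_self]
      obtain ⟨φ, hφ, hφ'⟩ := exists_isTest_deriv_eq htest hint0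
      have h1 := h φ hφ
      rw [hφ'] at h1
      have h2 : ∫ s in (0 : ℝ)..1, u s * ψ s = c * d := by
        have : ∀ s, u s * (ψ s - c * η s) = u s * ψ s - c * (u s * η s) := fun s => by ring
        simp only [this] at h1
        rw [intervalIntegral.integral_sub (hui ψ hψ.continuous)
          ((hui η hηtest.1.continuous).const_mul c), intervalIntegral.integral_const_mul,
          ← hd] at h1
        linarith
      rw [← hfull]
      · have : ∀ s, ψ s • (u s - d) = u s * ψ s - d * ψ s := fun s => by
          rw [smul_eq_mul]; ring
        simp only [this]
        rw [intervalIntegral.integral_sub (hui ψ hψ.continuous)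
          ((hψ.continuous.intervalIntegrable _ _).const_mul d),
          intervalIntegral.integral_const_mul, h2, ← hc]
        ring
      · intro x hx
        rw [image_eq_zero_of_notMem_tsupport fun h => hx (hψs h), zero_smul]
  refine ⟨d, ?_⟩
  refine Measure.eqOn_Icc_of_ae_eq (μ := volume) zero_ne_one ?_ hu continuousOn_const
  rw [Filter.EventuallyEq, ae_restrict_congr_set Ioo_ae_eq_Icc.symm,
    ae_restrict_iff' measurableSet_Ioo]
  filter_upwards [hae] with x hx hx'
  linarith [hx hx']

/-- A continuous function with an integrable weak derivative is the integral of that weak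
derivative. -/
lemma sub_eq_integral_of_weakDeriv {f h : ℝ → ℝ} (hf : ContinuousOn f (Icc 0 1))
    (hh : IntervalIntegrable h volume 0 1)
    (hw : ∀ φ : ℝ → ℝ, IsTest (Ioo 0 1) φ →
      ∫ s in (0 : ℝ)..1, f s * deriv φ s = -∫ s in (0 : ℝ)..1, h s * φ s)
    {x y : ℝ} (hx : x ∈ Icc (0 : ℝ) 1) (hy : y ∈ Icc (0 : ℝ) 1) :
    f y - f x = ∫ s in x..y, h s := by
  set F : ℝ → ℝ := fun x => ∫ s in (0 : ℝ)..x, h s with hF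
  have hFac : AbsolutelyContinuousOnInterval F 0 1 :=
    hh.absolutelyContinuousOnInterval_intervalIntegral (by simp)
  have hFc : ContinuousOn F (Icc 0 1) := by
    simpa [uIcc_of_le zero_le_one] using hFac.continuousOn
  obtain ⟨d, hd⟩ := eqOn_const_of_weakDeriv_eq_zero (hf.sub hFc) (by
    intro φ hφ
    have h0 : φ 0 = 0 := image_eq_zero_of_notMem_tsupport fun h => by simpa using hφ.2.2 h
    have h1 : φ 1 = 0 := image_eq_zero_of_notMem_tsupport fun h => by simpa using hφ.2.2 h
    have hdc : Continuous (deriv φ) := hφ.1.continuous_deriv (by norm_num)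
    have hφac : AbsolutelyContinuousOnInterval φ 0 1 :=
      (hφ.1.of_le (by norm_num)).contDiffOn.absolutelyContinuousOnInterval
    have hparts := hFac.integral_mul_deriv_eq_deriv_mul hφac
    have hFd : ∫ s in (0 : ℝ)..1, deriv F s * φ s = ∫ s in (0 : ℝ)..1, h s * φ s := by
      refine intervalIntegral.integral_congr_ae ?_
      filter_upwards [hh.ae_hasDerivAt_integral] with s hs hs'
      rw [(hs (uIoc_subset_uIcc hs') 0 (by simp)).deriv]
    rw [hFd, h0, h1, mul_zero, mul_zero, sub_zero, zero_sub] at hparts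
    have hi : ∀ g : ℝ → ℝ, ContinuousOn g (Icc 0 1) →
        IntervalIntegrable (fun s => g s * deriv φ s) volume 0 1 := by
      intro g hg
      refine ContinuousOn.intervalIntegrable ?_
      rw [uIcc_of_le zero_le_one]
      exact hg.mul hdc.continuousOn
    simp only [Pi.sub_apply, sub_mul]
    rw [intervalIntegral.integral_sub (hi f hf) (hi F hFc), hw φ hφ, hparts, sub_self])
  have hsub : ∀ {a b : ℝ}, a ∈ Icc (0 : ℝ) 1 → b ∈ Icc (0 : ℝ) 1 →
      IntervalIntegrable h volume a b := by
    intro a b ha hb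
    refine hh.mono_set ?_
    rw [uIcc_of_le zero_le_one]
    exact uIcc_subset_Icc ha hb
  have hadj := intervalIntegral.integral_add_adjacent_intervals
    (hsub (left_mem_Icc.2 zero_le_one) hx) (hsub hx hy)
  have h1 := hd x hx
  have h2 := hd y hy
  simp only [Pi.sub_apply, hF] at h1 h2
  linarith

/-! ### Arc length on edges -/

lemma hull_pair (a b : Plane) : hull {a, b} = segment ℝ a b := by
  rw [hull, Finset.coe_pair]
  exact convexHull_pair a b

lemma isCompact_hull (s : Finset Plane) : IsCompact (hull s) :=
  s.finite_toSet.isCompact_convexHull ℝ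

lemma hull_mono {s t : Finset Plane} (h : s ⊆ t) : hull s ⊆ hull t :=
  convexHull_mono (by exact_mod_cast h)

lemma subset_hull {s : Finset Plane} {x : Plane} (h : x ∈ s) : x ∈ hull s :=
  subset_convexHull ℝ _ (by exact_mod_cast h)

/-- Arc length on a segment, in the affine parametrization by `[0, 1]`. -/
lemma arcOn_segment (a b : Plane) (hab : a ≠ b) :
    arcOn (segment ℝ a b) = ENNReal.ofReal (dist a b) •
      Measure.map (fun s : ℝ => AffineMap.lineMap a b s) (volume.restrict (Icc 0 1)) := by
  have hL : 0 < dist a b := dist_pos.2 hab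
  have hlm : Measurable fun s : ℝ => (AffineMap.lineMap a b s : Plane) :=
    AffineMap.lineMap_continuous.measurable
  -- the parametrization by arc length is an isometry
  have hiso : Isometry fun t : ℝ => (AffineMap.lineMap a b ((dist a b)⁻¹ * t) : Plane) := by
    refine Isometry.of_dist_eq fun s t => ?_
    rw [dist_lineMap_lineMap, Real.dist_eq, Real.dist_eq, ← mul_sub, abs_mul,
      abs_of_pos (inv_pos.2 hL)]
    field_simp
  have h1 := hiso.map_hausdorffMeasure (d := 1) (Or.inl zero_le_one)
  rw [hausdorffMeasure_real] at h1
  have h2 : Measure.map (fun t : ℝ => (AffineMap.lineMap a b ((dist a b)⁻¹ * t) : Plane)) volume =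
      ENNReal.ofReal (dist a b) •
        Measure.map (fun s : ℝ => (AffineMap.lineMap a b s : Plane)) volume := by
    rw [show (fun t : ℝ => (AffineMap.lineMap a b ((dist a b)⁻¹ * t) : Plane)) =
      (fun s : ℝ => (AffineMap.lineMap a b s : Plane)) ∘ (fun t => (dist a b)⁻¹ * t) from rfl,
      ← Measure.map_map hlm (measurable_const_mul _),
      Real.map_volume_mul_left (inv_ne_zero hL.ne'), Measure.map_smul, inv_inv, abs_of_pos hL]
  have himg : segment ℝ a b = (fun s : ℝ => (AffineMap.lineMap a b s : Plane)) '' Icc 0 1 :=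
    segment_eq_image_lineMap ℝ a b
  have hsubr : segment ℝ a b ⊆
      range fun t : ℝ => (AffineMap.lineMap a b ((dist a b)⁻¹ * t) : Plane) := by
    rw [himg]
    rintro _ ⟨s, -, rfl⟩
    refine ⟨dist a b * s, ?_⟩
    simp [hL.ne']
  have hmeas : MeasurableSet (segment ℝ a b) := by
    rw [← hull_pair]; exact (isCompact_hull _).measurableSet
  have hpre : (fun s : ℝ => (AffineMap.lineMap a b s : Plane)) ⁻¹' segment ℝ a b = Icc 0 1 := by
    rw [himg, preimage_image_eq _ (AffineMap.lineMap_injective ℝ hab)]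
  have h3 : arcOn (segment ℝ a b) = (Measure.map (fun t : ℝ =>
      (AffineMap.lineMap a b ((dist a b)⁻¹ * t) : Plane)) volume).restrict (segment ℝ a b) := by
    rw [h1, Measure.restrict_restrict hmeas, inter_eq_left.2 hsubr, arcOn]
  rw [h3, h2, Measure.restrict_smul, Measure.restrict_map hlm hmeas, hpre]

lemma lintegral_arcOn_segment {a b : Plane} (hab : a ≠ b) {f : Plane → ℝ≥0∞}
    (hf : AEMeasurable f (arcOn (segment ℝ a b))) :
    ∫⁻ x, f x ∂(arcOn (segment ℝ a b)) =
      ENNReal.ofReal (dist a b) * ∫⁻ s in Icc (0 : ℝ) 1, f (AffineMap.lineMap a b s) := by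
  have hc : ENNReal.ofReal (dist a b) ≠ 0 := by
    rw [ne_eq, ENNReal.ofReal_eq_zero, not_le]; exact dist_pos.2 hab
  rw [arcOn_segment a b hab, aemeasurable_smul_measure_iff hc] at hf
  rw [arcOn_segment a b hab, lintegral_smul_measure, smul_eq_mul,
    lintegral_map' hf AffineMap.lineMap_continuous.aemeasurable]

lemma hausdorffMeasure_segment_lt_top (a b : Plane) :
    (μH[1] : Measure Plane) (segment ℝ a b) < ⊤ := by
  rw [hausdorffMeasure_segment]; exact edist_lt_top a b

lemma arcOn_mono {s t : Set Plane} (h : s ⊆ t) : arcOn s ≤ arcOn t :=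
  Measure.restrict_mono h le_rfl

lemma hull_subset_edgeUnion {S : Finset (Finset Plane)} {e : Finset Plane} (he : e ∈ S) :
    hull e ⊆ edgeUnion S :=
  subset_biUnion_of_mem (u := fun e => hull e) he

/-- Oscillation along a fracture edge: the fundamental theorem of calculus for the weak tangential
gradient and the Cauchy–Schwarz inequality. -/
lemma HasTangentialGradient.enorm_sub_sq_le {EΓ : Finset (Finset Plane)} {f : Plane → ℝ}
    {g : Plane → Plane} (h : HasTangentialGradient EΓ f g) (hc : ContinuousOn f (edgeUnion EΓ))
    {a b : Plane} (he : {a, b} ∈ EΓ) (hab : a ≠ b) {x y : Plane} (hx : x ∈ hull {a, b})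
    (hy : y ∈ hull {a, b}) :
    ‖f y - f x‖ₑ ^ 2 ≤
      ENNReal.ofReal (dist a b) * ∫⁻ z, ‖g z‖ₑ ^ 2 ∂(arcOn (hull {a, b})) := by
  have hsub := hull_subset_edgeUnion he
  have hgm : AEStronglyMeasurable g (arcOn (segment ℝ a b)) := by
    rw [← hull_pair]
    exact h.1.1.mono_measure (arcOn_mono hsub)
  have hdist : ENNReal.ofReal (dist a b) ≠ 0 := by
    rw [ne_eq, ENNReal.ofReal_eq_zero, not_le]; exact dist_pos.2 hab
  set l : ℝ → Plane := fun s => AffineMap.lineMap a b s with hl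
  have hlc : Continuous l := AffineMap.lineMap_continuous
  have hgl : AEStronglyMeasurable (fun s => g (l s)) (volume.restrict (Icc 0 1)) := by
    rw [arcOn_segment a b hab] at hgm
    have : AEStronglyMeasurable g (Measure.map l (volume.restrict (Icc 0 1))) :=
      ((aemeasurable_smul_measure_iff hdist).1 hgm.aemeasurable).aestronglyMeasurable
    exact this.comp_measurable hlc.measurable
  have hI : ∫⁻ z, ‖g z‖ₑ ^ 2 ∂(arcOn (hull {a, b})) =
      ENNReal.ofReal (dist a b) * ∫⁻ s in Icc (0 : ℝ) 1, ‖g (l s)‖ₑ ^ 2 := by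
    rw [hull_pair]
    exact lintegral_arcOn_segment hab (hgm.enorm.pow_const 2)
  have hfin : ∫⁻ s in Icc (0 : ℝ) 1, ‖g (l s)‖ₑ ^ 2 ≠ ⊤ := by
    intro htop
    have h1 : ∫⁻ z, ‖g z‖ₑ ^ 2 ∂(arcOn (hull {a, b})) < ⊤ := by
      rw [← eLpNorm_two_sq]
      exact ENNReal.pow_lt_top (h.1.mono_measure (arcOn_mono hsub)).2
    rw [hI, htop, ENNReal.mul_top hdist] at h1
    exact lt_irrefl _ h1
  have hLp : MemLp (fun s => g (l s)) 2 (volume.restrict (Icc 0 1)) := by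
    refine ⟨hgl, ?_⟩
    by_contra hcon
    rw [not_lt, top_le_iff] at hcon
    rw [← eLpNorm_two_sq, hcon] at hfin
    simp at hfin
  have hint : IntervalIntegrable (fun s => inner ℝ (g (l s)) (b - a)) volume 0 1 := by
    rw [intervalIntegrable_iff_integrableOn_Icc_of_le zero_le_one]
    exact (hLp.integrable (by norm_num)).inner_const (b - a)
  have hmaps : MapsTo l (Icc 0 1) (edgeUnion EΓ) := by
    intro s hs
    apply hsub
    rw [hull_pair, segment_eq_image_lineMap]
    exact ⟨s, hs, rfl⟩
  have hfc : ContinuousOn (fun s => f (l s)) (Icc 0 1) := hc.comp hlc.continuousOn hmaps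
  have hftc := @sub_eq_integral_of_weakDeriv _ _ hfc hint
    (h.2 _ he a (by simp) b (by simp) hab).2
  rw [hull_pair, segment_eq_image_lineMap] at hx hy
  obtain ⟨s, hs, rfl⟩ := hx
  obtain ⟨t, ht, rfl⟩ := hy
  rw [hI, ← mul_assoc, hftc hs ht, intervalIntegral.intervalIntegral_eq_integral_uIoc, smul_eq_mul,
    enorm_mul]
  have hsign : ‖(if s ≤ t then 1 else -1 : ℝ)‖ₑ = 1 := by split_ifs <;> simp
  have hdn : ENNReal.ofReal (dist a b) = ‖b - a‖ₑ := by
    rw [dist_comm, dist_eq_norm, ofReal_norm]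
  rw [hsign, one_mul]
  calc ‖∫ r in uIoc s t, inner ℝ (g (l r)) (b - a)‖ₑ ^ 2
      ≤ (∫⁻ r in Icc (0 : ℝ) 1, ‖b - a‖ₑ * ‖g (l r)‖ₑ) ^ 2 := by
        gcongr
        refine (enorm_integral_le_lintegral_enorm _).trans ?_
        refine (lintegral_mono_set (uIoc_subset_uIcc.trans (uIcc_subset_Icc hs ht))).trans
          (lintegral_mono fun r => ?_)
        have := norm_inner_le_norm (𝕜 := ℝ) (g (l r)) (b - a)
        rw [mul_comm, enorm_eq_nnnorm, enorm_eq_nnnorm, enorm_eq_nnnorm, ← ENNReal.coe_mul,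
          ENNReal.coe_le_coe]
        exact this
    _ = ‖b - a‖ₑ ^ 2 * (∫⁻ r in Icc (0 : ℝ) 1, ‖g (l r)‖ₑ) ^ 2 := by
        rw [lintegral_const_mul'' _ hgl.enorm, mul_pow]
    _ ≤ ‖b - a‖ₑ ^ 2 * ∫⁻ r in Icc (0 : ℝ) 1, ‖g (l r)‖ₑ ^ 2 := by
        gcongr
        simpa using lintegral_sq_le_mul hgl.enorm
    _ = _ := by rw [hdn, sq]

/-! ### Barycentric coordinates and hat functions -/

/-- `T` is the vertex set of a nondegenerate triangle. -/
def IsTri (T : Finset Plane) : Prop :=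
  AffineIndependent ℝ ((↑) : T → Plane) ∧ T.card = 3

/-- The vertices of a triangle as an affine basis of the plane. -/
def IsTri.basis {T : Finset Plane} (h : IsTri T) : AffineBasis T ℝ Plane where
  toFun := (↑)
  ind' := h.1
  tot' := by
    rw [h.1.affineSpan_eq_top_iff_card_eq_finrank_add_one, Fintype.card_coe, h.2]
    simp

open Classical in
/-- The barycentric coordinate of the triangle `T` with respect to `N`, as an affine function on
the whole plane. By convention it is `0` if `N` is not a vertex of `T`, so that it represents the
hat function of `N` on `T` for every `N`. -/
def bary (T : Finset Plane) (N : Plane) : Plane →ᵃ[ℝ] ℝ :=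
  if h : IsTri T ∧ N ∈ T then h.1.basis.coord ⟨N, h.2⟩ else 0

lemma bary_of_notMem {T : Finset Plane} {N : Plane} (h : N ∉ T) : bary T N = 0 := by
  rw [bary, dif_neg (fun h' => h h'.2)]

lemma affine_apply_sum {ι : Type*} (s : Finset ι) (f : Plane →ᵃ[ℝ] ℝ) (c : ι → ℝ) (p : ι → Plane)
    (hc : ∑ i ∈ s, c i = 1) : f (∑ i ∈ s, c i • p i) = ∑ i ∈ s, c i * f (p i) := by
  have hf : ∀ x, f x = f.linear x + f 0 := fun x => by
    simpa using congrFun f.decomp x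
  rw [hf, map_sum]
  conv_rhs => enter [2, i]; rw [hf]
  simp only [map_smul, smul_eq_mul, mul_add, Finset.sum_add_distrib, ← Finset.sum_mul, hc, one_mul]

namespace IsTri

variable {T : Finset Plane} (h : IsTri T)
include h

lemma bary_apply {N : Plane} (hN : N ∈ T) : bary T N = h.basis.coord ⟨N, hN⟩ := by
  rw [bary, dif_pos ⟨h, hN⟩]

lemma bary_self {N : Plane} (hN : N ∈ T) : bary T N N = 1 := by
  rw [h.bary_apply hN]
  exact h.basis.coord_apply_eq ⟨N, hN⟩

lemma bary_ne {N N' : Plane} (hN' : N' ∈ T) (hne : N ≠ N') : bary T N N' = 0 := by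
  by_cases hN : N ∈ T
  · rw [h.bary_apply hN]
    exact h.basis.coord_apply_ne (i := ⟨N, hN⟩) (j := ⟨N', hN'⟩) (by simpa using hne)
  · rw [bary_of_notMem hN]; rfl

lemma sum_bary (x : Plane) : ∑ N ∈ T, bary T N x = 1 := by
  rw [← Finset.sum_coe_sort, ← h.basis.sum_coord_apply_eq_one x]
  exact Finset.sum_congr rfl fun N _ => by rw [h.bary_apply N.2]

lemma sum_bary_smul (x : Plane) : ∑ N ∈ T, bary T N x • N = x := by
  rw [← Finset.sum_coe_sort T fun N => bary T N x • N]
  conv_rhs => rw [← h.basis.linear_combination_coord_eq_self x]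
  exact Finset.sum_congr rfl fun N _ => by rw [h.bary_apply N.2]; rfl

/-- An affine function is determined by its values at the vertices. -/
lemma affine_eq_sum (f : Plane →ᵃ[ℝ] ℝ) (x : Plane) : f x = ∑ N ∈ T, f N * bary T N x := by
  conv_lhs => rw [← h.sum_bary_smul x]
  rw [affine_apply_sum _ _ _ _ (h.sum_bary x)]
  exact Finset.sum_congr rfl fun N _ => mul_comm _ _

lemma mem_hull_iff {x : Plane} : x ∈ hull T ↔ ∀ N ∈ T, 0 ≤ bary T N x := by
  have := h.basis.convexHull_eq_nonneg_coord
  have hr : range h.basis = (T : Set Plane) := by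
    change range ((↑) : T → Plane) = _
    simp
  rw [hr] at this
  rw [hull, this, mem_ofPred_eq]
  exact ⟨fun H N hN => by rw [h.bary_apply hN]; exact H _,
    fun H N => by rw [← h.bary_apply N.2]; exact H _ N.2⟩

lemma bary_nonneg {x : Plane} (hx : x ∈ hull T) (N : Plane) : 0 ≤ bary T N x := by
  by_cases hN : N ∈ T
  · exact h.mem_hull_iff.1 hx N hN
  · rw [bary_of_notMem hN]; exact le_rfl

lemma bary_le_one {x : Plane} (hx : x ∈ hull T) (N : Plane) : bary T N x ≤ 1 := by
  by_cases hN : N ∈ T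
  · rw [← h.sum_bary x]
    exact Finset.single_le_sum (f := fun N => bary T N x) (fun N _ => h.bary_nonneg hx N) hN
  · rw [bary_of_notMem hN]; exact zero_le_one

lemma eq_bary {c : Plane → ℝ} {x N : Plane} (hN : N ∈ T) (hc : ∑ y ∈ T, c y = 1)
    (hx : ∑ y ∈ T, c y • y = x) : c N = bary T N x := by
  rw [← hx, affine_apply_sum T _ c (fun y => y) hc, Finset.sum_eq_single_of_mem N hN]
  · simp [h.bary_self hN]
  · intro y hy hne
    simp [h.bary_ne hy hne.symm]

end IsTri

/-- Affine functions that agree at the vertices agree on the simplex. -/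
lemma affine_eqOn_hull {f g : Plane →ᵃ[ℝ] ℝ} {s : Finset Plane} (h : ∀ y ∈ s, f y = g y) {x : Plane}
    (hx : x ∈ hull s) : f x = g x := by
  have hconv : Convex ℝ ((f - g) ⁻¹' {0}) := (convex_singleton 0).affine_preimage _
  have : hull s ⊆ (f - g) ⁻¹' {0} := convexHull_min (fun y hy => by
    simp [h y (by exact_mod_cast hy)]) hconv
  have := this hx
  simpa [sub_eq_zero] using this

lemma bary_eq_zero_of_mem_hull {T s : Finset Plane} (h : IsTri T) (hs : s ⊆ T) {N x : Plane}
    (hN : N ∉ s) (hx : x ∈ hull s) : bary T N x = 0 :=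
  affine_eqOn_hull (g := 0) (fun y hy => h.bary_ne (hs hy) (by rintro rfl; exact hN hy)) hx

namespace Triangulation

variable {M : Triangulation}

lemma mem_elements {T : Finset Plane} : T ∈ M.elements ↔ T ∈ M.complex.faces ∧ T.card = 3 := by
  simp [elements]

lemma mem_edges {e : Finset Plane} : e ∈ M.edges ↔ e ∈ M.complex.faces ∧ e.card = 2 := by
  simp [edges]

lemma exists_eq_pair {e : Finset Plane} (he : e ∈ M.edges) {a : Plane} (ha : a ∈ e) :
    ∃ b, a ≠ b ∧ e = {a, b} := by
  obtain ⟨p, q, hpq, rfl⟩ := Finset.card_eq_two.1 (mem_edges.1 he).2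
  rcases Finset.mem_insert.1 ha with rfl | h
  · exact ⟨q, hpq, rfl⟩
  · rw [Finset.mem_singleton] at h
    subst h
    exact ⟨p, hpq.symm, Finset.pair_comm _ _⟩

lemma mem_adjacent {N : Plane} {T : Finset Plane} : T ∈ M.adjacent N ↔ T ∈ M.elements ∧ N ∈ T := by
  simp [adjacent]

lemma mem_nodes_of_mem {N : Plane} {T : Finset Plane} (hT : T ∈ M.elements) (hN : N ∈ T) :
    N ∈ M.nodes := by
  simp only [nodes, Finset.mem_biUnion, id]
  exact ⟨T, hT, hN⟩

lemma exists_mem_of_mem_nodes {N : Plane} (hN : N ∈ M.nodes) : ∃ T ∈ M.elements, N ∈ T := by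
  simpa only [nodes, Finset.mem_biUnion, id] using hN

lemma isTri {T : Finset Plane} (hT : T ∈ M.elements) : IsTri T :=
  ⟨M.complex.indep (mem_elements.1 hT).1, (mem_elements.1 hT).2⟩

lemma exists_element_of_edge {e : Finset Plane} (he : e ∈ M.edges) : ∃ T ∈ M.elements, e ⊆ T := by
  obtain ⟨T, hT, hsub, hcard⟩ := M.pure e (mem_edges.1 he).1
  exact ⟨T, mem_elements.2 ⟨hT, hcard⟩, hsub⟩

open Classical in
lemma mem_hull_inter {s t : Finset Plane} (hs : s ∈ M.complex.faces) (ht : t ∈ M.complex.faces)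
    {x : Plane} (hxs : x ∈ hull s) (hxt : x ∈ hull t) : x ∈ hull (s ∩ t) := by
  have := M.complex.inter_subset_convexHull hs ht ⟨hxs, hxt⟩
  rwa [hull, Finset.coe_inter]

lemma mem_of_mem_hull {s t : Finset Plane} (hs : s ∈ M.complex.faces) (ht : t ∈ M.complex.faces)
    {N : Plane} (hN : N ∈ s) (h : N ∈ hull t) : N ∈ t :=
  (Geometry.SimplicialComplex.vertex_mem_convexHull_iff (Geometry.SimplicialComplex.mem_vertices.2
    (M.complex.down_closed hs (Finset.singleton_subset_iff.2 hN) (Finset.singleton_nonempty N)))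
    ht).1 h

lemma space_eq : M.complex.space = ⋃ T : M.elements, hull T.1 := by
  ext x
  rw [Geometry.SimplicialComplex.mem_space_iff, mem_iUnion]
  constructor
  · rintro ⟨s, hs, hx⟩
    obtain ⟨T, hT, hsub, hcard⟩ := M.pure s hs
    exact ⟨⟨T, mem_elements.2 ⟨hT, hcard⟩⟩, hull_mono hsub hx⟩
  · rintro ⟨T, hx⟩
    exact ⟨T, (mem_elements.1 T.2).1, hx⟩

/-- The hat function of `N` agrees on every element with the barycentric coordinate. -/
lemma hat_eq_bary {T : Finset Plane} (hT : T ∈ M.elements) (N : Plane) {x : Plane}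
    (hx : x ∈ hull T) : M.hat N x = bary T N x := by
  classical
  by_cases hex : ∃ (T : Finset Plane) (c : Plane → ℝ), T ∈ M.elements ∧ N ∈ T ∧
      (∀ y ∈ T, 0 ≤ c y) ∧ ∑ y ∈ T, c y = 1 ∧ ∑ y ∈ T, c y • y = x
  · rw [hat, dif_pos hex]
    obtain ⟨hT', hN', hpos, hsum, hcomb⟩ := hex.choose_spec.choose_spec
    set T' := hex.choose
    set c := hex.choose_spec.choose
    have htri := isTri hT
    have htri' := isTri hT'
    rw [htri'.eq_bary hN' hsum hcomb]
    have hx' : x ∈ hull T' := by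
      rw [htri'.mem_hull_iff]
      intro y hy
      rw [← htri'.eq_bary hy hsum hcomb]
      exact hpos y hy
    have hxi := mem_hull_inter (mem_elements.1 hT).1 (mem_elements.1 hT').1 hx hx'
    refine affine_eqOn_hull (fun y hy => ?_) hxi
    rw [Finset.mem_inter] at hy
    by_cases hNy : N = y
    · subst hNy
      rw [htri'.bary_self hy.2, htri.bary_self hy.1]
    · rw [htri'.bary_ne hy.2 hNy, htri.bary_ne hy.1 hNy]
  · rw [hat, dif_neg hex]
    by_cases hN : N ∈ T
    · exact absurd ⟨T, fun y => bary T y x, hT, hN, (isTri hT).mem_hull_iff.1 hx,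
        (isTri hT).sum_bary x, (isTri hT).sum_bary_smul x⟩ hex
    · rw [bary_of_notMem hN]; rfl

/-- A function that is affine on every element is automatically continuous on the mesh. -/
lemma isP1_of_eqOn {f : Plane → ℝ}
    (h : ∀ T ∈ M.elements, ∃ A : Plane →ᵃ[ℝ] ℝ, EqOn f A (hull T)) : M.IsP1 f := by
  refine ⟨?_, h⟩
  rw [space_eq]
  refine (locallyFinite_of_finite _).continuousOn_iUnion
    (fun T => (isCompact_hull _).isClosed) fun T => ?_
  obtain ⟨A, hA⟩ := h T T.2
  exact A.continuous_of_finiteDimensional.continuousOn.congr hA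

lemma sum_hat_eqOn {T : Finset Plane} (hT : T ∈ M.elements) (s : Finset Plane) (c : Plane → ℝ) :
    EqOn (fun x => ∑ N ∈ s, c N * M.hat N x)
      (∑ N ∈ s, c N • bary T N : Plane →ᵃ[ℝ] ℝ) (hull T) := by
  intro x hx
  rw [show ((∑ N ∈ s, c N • bary T N : Plane →ᵃ[ℝ] ℝ)) x = ∑ N ∈ s, c N * bary T N x from ?_]
  · exact Finset.sum_congr rfl fun N _ => by rw [hat_eq_bary hT N hx]
  · induction s using Finset.induction_on with
    | empty => simp
    | insert a s ha ih => rw [Finset.sum_insert ha, Finset.sum_insert ha, ← ih]; simp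

lemma isP1_sum_hat (s : Finset Plane) (c : Plane → ℝ) :
    M.IsP1 fun x => ∑ N ∈ s, c N * M.hat N x :=
  isP1_of_eqOn fun _ hT => ⟨_, sum_hat_eqOn hT s c⟩

end Triangulation

/-! ### Shape regularity -/

/-- `T` contains a disc of radius `ρ` and has diameter at most `H`. -/
structure Fat (ρ H : ℝ) (T : Finset Plane) : Prop where
  exists_ball : ∃ z, Metric.closedBall z ρ ⊆ hull T
  diam_le : ∀ x ∈ hull T, ∀ y ∈ hull T, ‖y - x‖ ≤ H

lemma Triangulation.QuasiUniform.pos {M : Triangulation} {H γ : ℝ} (h : M.QuasiUniform H γ)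
    {T : Finset Plane} (hT : T ∈ M.elements) : 0 < H ∧ 0 < γ := by
  have hb := (isCompact_hull T).isBounded
  have hH : 0 < H := by
    obtain ⟨a, ha, b, hb', hab⟩ := Finset.one_lt_card.1
      (by rw [(Triangulation.mem_elements.1 hT).2]; norm_num : 1 < T.card)
    exact (dist_pos.2 hab).trans_le
      ((Metric.dist_le_diam_of_mem hb (subset_hull ha) (subset_hull hb')).trans (h.diam_le T hT))
  refine ⟨hH, ?_⟩
  have h0 : 0 ≤ inDiam T := Real.sSup_nonneg fun d hd => hd.1
  by_contra hγ
  have := h.le_inDiam T hT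
  nlinarith

lemma Triangulation.QuasiUniform.fat {M : Triangulation} {H γ : ℝ} (h : M.QuasiUniform H γ)
    {T : Finset Plane} (hT : T ∈ M.elements) : Fat (H / (4 * γ)) H T := by
  obtain ⟨hH, hγ⟩ := h.pos hT
  refine ⟨?_, fun x hx y hy => ?_⟩
  · have hlt : H / (2 * γ) < inDiam T := by
      rw [div_lt_iff₀ (by positivity)]
      nlinarith [h.le_inDiam T hT]
    obtain ⟨d, ⟨-, z, hz⟩, hd⟩ := exists_lt_of_lt_csSup (by
      obtain ⟨a, ha⟩ := Finset.card_pos.1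
        (by rw [(Triangulation.mem_elements.1 hT).2]; norm_num : 0 < T.card)
      exact ⟨0, le_rfl, a, by simpa using subset_hull ha⟩) hlt
    refine ⟨z, (Metric.closedBall_subset_closedBall ?_).trans hz⟩
    have : H / (4 * γ) = H / (2 * γ) / 2 := by field_simp; norm_num
    linarith
  · rw [← dist_eq_norm]
    exact (Metric.dist_le_diam_of_mem (isCompact_hull T).isBounded hy hx).trans (h.diam_le T hT)

lemma le_volume_closedBall (z : Plane) {r : ℝ} (hr : 0 ≤ r) :
    ENNReal.ofReal (3 * r ^ 2) ≤ volume (Metric.closedBall z r) := by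
  rw [EuclideanSpace.volume_closedBall_fin_two, ← ENNReal.ofReal_pow hr,
    ← ENNReal.ofReal_mul (by positivity)]
  apply ENNReal.ofReal_le_ofReal
  nlinarith [Real.pi_gt_three, sq_nonneg r]

namespace Fat

variable {ρ H : ℝ} {T : Finset Plane} (hF : Fat ρ H T)
include hF

/-- An affine function with values in `[0, 1]` on a disc of radius `ρ` has slope at most
`1 / (2 ρ)`. -/
lemma abs_bary_sub_le (hρ : 0 < ρ) (h : IsTri T) (N x y : Plane) :
    |bary T N x - bary T N y| ≤ ‖x - y‖ / (2 * ρ) := by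
  rcases eq_or_ne x y with rfl | hne
  · simp
  have hxy : 0 < ‖x - y‖ := norm_pos_iff.2 (sub_ne_zero.2 hne)
  obtain ⟨z, hz⟩ := hF.exists_ball
  set f := bary T N
  set w : Plane := (ρ / ‖x - y‖) • (x - y) with hw
  have hwn : ‖w‖ = ρ := by
    rw [hw, norm_smul, Real.norm_of_nonneg (by positivity)]
    field_simp
  have hlin : ∀ p q, f p - f q = f.linear (p - q) := fun p q => by
    simpa using (f.linearMap_vsub p q).symm
  have h1 : z + w ∈ hull T := hz (by simp [hwn])
  have h2 : z - w ∈ hull T := hz (by simp [hwn])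
  have h3 : f (z + w) - f (z - w) = 2 * (ρ / ‖x - y‖) * (f x - f y) := by
    rw [hlin, hlin, show z + w - (z - w) = (2 : ℝ) • w by module, hw, map_smul, map_smul,
      smul_eq_mul, smul_eq_mul]
    ring
  have h4 : |f (z + w) - f (z - w)| ≤ 1 := by
    rw [abs_le]
    constructor <;> linarith [h.bary_nonneg h1 N, h.bary_le_one h1 N, h.bary_nonneg h2 N,
      h.bary_le_one h2 N]
  rw [h3, abs_mul, abs_of_pos (by positivity)] at h4
  rw [le_div_iff₀ (by positivity)]
  have h5 : 2 * (ρ / ‖x - y‖) * |f x - f y| * ‖x - y‖ = |f x - f y| * (2 * ρ) := by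
    field_simp
  nlinarith

lemma le_dist (hρ : 0 < ρ) (h : IsTri T) {a b : Plane} (ha : a ∈ T) (hb : b ∈ T) (hab : a ≠ b) :
    2 * ρ ≤ dist a b := by
  have := hF.abs_bary_sub_le hρ h a a b
  rw [h.bary_self ha, h.bary_ne hb hab, sub_zero, abs_one, le_div_iff₀ (by positivity), one_mul,
    ← dist_eq_norm] at this
  exact this

lemma dist_le {x y : Plane} (hx : x ∈ hull T) (hy : y ∈ hull T) : dist x y ≤ H := by
  rw [dist_eq_norm]; exact hF.diam_le y hy x hx

lemma radius_le (hρ : 0 < ρ) : 2 * ρ ≤ H := by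
  obtain ⟨z, hz⟩ := hF.exists_ball
  have hn : ‖(EuclideanSpace.single 0 ρ : Plane)‖ = ρ := by simp [hρ.le]
  have h1 : z + EuclideanSpace.single 0 ρ ∈ hull T := hz (by simp [abs_of_pos hρ])
  have h2 : z - EuclideanSpace.single 0 ρ ∈ hull T := hz (by simp [abs_of_pos hρ])
  have := hF.diam_le _ h2 _ h1
  rw [show z + EuclideanSpace.single 0 ρ - (z - EuclideanSpace.single 0 ρ) =
    (2 : ℝ) • (EuclideanSpace.single 0 ρ : Plane) by module, norm_smul, hn] at this
  simpa using this

lemma le_volume (hρ : 0 < ρ) : ENNReal.ofReal (3 * ρ ^ 2) ≤ volume (hull T) := by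
  obtain ⟨z, hz⟩ := hF.exists_ball
  exact (le_volume_closedBall z hρ.le).trans (measure_mono hz)

end Fat

/-! ### Dual basis functions -/

/-- The range of a symmetric matrix is the orthogonal complement of its kernel, read off for a
unit vector. -/
lemma exists_mulVec_eq_single {n : Type*} [Fintype n] [DecidableEq n] {A : Matrix n n ℝ}
    (hA : A.IsSymm) (i : n) (h : ∀ c, A.mulVec c = 0 → c i = 0) :
    ∃ c, A.mulVec c = Pi.single i 1 := by
  have hmem : (LinearMap.proj i : (n → ℝ) →ₗ[ℝ] ℝ) ∈ A.mulVecLin.ker.dualAnnihilator := by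
    rw [Submodule.mem_dualAnnihilator]
    intro c hc
    exact h c (by simpa using hc)
  rw [← LinearMap.range_dualMap_eq_dualAnnihilator_ker] at hmem
  obtain ⟨φ, hφ⟩ := hmem
  refine ⟨fun j => φ (Pi.single j 1), funext fun j => ?_⟩
  have h1 := congrArg (fun ψ : Module.Dual ℝ (n → ℝ) => ψ (Pi.single j 1)) hφ
  simp only [LinearMap.dualMap_apply, Matrix.mulVecLin_apply, LinearMap.proj_apply,
    Matrix.mulVec_single_one] at h1
  have h2 : φ (A.col j) = ∑ k, A k j * φ (Pi.single k 1) := by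
    conv_lhs => rw [← Finset.univ_sum_single (A.col j)]
    rw [map_sum]
    refine Finset.sum_congr rfl fun k _ => ?_
    rw [show (Pi.single k (A.col j k) : n → ℝ) = A k j • Pi.single k 1 by
      rw [← Pi.single_smul']; simp [Matrix.col_apply], map_smul, smul_eq_mul]
  rw [h2] at h1
  change ∑ k, A j k * φ (Pi.single k 1) = _
  have h3 : ∀ k, A j k = A k j := fun k => hA.apply k j
  simp only [h3]
  rw [h1, Pi.single_apply, Pi.single_apply]
  simp [eq_comm]

/-- A measure on the triangle `T` that controls the value at the vertex `N` of affine functions: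
`κ f(N)² ≤ ∫ f² dμ`. This is all that is needed for the dual basis function of `N`. -/
structure Controls (μ : Measure Plane) (T : Finset Plane) (N : Plane) (κ : ℝ) : Prop where
  finite : IsFiniteMeasure μ
  mem_hull : ∀ᵐ x ∂μ, x ∈ hull T
  pos : 0 < κ
  le : ∀ f : Plane →ᵃ[ℝ] ℝ, ENNReal.ofReal (κ * f N ^ 2) ≤ ∫⁻ x, ‖f x‖ₑ ^ 2 ∂μ

namespace Controls

variable {μ : Measure Plane} {T : Finset Plane} {N : Plane} {κ : ℝ} (h : Controls μ T N κ)
include h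

lemma integrable_of_continuousOn {f : Plane → ℝ} (hf : ContinuousOn f (hull T)) :
    Integrable f μ := by
  have := h.finite
  rw [← Measure.restrict_eq_self_of_ae_mem h.mem_hull]
  exact hf.integrableOn_compact (isCompact_hull T)

lemma integrable_affine_mul (f g : Plane →ᵃ[ℝ] ℝ) : Integrable (fun x => f x * g x) μ :=
  h.integrable_of_continuousOn (f.continuous_of_finiteDimensional.mul
    g.continuous_of_finiteDimensional).continuousOn

lemma sq_le_integral (f : Plane →ᵃ[ℝ] ℝ) : κ * f N ^ 2 ≤ ∫ x, f x * f x ∂μ := by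
  have h1 := h.le f
  have h2 : ∫⁻ x, ‖f x‖ₑ ^ 2 ∂μ = ENNReal.ofReal (∫ x, f x * f x ∂μ) := by
    rw [ofReal_integral_eq_lintegral_ofReal (h.integrable_affine_mul f f)
      (Eventually.of_forall fun x => mul_self_nonneg _)]
    refine lintegral_congr fun x => ?_
    rw [Real.enorm_eq_ofReal_abs, ← ENNReal.ofReal_pow (abs_nonneg _), sq_abs, sq]
  rw [h2] at h1
  exact (ENNReal.ofReal_le_ofReal_iff (integral_nonneg fun x => mul_self_nonneg _)).1 h1

variable {M : Triangulation}

lemma hat_ae_eq (hT : T ∈ M.elements) (N' : Plane) : M.hat N' =ᵐ[μ] bary T N' := by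
  filter_upwards [h.mem_hull] with x hx
  exact Triangulation.hat_eq_bary hT N' hx

/-- The dual basis function reproduces the value at `N` of affine functions. -/
lemma integral_dual_mul {ψ : Plane → ℝ} (hψ : M.IsDual μ N ψ) (hT : T ∈ M.elements) (hN : N ∈ T)
    (f : Plane →ᵃ[ℝ] ℝ) : ∫ x, ψ x * f x ∂μ = f N := by
  obtain ⟨A, hA⟩ := hψ.1.2 T hT
  have hψA : ψ =ᵐ[μ] A := by
    filter_upwards [h.mem_hull] with x hx using hA hx
  have htri := Triangulation.isTri hT
  calc ∫ x, ψ x * f x ∂μ = ∫ x, ∑ N' ∈ T, f N' * (A x * bary T N' x) ∂μ := by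
        refine integral_congr_ae ?_
        filter_upwards [hψA] with x hx
        rw [hx, htri.affine_eq_sum f x, Finset.mul_sum]
        exact Finset.sum_congr rfl fun N' _ => by ring
    _ = ∑ N' ∈ T, f N' * ∫ x, A x * bary T N' x ∂μ := by
        rw [integral_finsetSum _ fun N' _ => (h.integrable_affine_mul A (bary T N')).const_mul _]
        simp_rw [integral_const_mul]
    _ = ∑ N' ∈ T, f N' * (if N' = N then 1 else 0) := by
        refine Finset.sum_congr rfl fun N' hN' => ?_
        rw [← hψ.2 N' (Triangulation.mem_nodes_of_mem hT hN')]
        congr 1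
        refine integral_congr_ae ?_
        filter_upwards [hψA, h.hat_ae_eq hT N'] with x h1 h2
        rw [h1, h2]
    _ = f N := by simp [hN]

lemma hasUniqueDual (hT : T ∈ M.elements) (hN : N ∈ T) : M.HasUniqueDual μ N := by
  classical
  have htri := Triangulation.isTri hT
  -- uniqueness: the difference of two dual functions is orthogonal to itself
  have huniq : ∀ ψ ψ' : Plane → ℝ, M.IsDual μ N ψ → M.IsDual μ N ψ' → ψ' =ᵐ[μ] ψ := by
    intro ψ ψ' hψ hψ'
    obtain ⟨A, hA⟩ := hψ.1.2 T hT
    obtain ⟨A', hA'⟩ := hψ'.1.2 T hT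
    have hψA : ψ =ᵐ[μ] A := by filter_upwards [h.mem_hull] with x hx using hA hx
    have hψA' : ψ' =ᵐ[μ] A' := by filter_upwards [h.mem_hull] with x hx using hA' hx
    have e1 := h.integral_dual_mul hψ hT hN (A' - A)
    have e2 := h.integral_dual_mul hψ' hT hN (A' - A)
    rw [integral_congr_ae (g := fun x => A x * (A' - A) x)
      (by filter_upwards [hψA] with x hx; rw [hx])] at e1
    rw [integral_congr_ae (g := fun x => A' x * (A' - A) x)
      (by filter_upwards [hψA'] with x hx; rw [hx])] at e2
    have e3 : ∫ x, (A' - A) x * (A' - A) x ∂μ = 0 := by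
      have : ∀ x, (A' - A) x * (A' - A) x = A' x * (A' - A) x - A x * (A' - A) x := fun x => by
        rw [← sub_mul]; rfl
      simp_rw [this]
      rw [integral_sub (h.integrable_affine_mul _ _) (h.integrable_affine_mul _ _), e1, e2,
        sub_self]
    rw [integral_eq_zero_iff_of_nonneg (fun x => mul_self_nonneg _)
      (h.integrable_affine_mul _ _)] at e3
    filter_upwards [e3, hψA, hψA'] with x h1 h2 h3
    have h4 : A' x - A x = 0 := by simpa using h1
    rw [h2, h3]
    linarith
  -- existence: the kernel of the Gram matrix consists of functions that vanish at `N`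
  let G : Matrix T T ℝ := fun i j => ∫ x, bary T i x * bary T j x ∂μ
  have hG : G.IsSymm := by
    ext i j
    simp only [G]
    exact integral_congr_ae (Eventually.of_forall fun x => mul_comm _ _)
  let fc : (T → ℝ) → Plane →ᵃ[ℝ] ℝ := fun c => ∑ i, c i • bary T i
  have hfc : ∀ c x, fc c x = ∑ i, c i * bary T i x := by
    intro c x
    have : ∀ s : Finset T, (∑ i ∈ s, c i • bary T i : Plane →ᵃ[ℝ] ℝ) x =
        ∑ i ∈ s, c i * bary T i x := by
      intro s
      induction s using Finset.induction_on with
      | empty => simp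
      | insert a s ha ih => rw [Finset.sum_insert ha, Finset.sum_insert ha, ← ih]; simp
    exact this _
  have hGc : ∀ c j, G.mulVec c j = ∫ x, fc c x * bary T j x ∂μ := by
    intro c j
    simp_rw [hfc, Finset.sum_mul, mul_assoc]
    rw [integral_finsetSum _ fun i _ => (h.integrable_affine_mul _ _).const_mul _]
    simp_rw [integral_const_mul]
    rw [Matrix.mulVec, dotProduct]
    exact Finset.sum_congr rfl fun i _ => by rw [mul_comm, hG.apply]
  obtain ⟨c, hc⟩ := exists_mulVec_eq_single hG ⟨N, hN⟩ (by
    intro c hc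
    have hN' : fc c N = c ⟨N, hN⟩ := by
      rw [hfc, Finset.sum_eq_single ⟨N, hN⟩]
      · rw [htri.bary_self hN, mul_one]
      · intro j _ hj
        rw [htri.bary_ne hN (fun h' => hj (Subtype.ext h')), mul_zero]
      · simp
    have hz : ∫ x, fc c x * fc c x ∂μ = 0 := by
      have : ∀ x, fc c x * fc c x = ∑ j, c j * (fc c x * bary T j x) := by
        intro x
        conv_lhs => enter [2]; rw [hfc]
        rw [Finset.mul_sum]
        exact Finset.sum_congr rfl fun j _ => by ring
      simp_rw [this]
      rw [integral_finsetSum _ fun i _ => (h.integrable_affine_mul _ _).const_mul _]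
      simp_rw [integral_const_mul, ← hGc, hc]
      simp
    have := h.sq_le_integral (fc c)
    rw [hz, hN'] at this
    have := h.pos
    by_contra hne
    have : 0 < κ * c ⟨N, hN⟩ ^ 2 := by positivity
    linarith)
  let c' : Plane → ℝ := fun y => if hy : y ∈ T then c ⟨y, hy⟩ else 0
  have hdual : M.IsDual μ N fun x => ∑ y ∈ T, c' y * M.hat y x := by
    refine ⟨Triangulation.isP1_sum_hat _ _, fun N' _ => ?_⟩
    have hae : (fun x => (∑ y ∈ T, c' y * M.hat y x) * M.hat N' x) =ᵐ[μ]
        fun x => fc c x * bary T N' x := by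
      filter_upwards [h.mem_hull] with x hx
      rw [Triangulation.hat_eq_bary hT N' hx, hfc, ← Finset.sum_coe_sort T]
      congr 1
      refine Finset.sum_congr rfl fun y _ => ?_
      simp only [c', y.2, dif_pos, Subtype.coe_eta]
      rw [Triangulation.hat_eq_bary hT y hx]
    rw [integral_congr_ae hae]
    by_cases hN' : N' ∈ T
    · rw [← hGc c ⟨N', hN'⟩, hc, Pi.single_apply]
      simp
    · rw [bary_of_notMem hN', if_neg (by rintro rfl; exact hN' hN)]
      simp
  exact ⟨_, hdual, fun ψ' hψ' => huniq _ _ hdual hψ'⟩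

/-- The norm of the dual basis function: `ψ` is its own representer, so `∫ ψ² = ψ(N) ≤ 1 / κ`. -/
lemma lintegral_dual_le {ψ : Plane → ℝ} (hψ : M.IsDual μ N ψ) (hT : T ∈ M.elements) (hN : N ∈ T) :
    ∫⁻ x, ‖ψ x‖ₑ ^ 2 ∂μ ≤ ENNReal.ofReal (1 / κ) := by
  obtain ⟨A, hA⟩ := hψ.1.2 T hT
  have hψA : ψ =ᵐ[μ] A := by filter_upwards [h.mem_hull] with x hx using hA hx
  have h1 := h.integral_dual_mul hψ hT hN A
  rw [integral_congr_ae (g := fun x => A x * A x)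
      (by filter_upwards [hψA] with x hx; rw [hx])] at h1
  have h2 := h.sq_le_integral A
  rw [h1] at h2
  have hκ := h.pos
  have h3 : A N ≤ 1 / κ := by
    rw [le_div_iff₀ hκ]
    by_contra hcon
    have : 0 < A N := by
      by_contra hneg
      nlinarith
    nlinarith
  calc ∫⁻ x, ‖ψ x‖ₑ ^ 2 ∂μ = ENNReal.ofReal (∫ x, A x * A x ∂μ) := by
        rw [ofReal_integral_eq_lintegral_ofReal (h.integrable_affine_mul A A)
          (Eventually.of_forall fun x => mul_self_nonneg _)]
        refine lintegral_congr_ae ?_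
        filter_upwards [hψA] with x hx
        rw [hx, Real.enorm_eq_ofReal_abs, ← ENNReal.ofReal_pow (abs_nonneg _), sq_abs, sq]
    _ ≤ _ := by rw [h1]; exact ENNReal.ofReal_le_ofReal h3

lemma dual_isDual (hT : T ∈ M.elements) (hN : N ∈ T) : M.IsDual μ N (M.dual μ N) := by
  obtain ⟨ψ, hψ, -⟩ := h.hasUniqueDual hT hN
  have hex : ∃ ψ, M.IsDual μ N ψ := ⟨ψ, hψ⟩
  rw [Triangulation.dual, dif_pos hex]
  exact hex.choose_spec

lemma dual_memLp (hT : T ∈ M.elements) (hN : N ∈ T) : MemLp (M.dual μ N) 2 μ := by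
  obtain ⟨A, hA⟩ := (h.dual_isDual hT hN).1.2 T hT
  have hψA : M.dual μ N =ᵐ[μ] A := by filter_upwards [h.mem_hull] with x hx using hA hx
  refine ⟨(h.integrable_of_continuousOn
    A.continuous_of_finiteDimensional.continuousOn).1.congr hψA.symm, ?_⟩
  refine (eLpNorm_two_le_of_sq_le (a := ENNReal.ofReal √(1 / κ)) ?_).trans_lt
    ENNReal.ofReal_lt_top
  rw [← ENNReal.ofReal_pow (Real.sqrt_nonneg _), Real.sq_sqrt (one_div_pos.2 h.pos).le]
  exact h.lintegral_dual_le (h.dual_isDual hT hN) hT hN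

lemma integrable_dual_mul (hT : T ∈ M.elements) (hN : N ∈ T) {w : Plane → ℝ} (hw : MemLp w 2 μ) :
    Integrable (fun x => M.dual μ N x * w x) μ :=
  (h.dual_memLp hT hN).integrable_mul hw

/-- The averaging functional differs from a constant `m` by at most the `L²` distance of the
function to `m`. -/
lemma enorm_integral_dual_sub_sq_le (hT : T ∈ M.elements) (hN : N ∈ T) {w : Plane → ℝ}
    (hw : MemLp w 2 μ) (m : ℝ) :
    ‖∫ x, M.dual μ N x * w x ∂μ - m‖ₑ ^ 2 ≤
      ENNReal.ofReal (1 / κ) * ∫⁻ x, ‖w x - m‖ₑ ^ 2 ∂μ := by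
  have := h.finite
  have hd := h.dual_isDual hT hN (M := M)
  have hwm : MemLp (fun x => w x - m) 2 μ := hw.sub (memLp_const m)
  have h1 : ∫ x, M.dual μ N x * w x ∂μ - m = ∫ x, M.dual μ N x * (w x - m) ∂μ := by
    have h2 := h.integral_dual_mul hd hT hN (AffineMap.const ℝ Plane m)
    simp only [AffineMap.const_apply] at h2
    have h3 := h.integrable_dual_mul hT hN (M := M) (memLp_const (p := 2) m)
    simp_rw [mul_sub]
    rw [integral_sub (h.integrable_dual_mul hT hN hw) h3, h2]
  rw [h1]
  calc ‖∫ x, M.dual μ N x * (w x - m) ∂μ‖ₑ ^ 2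
      ≤ (∫⁻ x, ‖M.dual μ N x‖ₑ * ‖w x - m‖ₑ ∂μ) ^ 2 := by
        gcongr
        refine (enorm_integral_le_lintegral_enorm _).trans (le_of_eq ?_)
        simp_rw [enorm_mul]
    _ ≤ (∫⁻ x, ‖M.dual μ N x‖ₑ ^ 2 ∂μ) * ∫⁻ x, ‖w x - m‖ₑ ^ 2 ∂μ :=
        lintegral_mul_sq_le (h.dual_memLp hT hN).1.enorm hwm.1.enorm
    _ ≤ _ := by
        gcongr
        exact h.lintegral_dual_le hd hT hN

end Controls

/-! ### The averaging measures and the fracture inside an element -/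

lemma isCompact_edgeUnion (S : Finset (Finset Plane)) : IsCompact (edgeUnion S) :=
  S.isCompact_biUnion fun _ _ => isCompact_hull _

/-- An affine function on `[0, 1]` is controlled at the end point by its mean square. -/
lemma quarter_sq_le_integral (c d : ℝ) : c ^ 2 / 4 ≤ ∫ s in (0 : ℝ)..1, (c + s * d) ^ 2 := by
  have h : ∀ s : ℝ, (c + s * d) ^ 2 = c ^ 2 + 2 * c * d * s + d ^ 2 * s ^ 2 := fun s => by ring
  simp_rw [h]
  rw [intervalIntegral.integral_add (Continuous.intervalIntegrable (by fun_prop) _ _)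
      (Continuous.intervalIntegrable (by fun_prop) _ _),
    intervalIntegral.integral_add (Continuous.intervalIntegrable (by fun_prop) _ _)
      (Continuous.intervalIntegrable (by fun_prop) _ _),
    intervalIntegral.integral_const_mul, intervalIntegral.integral_const_mul, integral_id,
    integral_pow]
  norm_num
  nlinarith [sq_nonneg (3 * c + 2 * d)]

lemma ofReal_le_eight_mul_add {a b c : ℝ} (hb : 0 ≤ b) (hc : 0 ≤ c) (h : a ≤ 8 * b + 2 * c) :
    ENNReal.ofReal a ≤ 8 * ENNReal.ofReal b + 2 * ENNReal.ofReal c := by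
  rw [show (8 : ℝ≥0∞) = ENNReal.ofReal 8 by norm_num,
    show (2 : ℝ≥0∞) = ENNReal.ofReal 2 by norm_num, ← ENNReal.ofReal_mul (by norm_num),
    ← ENNReal.ofReal_mul (by norm_num), ← ENNReal.ofReal_add (by positivity) (by positivity)]
  exact ENNReal.ofReal_le_ofReal h

/-- On a fat triangle, `f(N) = 2 f(y) - f(2 y - N)` is averaged over those `y` for which
`2 y - N` lies in the inscribed disc. -/
lemma controls_areaOn {T : Finset Plane} {ρ H : ℝ} (hρ : 0 < ρ) (hF : Fat ρ H T)
    {N : Plane} (hN : N ∈ T) : Controls (areaOn T) T N (ρ ^ 2 / 12) where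
  finite := ⟨by rw [areaOn, Measure.restrict_apply_univ]; exact (isCompact_hull T).measure_lt_top⟩
  mem_hull := ae_restrict_mem (isCompact_hull T).measurableSet
  pos := by positivity
  le f := by
    obtain ⟨z, hz⟩ := hF.exists_ball
    have hfc : Continuous f := f.continuous_of_finiteDimensional
    have hTc := (isCompact_hull T).isClosed
    set F : Plane → ℝ≥0∞ := (hull T).indicator fun x => ‖f x‖ₑ ^ 2 with hFdef
    have hFm : Measurable F := measurable_indicator_enorm_sq hTc hfc.continuousOn
    have hFint : ∫⁻ x, F x = ∫⁻ x, ‖f x‖ₑ ^ 2 ∂(areaOn T) :=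
      lintegral_indicator hTc.measurableSet _
    set B := Metric.closedBall ((1 / 2 : ℝ) • (N + z)) (ρ / 2) with hB
    have hrefl : ∀ y ∈ B, -N + (2 : ℝ) • y ∈ hull T := by
      intro y hy
      apply hz
      rw [hB, mem_closedBall_iff_norm] at hy
      rw [mem_closedBall_iff_norm,
        show -N + (2 : ℝ) • y - z = (2 : ℝ) • (y - (1 / 2 : ℝ) • (N + z)) by module, norm_smul,
        Real.norm_of_nonneg zero_le_two]
      linarith
    have hBsub : ∀ y ∈ B, y ∈ hull T := by
      intro y hy
      have h1 := (convex_convexHull ℝ (T : Set Plane)) (subset_hull hN) (hrefl y hy)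
        (a := 1 / 2) (b := 1 / 2) (by norm_num) (by norm_num) (by norm_num)
      rwa [show (1 / 2 : ℝ) • N + (1 / 2 : ℝ) • (-N + (2 : ℝ) • y) = y by module] at h1
    have hptw : ∀ y ∈ B, ENNReal.ofReal (f N ^ 2) ≤ 8 * F y + 2 * F (-N + (2 : ℝ) • y) := by
      intro y hy
      rw [hFdef, indicator_of_mem (hBsub y hy), indicator_of_mem (hrefl y hy)]
      have h1 := affine_apply_sum Finset.univ f ![2, -1] ![y, -N + (2 : ℝ) • y]
        (by simp; norm_num)
      simp only [Fin.sum_univ_two, Matrix.cons_val_zero, Matrix.cons_val_one] at h1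
      rw [show (2 : ℝ) • y + (-1 : ℝ) • (-N + (2 : ℝ) • y) = N by module] at h1
      rw [Real.enorm_eq_ofReal_abs, Real.enorm_eq_ofReal_abs, ← ENNReal.ofReal_pow (abs_nonneg _),
        ← ENNReal.ofReal_pow (abs_nonneg _), sq_abs, sq_abs]
      refine ofReal_le_eight_mul_add (sq_nonneg _) (sq_nonneg _) ?_
      rw [h1]
      nlinarith [sq_nonneg (2 * f y + f (-N + (2 : ℝ) • y))]
    have hvol : ENNReal.ofReal (3 * (ρ / 2) ^ 2) ≤ volume B :=
      le_volume_closedBall _ (by positivity)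
    have hmain : volume B * ENNReal.ofReal (f N ^ 2) ≤ 9 * ∫⁻ x, F x := by
      calc volume B * ENNReal.ofReal (f N ^ 2) = ∫⁻ y in B, ENNReal.ofReal (f N ^ 2) := by
            rw [setLIntegral_const, mul_comm]
        _ ≤ ∫⁻ y in B, (8 * F y + 2 * F (-N + (2 : ℝ) • y)) :=
            setLIntegral_mono' Metric.isClosed_closedBall.measurableSet hptw
        _ ≤ ∫⁻ y, (8 * F y + 2 * F (-N + (2 : ℝ) • y)) := setLIntegral_le_lintegral _ _
        _ = 8 * (∫⁻ y, F y) + 2 * (ENNReal.ofReal (2 ^ 2)⁻¹ * ∫⁻ y, F y) := by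
            rw [lintegral_add_left (hFm.const_mul _), lintegral_const_mul _ hFm,
              lintegral_const_mul _
                (show Measurable fun y => F (-N + (2 : ℝ) • y) from hFm.comp (by fun_prop)),
              lintegral_comp_smul_add F hFm _ two_ne_zero]
        _ ≤ 8 * (∫⁻ y, F y) + 1 * ∫⁻ y, F y := by
            refine add_le_add le_rfl ?_
            rw [← mul_assoc]
            gcongr
            rw [show (2 : ℝ≥0∞) = ENNReal.ofReal 2 by norm_num, ← ENNReal.ofReal_mul (by norm_num)]
            rw [ENNReal.ofReal_le_one]
            norm_num
        _ = 9 * ∫⁻ x, F x := by rw [← add_mul]; norm_num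
    rw [← hFint]
    have h9 : ENNReal.ofReal (ρ ^ 2 / 12 * f N ^ 2) * 9 ≤ 9 * ∫⁻ x, F x := by
      refine le_trans ?_ (le_trans (mul_le_mul_left hvol _) hmain)
      rw [show (9 : ℝ≥0∞) = ENNReal.ofReal 9 by norm_num, ← ENNReal.ofReal_mul (by positivity),
        ← ENNReal.ofReal_mul (by positivity)]
      exact ENNReal.ofReal_le_ofReal (le_of_eq (by ring))
    rw [mul_comm] at h9
    exact (ENNReal.mul_le_mul_iff_right (by norm_num) (by norm_num)).1 h9

namespace Triangulation

variable {M : Triangulation} {EΓ : Finset (Finset Plane)}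

lemma arcOn_edgeUnion_lt_top (hE : EΓ ⊆ M.edges) : (μH[1] : Measure Plane) (edgeUnion EΓ) < ⊤ := by
  refine (measure_biUnion_lt_top EΓ.finite_toSet fun e he => ?_)
  obtain ⟨a, b, -, rfl⟩ := Finset.card_eq_two.1 (mem_edges.1 (hE he)).2
  rw [hull_pair]
  exact hausdorffMeasure_segment_lt_top a b

lemma arcOn_finite (hE : EΓ ⊆ M.edges) {s : Set Plane} (hs : s ⊆ edgeUnion EΓ) :
    IsFiniteMeasure (arcOn s) :=
  ⟨by
    rw [arcOn, Measure.restrict_apply_univ]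
    exact (measure_mono hs).trans_lt (arcOn_edgeUnion_lt_top hE)⟩

/-- If a fracture edge of `T` ends at `N`, the part of the fracture in `T` controls the value at `N`
of affine functions, already by its restriction to that edge. -/
lemma controls_arcOn (hE : EΓ ⊆ M.edges) {T : Finset Plane} (hT : T ∈ M.elements) {ρ H : ℝ}
    (hρ : 0 < ρ) (hF : Fat ρ H T) {N : Plane} {e : Finset Plane} (he : e ∈ EΓ) (hN : N ∈ e)
    (heT : e ⊆ T) : Controls (arcOn (edgeUnion EΓ ∩ hull T)) T N (ρ / 2) where
  finite := arcOn_finite hE inter_subset_left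
  mem_hull := by
    have h := ae_restrict_mem (μ := (μH[1] : Measure Plane))
      ((isCompact_edgeUnion EΓ).measurableSet.inter (isCompact_hull T).measurableSet)
    filter_upwards [h] with x hx using hx.2
  pos := by positivity
  le f := by
    have hfc : Continuous f := f.continuous_of_finiteDimensional
    obtain ⟨b, hNb, rfl⟩ := exists_eq_pair (hE he) hN
    have hdist := hF.le_dist hρ (isTri hT) (heT hN) (heT (by simp)) hNb
    have hle : arcOn (segment ℝ N b) ≤ arcOn (edgeUnion EΓ ∩ hull T) := by
      rw [← hull_pair]
      exact arcOn_mono (subset_inter (hull_subset_edgeUnion he) (hull_mono heT))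
    refine le_trans ?_ (lintegral_mono' hle le_rfl)
    rw [lintegral_arcOn_segment hNb (by fun_prop)]
    have hval : ∀ s : ℝ, f (AffineMap.lineMap N b s) = f N + s * (f b - f N) := by
      intro s
      rw [AffineMap.apply_lineMap, AffineMap.lineMap_apply_module', smul_eq_mul, add_comm]
    have hI : ∫⁻ s in Icc (0 : ℝ) 1, ‖f (AffineMap.lineMap N b s)‖ₑ ^ 2 =
        ENNReal.ofReal (∫ s in (0 : ℝ)..1, (f N + s * (f b - f N)) ^ 2) := by
      rw [intervalIntegral.integral_of_le zero_le_one, ← integral_Icc_eq_integral_Ioc,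
        ofReal_integral_eq_lintegral_ofReal
          (Continuous.integrableOn_Icc (by fun_prop)) (Eventually.of_forall fun s => sq_nonneg _)]
      refine lintegral_congr fun s => ?_
      rw [hval, Real.enorm_eq_ofReal_abs, ← ENNReal.ofReal_pow (abs_nonneg _), sq_abs]
    rw [hI, ← ENNReal.ofReal_mul dist_nonneg]
    apply ENNReal.ofReal_le_ofReal
    have h1 := quarter_sq_le_integral (f N) (f b - f N)
    calc ρ / 2 * f N ^ 2 = 2 * ρ * (f N ^ 2 / 4) := by ring
      _ ≤ _ := by gcongr

open Classical in
/-- The fracture edges of the element `T`. -/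
def fracEdges (EΓ : Finset (Finset Plane)) (T : Finset Plane) : Finset (Finset Plane) :=
  {e ∈ EΓ | e ⊆ T}

lemma mem_fracEdges {T e : Finset Plane} : e ∈ fracEdges EΓ T ↔ e ∈ EΓ ∧ e ⊆ T := by
  simp [fracEdges]

lemma card_fracEdges_le (hE : EΓ ⊆ M.edges) {T : Finset Plane} (hT : T ∈ M.elements) :
    (fracEdges EΓ T).card ≤ 3 := by
  have h : fracEdges EΓ T ⊆ T.powersetCard 2 := fun e he => by
    rw [mem_fracEdges] at he
    exact Finset.mem_powersetCard.2 ⟨he.2, (mem_edges.1 (hE he.1)).2⟩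
  refine (Finset.card_le_card h).trans ?_
  rw [Finset.card_powersetCard, (mem_elements.1 hT).2]
  decide

/-- An edge that is not contained in the face `t` meets it at most in an end point. -/
lemma mem_and_mem_of_not_subset {e t : Finset Plane} (he : e ∈ M.edges) (ht : t ∈ M.complex.faces)
    (het : ¬ e ⊆ t) {x : Plane} (hxe : x ∈ hull e) (hxt : x ∈ hull t) : x ∈ e ∧ x ∈ t := by
  classical
  have hxi := mem_hull_inter (mem_edges.1 he).1 ht hxe hxt
  have hlt : (e ∩ t).card < 2 := by
    have h2 := (mem_edges.1 he).2
    have h3 : (e ∩ t).card < e.card := Finset.card_lt_card ⟨Finset.inter_subset_left, fun h =>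
      het (h.trans Finset.inter_subset_right)⟩
    omega
  obtain ⟨p, hp⟩ : (e ∩ t).Nonempty := by
    rw [Finset.nonempty_iff_ne_empty]
    intro h0
    rw [h0] at hxi
    simp [hull] at hxi
  have h1 : e ∩ t = {p} := by
    refine (Finset.eq_of_subset_of_card_le (Finset.singleton_subset_iff.2 hp) ?_).symm
    rw [Finset.card_singleton]; omega
  rw [h1, hull, Finset.coe_singleton, convexHull_singleton, mem_singleton_iff] at hxi
  rw [hxi]
  exact Finset.mem_inter.1 hp

/-- Up to vertices, which have length zero, the part of the fracture in an element consists of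
those edges of the element that are fracture edges. -/
lemma lintegral_arcOn_inter_le (hE : EΓ ⊆ M.edges) {T : Finset Plane} (hT : T ∈ M.elements)
    (F : Plane → ℝ≥0∞) :
    ∫⁻ x, F x ∂(arcOn (edgeUnion EΓ ∩ hull T)) ≤
      ∑ e ∈ fracEdges EΓ T, ∫⁻ x, F x ∂(arcOn (hull e)) := by
  classical
  have hsub : edgeUnion EΓ ∩ hull T ⊆ (⋃ e ∈ fracEdges EΓ T, hull e) ∪ (T : Set Plane) := by
    rintro x ⟨hx, hxT⟩
    simp only [edgeUnion, mem_iUnion, exists_prop] at hx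
    obtain ⟨e, he, hxe⟩ := hx
    by_cases heT : e ⊆ T
    · left
      simp only [mem_iUnion, exists_prop]
      exact ⟨e, mem_fracEdges.2 ⟨he, heT⟩, hxe⟩
    · right
      exact (mem_and_mem_of_not_subset (hE he) (mem_elements.1 hT).1 heT hxe hxT).2
  have hnull : (μH[1] : Measure Plane) (T : Set Plane) = 0 := by
    have := Measure.nullSingletonClass_hausdorff Plane (d := 1) one_pos
    exact T.finite_toSet.measure_zero _
  have hle : arcOn (edgeUnion EΓ ∩ hull T) ≤ ∑ e ∈ fracEdges EΓ T, arcOn (hull e) := by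
    calc arcOn (edgeUnion EΓ ∩ hull T)
        ≤ (μH[1]).restrict ((⋃ e ∈ fracEdges EΓ T, hull e) ∪ (T : Set Plane)) :=
          arcOn_mono hsub
      _ = (μH[1]).restrict (⋃ e ∈ fracEdges EΓ T, hull e) :=
          Measure.restrict_congr_set (union_ae_eq_left_of_ae_eq_empty (ae_eq_empty.2 hnull))
      _ ≤ _ := by
          generalize fracEdges EΓ T = S
          induction S using Finset.induction_on with
          | empty => simp
          | insert e S he ih =>
            rw [Finset.set_biUnion_insert, Finset.sum_insert he]
            exact (Measure.restrict_union_le _ _).trans (add_le_add le_rfl ih)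
  refine (lintegral_mono' hle le_rfl).trans (le_of_eq ?_)
  rw [lintegral_finsetSum_measure]

end Triangulation

/-! ### Poincaré and trace inequalities on triangles and discs -/

lemma gradient_sub_const (u : Plane → ℝ) (m : ℝ) (x : Plane) :
    ∇ (fun x => u x - m) x = ∇ u x := by
  rw [gradient, gradient, fderiv_sub_const]

/-- On the triangle `P, a, b` the determinant of the edge vectors is at least the area. -/
lemma IsTri.volume_le_det {T : Finset Plane} (h : IsTri T) {P a b : Plane} (hP : P ∈ T) (ha : a ∈ T)
    (hb : b ∈ T) (hPa : P ≠ a) (hPb : P ≠ b) (hab : a ≠ b) :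
    (a - P) 0 * (b - a) 1 - (a - P) 1 * (b - a) 0 ≠ 0 ∧
    volume (hull T) ≤ ENNReal.ofReal |(a - P) 0 * (b - a) 1 - (a - P) 1 * (b - a) 0| := by
  set x := a - P with hx
  set y := b - a with hy
  have hlin : ∀ N, ∀ p q, (bary T N).linear (p - q) = bary T N p - bary T N q := fun N p q => by
    simpa using (bary T N).linearMap_vsub p q
  have hbx : (bary T b).linear x = 0 := by
    rw [hlin, h.bary_ne ha hab.symm, h.bary_ne hP hPb.symm, sub_zero]
  have hby : (bary T b).linear y = 1 := by
    rw [hlin, h.bary_self hb, h.bary_ne ha hab.symm, sub_zero]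
  have hax : (bary T a).linear x = 1 := by
    rw [hlin, h.bary_self ha, h.bary_ne hP hPa.symm, sub_zero]
  have hPx : (bary T P).linear x = -1 := by
    rw [hlin, h.bary_self hP, h.bary_ne ha hPa, zero_sub]
  have hPy : (bary T P).linear y = 0 := by
    rw [hlin, h.bary_ne hb hPb, h.bary_ne ha hPa, sub_zero]
  have hd : x 0 * y 1 - x 1 * y 0 ≠ 0 := by
    intro hd
    have h0 : y 0 • x - x 0 • y = 0 := by
      ext i; fin_cases i <;> simp <;> linarith
    have h1 : y 1 • x - x 1 • y = 0 := by
      ext i; fin_cases i <;> simp <;> linarith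
    have e0 := congrArg (bary T b).linear h0
    have e1 := congrArg (bary T b).linear h1
    simp only [map_sub, map_smul, hbx, hby, smul_eq_mul, mul_zero, mul_one, map_zero,
      zero_sub, neg_eq_zero] at e0 e1
    have : x = 0 := by ext i; fin_cases i <;> simp [e0, e1]
    rw [this, map_zero] at hax
    exact zero_ne_one hax
  refine ⟨hd, ?_⟩
  have hTm := (isCompact_hull T).measurableSet
  have hobl := lintegral_oblique ((hull T).indicator 1) (measurable_one.indicator hTm) P x y hd
  rw [lintegral_indicator_one hTm] at hobl
  have hle : ∫⁻ t : ℝ, ∫⁻ s : ℝ, (hull T).indicator 1 (P + (t • x + s • y)) ≤ (1 : ℝ≥0∞) := by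
    have hptw : ∀ t s : ℝ, (hull T).indicator (1 : Plane → ℝ≥0∞) (P + (t • x + s • y)) ≤
        (Icc (0 : ℝ) 1).indicator 1 t * (Icc (0 : ℝ) 1).indicator 1 s := by
      intro t s
      by_cases hmem : P + (t • x + s • y) ∈ hull T
      · have hval : ∀ N, bary T N (P + (t • x + s • y)) =
            bary T N P + (t * (bary T N).linear x + s * (bary T N).linear y) := by
          intro N
          have := hlin N (P + (t • x + s • y)) P
          rw [add_sub_cancel_left, map_add, map_smul, map_smul, smul_eq_mul, smul_eq_mul] at this
          linarith
        have e1 := hval b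
        have e2 := hval P
        rw [hbx, hby, h.bary_ne hP hPb.symm] at e1
        rw [hPx, hPy, h.bary_self hP] at e2
        have hs : s ∈ Icc (0 : ℝ) 1 := by
          constructor <;> linarith [h.bary_nonneg hmem b, h.bary_le_one hmem b]
        have ht : t ∈ Icc (0 : ℝ) 1 := by
          constructor <;> linarith [h.bary_nonneg hmem P, h.bary_le_one hmem P]
        rw [indicator_of_mem hmem, indicator_of_mem hs, indicator_of_mem ht]
        simp
      · rw [indicator_of_notMem hmem]; exact zero_le
    calc ∫⁻ t : ℝ, ∫⁻ s : ℝ, (hull T).indicator 1 (P + (t • x + s • y))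
        ≤ ∫⁻ t : ℝ, ∫⁻ s : ℝ, (Icc (0 : ℝ) 1).indicator 1 t * (Icc (0 : ℝ) 1).indicator 1 s :=
          lintegral_mono fun t => lintegral_mono fun s => hptw t s
      _ = 1 := by
          have hm : Measurable ((Icc (0 : ℝ) 1).indicator (1 : ℝ → ℝ≥0∞)) :=
            measurable_one.indicator measurableSet_Icc
          simp_rw [lintegral_const_mul _ hm, lintegral_indicator_one measurableSet_Icc]
          simp [lintegral_indicator_one measurableSet_Icc]
  have hd0 : 0 < |x 0 * y 1 - x 1 * y 0| := abs_pos.2 hd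
  rw [hobl, ENNReal.ofReal_inv_of_pos hd0, ENNReal.inv_mul_le_iff
    (by rw [ne_eq, ENNReal.ofReal_eq_zero, not_le]; exact hd0) ENNReal.ofReal_ne_top, mul_one] at hle
  exact hle

lemma ofReal_mul_three_add {a b c : ℝ} (ha : 0 ≤ a) (hb : 0 ≤ b) (hc : 0 ≤ c) (I : ℝ≥0∞) :
    ENNReal.ofReal c * (3 * (ENNReal.ofReal a * I) + ENNReal.ofReal b * I) =
      ENNReal.ofReal (c * (3 * a + b)) * I := by
  rw [ENNReal.ofReal_mul hc, ENNReal.ofReal_add (by positivity) hb,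
    ENNReal.ofReal_mul (by norm_num : (0 : ℝ) ≤ 3),
    show ENNReal.ofReal 3 = (3 : ℝ≥0∞) by norm_num]
  ring

/-- Poincaré and trace inequality on a triangle, with the same constant `m`. -/
lemma Fat.exists_poincare_trace {T : Finset Plane} (h : IsTri T) {ρ H : ℝ} (hρ : 0 < ρ)
    (hF : Fat ρ H T) {u : Plane → ℝ} (hu : ∀ p ∈ hull T, ContDiffAt ℝ 1 u p) :
    ∃ m : ℝ,
      ∫⁻ x in hull T, ‖u x - m‖ₑ ^ 2 ≤
        ENNReal.ofReal (4 * H ^ 2) * ∫⁻ x in hull T, ‖∇ u x‖ₑ ^ 2 ∧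
      ∀ a ∈ T, ∀ b ∈ T, a ≠ b → ∫⁻ x, ‖u x - m‖ₑ ^ 2 ∂(arcOn (hull {a, b})) ≤
        ENNReal.ofReal (5 * H ^ 3 / ρ ^ 2) * ∫⁻ x in hull T, ‖∇ u x‖ₑ ^ 2 := by
  have hTc := (isCompact_hull T).isClosed
  have hconv : Convex ℝ (hull T) := convex_convexHull ℝ _
  have hvol := hF.le_volume hρ
  have hH : 0 < H := by linarith [hF.radius_le hρ]
  obtain ⟨m, hm⟩ := exists_poincare hTc hconv
    (fun h0 => by
      rw [h0, nonpos_iff_eq_zero, ENNReal.ofReal_eq_zero] at hvol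
      have : 0 < 3 * ρ ^ 2 := by positivity
      linarith)
    (isCompact_hull T).measure_lt_top.ne hF.diam_le hu
  refine ⟨m, hm, fun a ha b hb hab => ?_⟩
  obtain ⟨P, hP, hPa, hPb⟩ : ∃ P ∈ T, P ≠ a ∧ P ≠ b := by
    by_contra! hcon
    have hsub : T ⊆ {a, b} := fun x hx => by
      rw [Finset.mem_insert, Finset.mem_singleton]
      by_cases hxa : x = a
      · exact Or.inl hxa
      · exact Or.inr (hcon x hx hxa)
    have h1 := Finset.card_le_card hsub
    have h2 := h.2
    rw [Finset.card_pair hab] at h1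
    omega
  obtain ⟨hd, hvd⟩ := h.volume_le_det hP ha hb hPa hPb hab
  have hedge : ∀ s ∈ Icc (0 : ℝ) 1, a + s • (b - a) ∈ hull T := fun s hs =>
    hconv.add_smul_sub_mem (subset_hull ha) (subset_hull hb) hs
  have htr := lintegral_trace_le hTc (P := P) hd (D := H) (w := fun x => u x - m)
    (fun t ht s hs => by
      rw [show a - P + s • (b - a) = (a + s • (b - a)) - P by module]
      exact hconv.add_smul_sub_mem (subset_hull hP) (hedge s hs) ht)
    (fun s hs => by
      rw [show a - P + s • (b - a) = (a + s • (b - a)) - P by module]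
      exact hF.diam_le _ (subset_hull hP) _ (hedge s hs))
    (fun p hp => (hu p hp).sub contDiffAt_const)
  set d := (a - P) 0 * (b - a) 1 - (a - P) 1 * (b - a) 0
  set I := ∫⁻ x in hull T, ‖∇ u x‖ₑ ^ 2 with hI
  have hd3 : 3 * ρ ^ 2 ≤ |d| :=
    (ENNReal.ofReal_le_ofReal_iff (abs_nonneg _)).1 (hvol.trans hvd)
  simp only [gradient_sub_const, ← hI] at htr
  have hcm : AEMeasurable (fun x => ‖u x - m‖ₑ ^ 2) (arcOn (segment ℝ a b)) := by
    have hsub : segment ℝ a b ⊆ hull T := hconv.segment_subset (subset_hull ha) (subset_hull hb)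
    have hmeas : MeasurableSet (segment ℝ a b) := by
      rw [← hull_pair]; exact (isCompact_hull _).measurableSet
    have : ContinuousOn (fun x => u x - m) (segment ℝ a b) := fun x hx =>
      ((hu x (hsub hx)).continuousAt.sub continuousAt_const).continuousWithinAt
    exact (this.aemeasurable hmeas).enorm.pow_const 2
  rw [hull_pair, lintegral_arcOn_segment hab hcm, ← restrict_Ioc_eq_restrict_Icc]
  have hline : ∀ s : ℝ, (AffineMap.lineMap a b s : Plane) = P + (a - P + s • (b - a)) := by
    intro s
    rw [AffineMap.lineMap_apply_module']
    module
  simp only [hline]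
  calc ENNReal.ofReal (dist a b) * ∫⁻ s in Ioc (0 : ℝ) 1, ‖u (P + (a - P + s • (b - a))) - m‖ₑ ^ 2
      ≤ ENNReal.ofReal (dist a b) * (ENNReal.ofReal |d|⁻¹ *
          (3 * (ENNReal.ofReal (4 * H ^ 2) * I) + ENNReal.ofReal (H ^ 2) * I)) := by
        gcongr
        exact htr.trans (by gcongr)
    _ = ENNReal.ofReal (dist a b * (|d|⁻¹ * (3 * (4 * H ^ 2) + H ^ 2))) * I := by
        rw [ENNReal.ofReal_mul dist_nonneg, ofReal_mul_three_add (by positivity) (by positivity)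
          (by positivity), mul_assoc]
    _ ≤ _ := by
        gcongr
        have h1 : dist a b ≤ H := hF.dist_le (subset_hull ha) (subset_hull hb)
        have h2 : |d|⁻¹ ≤ (3 * ρ ^ 2)⁻¹ := inv_anti₀ (by positivity) hd3
        calc dist a b * (|d|⁻¹ * (3 * (4 * H ^ 2) + H ^ 2))
            ≤ H * ((3 * ρ ^ 2)⁻¹ * (3 * (4 * H ^ 2) + H ^ 2)) := by gcongr
          _ = 13 / 3 * H ^ 3 / ρ ^ 2 := by field_simp; ring
          _ ≤ _ := by gcongr; norm_num

/-- Poincaré inequality on a disc, and trace inequality on its radii, with the same constant `m`. -/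
lemma exists_poincare_trace_closedBall {N : Plane} {r : ℝ} (hr : 0 < r) {u : Plane → ℝ}
    (hu : ∀ p ∈ Metric.closedBall N r, ContDiffAt ℝ 1 u p) :
    ∃ m : ℝ,
      ∫⁻ x in Metric.closedBall N r, ‖u x - m‖ₑ ^ 2 ≤
        ENNReal.ofReal (16 * r ^ 2) * ∫⁻ x in Metric.closedBall N r, ‖∇ u x‖ₑ ^ 2 ∧
      ∀ ξ : Plane, ‖ξ‖ = r → ∫⁻ s in Ioc (0 : ℝ) 1, ‖u (N + s • ξ) - m‖ₑ ^ 2 ≤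
        52 * ∫⁻ x in Metric.closedBall N r, ‖∇ u x‖ₑ ^ 2 := by
  set K := Metric.closedBall N r with hK
  have hKc : IsClosed K := Metric.isClosed_closedBall
  have hconv : Convex ℝ K := convex_closedBall N r
  obtain ⟨m, hm⟩ := exists_poincare hKc hconv (D := 2 * r)
    (Metric.measure_closedBall_pos volume N hr).ne' measure_closedBall_lt_top.ne
    (fun x hx y hy => by
      rw [← dist_eq_norm]
      have h1 := Metric.mem_closedBall.1 hx
      have h2 := Metric.mem_closedBall.1 hy
      linarith [dist_triangle_right y x N]) hu
  refine ⟨m, hm.trans (le_of_eq (by ring_nf)), fun ξ hξ => ?_⟩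
  -- the triangle with vertices `N + J ξ`, `N`, `N + ξ`, where `J` is the rotation by a right angle
  set J : Plane := !₂[-ξ 1, ξ 0] with hJ
  have hnorm : ξ 0 ^ 2 + ξ 1 ^ 2 = r ^ 2 := by
    rw [← hξ, EuclideanSpace.norm_sq_eq, Fin.sum_univ_two]
    simp
  have hJn : ‖J‖ = r := by
    rw [← abs_of_pos hr, ← abs_of_nonneg (norm_nonneg J), ← sq_eq_sq_iff_abs_eq_abs,
      EuclideanSpace.norm_sq_eq, Fin.sum_univ_two, ← hnorm]
    simp [hJ]
    ring
  have hdet : (-J) 0 * ξ 1 - (-J) 1 * ξ 0 = r ^ 2 := by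
    rw [← hnorm]
    simp [hJ]
    ring
  have hNJ : N + J ∈ K := by rw [hK, mem_closedBall_iff_norm]; simp [hJn]
  have hNξ : N + ξ ∈ K := by rw [hK, mem_closedBall_iff_norm]; simp [hξ]
  have hN : N ∈ K := Metric.mem_closedBall_self hr.le
  have hedge : ∀ s ∈ Icc (0 : ℝ) 1, N + s • ξ ∈ K := fun s hs => by
    have := hconv.add_smul_sub_mem hN hNξ hs
    rwa [add_sub_cancel_left] at this
  have htr := lintegral_trace_le hKc (P := N + J) (x := -J) (y := ξ)
    (by rw [hdet]; positivity) (D := 2 * r) (w := fun x => u x - m)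
    (fun t ht s hs => by
      have := hconv.add_smul_sub_mem hNJ (hedge s hs) ht
      rwa [show N + s • ξ - (N + J) = -J + s • ξ by module] at this)
    (fun s hs => by
      refine (norm_add_le _ _).trans ?_
      rw [norm_neg, hJn, norm_smul, hξ, Real.norm_of_nonneg hs.1]
      nlinarith [hs.2])
    (fun p hp => (hu p hp).sub contDiffAt_const)
  set I := ∫⁻ x in K, ‖∇ u x‖ₑ ^ 2 with hI
  rw [hdet] at htr
  simp only [gradient_sub_const, ← hI] at htr
  have hline : ∀ s : ℝ, N + J + (-J + s • ξ) = N + s • ξ := fun s => by module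
  simp only [hline] at htr
  calc ∫⁻ s in Ioc (0 : ℝ) 1, ‖u (N + s • ξ) - m‖ₑ ^ 2
      ≤ ENNReal.ofReal |r ^ 2|⁻¹ * (3 * (ENNReal.ofReal (4 * (2 * r) ^ 2) * I) +
          ENNReal.ofReal ((2 * r) ^ 2) * I) := htr.trans (by gcongr)
    _ = ENNReal.ofReal (|r ^ 2|⁻¹ * (3 * (4 * (2 * r) ^ 2) + (2 * r) ^ 2)) * I := by
        rw [ofReal_mul_three_add (by positivity) (by positivity) (by positivity)]
    _ = 52 * I := by
        rw [abs_of_pos (by positivity),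
          show (r ^ 2)⁻¹ * (3 * (4 * (2 * r) ^ 2) + (2 * r) ^ 2) = 52 by field_simp; norm_num]
        norm_num

namespace Triangulation

/-! ### Localization to the star of a node -/

variable {M : Triangulation} {Ω : Set Plane}

variable (M) in
/-- The star of `N`, the union of the elements that contain the node `N`. -/
def star (N : Plane) : Set Plane := ⋃ T ∈ M.adjacent N, hull T

variable (M Ω) in
/-- The open star of `N` in `Ω`: the points of `Ω` in no element other than those at `N`. -/
def openStar (N : Plane) : Set Plane := Ω \ ⋃ T ∈ M.elements \ M.adjacent N, hull T

lemma isCompact_star (N : Plane) : IsCompact (M.star N) :=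
  (M.adjacent N).isCompact_biUnion fun _ _ => isCompact_hull _

lemma isOpen_openStar (hΩ : IsOpen Ω) (N : Plane) : IsOpen (M.openStar Ω N) :=
  hΩ.sdiff ((M.elements \ M.adjacent N).isCompact_biUnion fun _ _ => isCompact_hull _).isClosed

lemma subset_star {N : Plane} {T : Finset Plane} (hT : T ∈ M.adjacent N) : hull T ⊆ M.star N :=
  subset_biUnion_of_mem (u := fun T => hull T) hT

lemma Triangulates.exists_mem_hull (h : M.Triangulates Ω) {p : Plane} (hp : p ∈ closure Ω) :
    ∃ T ∈ M.elements, p ∈ hull T := by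
  rw [← h.1, space_eq, mem_iUnion] at hp
  obtain ⟨T, hT⟩ := hp
  exact ⟨T, T.2, hT⟩

lemma hull_subset_closure (h : M.Triangulates Ω) {T : Finset Plane} (hT : T ∈ M.elements) :
    hull T ⊆ closure Ω := by
  rw [← h.1, space_eq]
  exact subset_iUnion (fun T : M.elements => hull T.1) ⟨T, hT⟩

lemma mem_openStar_or {N p : Plane} (hp : p ∈ Ω) :
    p ∈ M.openStar Ω N ∨ ∃ T ∈ M.elements, N ∉ T ∧ p ∈ hull T := by
  by_cases h : p ∈ ⋃ T ∈ M.elements \ M.adjacent N, hull T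
  · right
    simp only [mem_iUnion, exists_prop, Finset.mem_sdiff, mem_adjacent, not_and] at h
    obtain ⟨T, ⟨hT, hN⟩, hpT⟩ := h
    exact ⟨T, hT, hN hT, hpT⟩
  · exact Or.inl ⟨hp, h⟩

lemma openStar_subset_star (h : M.Triangulates Ω) (N : Plane) : M.openStar Ω N ⊆ M.star N := by
  rintro p ⟨hp, hpn⟩
  obtain ⟨T, hT, hpT⟩ := h.exists_mem_hull (subset_closure hp)
  by_cases hN : N ∈ T
  · exact subset_star (mem_adjacent.2 ⟨hT, hN⟩) hpT
  · refine absurd ?_ hpn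
    simp only [mem_iUnion, exists_prop, Finset.mem_sdiff, mem_adjacent, not_and]
    exact ⟨T, ⟨hT, fun _ => hN⟩, hpT⟩

/-- Near `N`, an element that does not contain `N` does not meet the star of `N`: the barycentric
coordinate of `N` is positive there. -/
lemma notMem_star {ρ H : ℝ} (hρ : 0 < ρ) (hfat : ∀ T ∈ M.elements, Fat ρ H T) {N p : Plane}
    (hp : ‖N - p‖ < 2 * ρ) {T : Finset Plane} (hT : T ∈ M.elements) (hN : N ∉ T)
    (hpT : p ∈ hull T) : p ∉ M.star N := by
  intro hs
  simp only [star, mem_iUnion, exists_prop, mem_adjacent] at hs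
  obtain ⟨T', ⟨hT', hN'⟩, hpT'⟩ := hs
  have h1 := (hfat T' hT').abs_bary_sub_le hρ (isTri hT') N N p
  have h0 : bary T' N p = 0 := by
    rw [← hat_eq_bary hT' N hpT', hat_eq_bary hT N hpT, bary_of_notMem hN]
    rfl
  rw [(isTri hT').bary_self hN', h0, sub_zero, abs_one, le_div_iff₀ (by positivity)] at h1
  linarith

variable (M Ω) in
/-- The part of a function that lives in the star of `N`. If `N` is a point where several parts of
`Ω` touch, or if other parts of `Ω` come close to `N`, this removes everything that is not connected
with `N`. A test function stays smooth near `N` since it vanishes near the boundary of `Ω`. -/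
def starPart (N : Plane) (φ : Plane → ℝ) : Plane → ℝ := (M.openStar Ω N).indicator φ

lemma starPart_eventuallyEq (hΩ : IsOpen Ω) (hM : M.Triangulates Ω) {ρ H : ℝ} (hρ : 0 < ρ)
    (hfat : ∀ T ∈ M.elements, Fat ρ H T) {φ : Plane → ℝ} (hφ : IsTest Ω φ) {N p : Plane}
    (hp : ‖N - p‖ < 2 * ρ) :
    (p ∈ M.star N ∧ M.starPart Ω N φ =ᶠ[𝓝 p] φ) ∨ M.starPart Ω N φ =ᶠ[𝓝 p] fun _ => 0 := by
  by_cases hpΩ : p ∈ Ω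
  · rcases mem_openStar_or (M := M) (N := N) hpΩ with h | ⟨T, hT, hN, hpT⟩
    · left
      refine ⟨openStar_subset_star hM N h, ?_⟩
      filter_upwards [(isOpen_openStar hΩ N).mem_nhds h] with q hq
      rw [starPart, indicator_of_mem hq]
    · right
      have h1 := (isCompact_star (M := M) N).isClosed.isOpen_compl.mem_nhds
        (notMem_star hρ hfat hp hT hN hpT)
      filter_upwards [h1] with q hq
      rw [starPart, indicator_of_notMem fun h => hq (openStar_subset_star hM N h)]
  · right
    have h1 : φ =ᶠ[𝓝 p] 0 := notMem_tsupport_iff_eventuallyEq.1 fun h => hpΩ (hφ.2.2 h)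
    filter_upwards [h1] with q hq
    by_cases hqs : q ∈ M.openStar Ω N
    · rw [starPart, indicator_of_mem hqs, hq]; rfl
    · rw [starPart, indicator_of_notMem hqs]

lemma starPart_eq {ρ H : ℝ} (hρ : 0 < ρ)
    (hfat : ∀ T ∈ M.elements, Fat ρ H T) {φ : Plane → ℝ} (hφ : IsTest Ω φ) {N p : Plane}
    (hp : ‖N - p‖ < 2 * ρ) (hps : p ∈ M.star N) : M.starPart Ω N φ p = φ p := by
  by_cases hpΩ : p ∈ Ω
  · rcases mem_openStar_or (M := M) (N := N) hpΩ with h | ⟨T, hT, hN, hpT⟩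
    · rw [starPart, indicator_of_mem h]
    · exact absurd hps (notMem_star hρ hfat hp hT hN hpT)
  · rw [starPart, indicator_of_notMem fun h => hpΩ h.1,
      image_eq_zero_of_notMem_tsupport fun h => hpΩ (hφ.2.2 h)]

lemma contDiffAt_starPart (hΩ : IsOpen Ω) (hM : M.Triangulates Ω) {ρ H : ℝ} (hρ : 0 < ρ)
    (hfat : ∀ T ∈ M.elements, Fat ρ H T) {φ : Plane → ℝ} (hφ : IsTest Ω φ) {N p : Plane}
    (hp : ‖N - p‖ < 2 * ρ) : ContDiffAt ℝ 1 (M.starPart Ω N φ) p := by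
  rcases starPart_eventuallyEq hΩ hM hρ hfat hφ hp with ⟨-, h⟩ | h
  · exact (hφ.1.contDiffAt.of_le (by norm_num)).congr_of_eventuallyEq h
  · exact contDiffAt_const.congr_of_eventuallyEq h

lemma enorm_gradient_starPart_le (hΩ : IsOpen Ω) (hM : M.Triangulates Ω) {ρ H : ℝ} (hρ : 0 < ρ)
    (hfat : ∀ T ∈ M.elements, Fat ρ H T) {φ : Plane → ℝ} (hφ : IsTest Ω φ) {N p : Plane}
    (hp : ‖N - p‖ < 2 * ρ) :
    ‖∇ (M.starPart Ω N φ) p‖ₑ ^ 2 ≤ (M.star N).indicator (fun x => ‖∇ φ x‖ₑ ^ 2) p := by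
  rcases starPart_eventuallyEq hΩ hM hρ hfat hφ hp with ⟨hps, h⟩ | h
  · rw [indicator_of_mem hps, gradient, h.fderiv_eq, gradient]
  · rw [gradient, h.fderiv_eq]
    simp

/-- A boundary node is the end point of a boundary edge. -/
lemma Triangulates.exists_boundary_edge (hM : M.Triangulates Ω) {N : Plane} (hN : N ∈ M.nodes)
    (hfr : N ∈ frontier Ω) :
    ∃ b, b ≠ N ∧ hull {N, b} ⊆ frontier Ω ∧ ∃ T ∈ M.adjacent N, b ∈ T := by
  obtain ⟨S, hS, hfS⟩ := hM.2
  rw [hfS] at hfr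
  simp only [edgeUnion, mem_iUnion, exists_prop] at hfr
  obtain ⟨E, hE, hNE⟩ := hfr
  obtain ⟨T₀, hT₀, hNT₀⟩ := exists_mem_of_mem_nodes hN
  have hmem : N ∈ E := mem_of_mem_hull (mem_elements.1 hT₀).1 (mem_edges.1 (hS hE)).1 hNT₀ hNE
  obtain ⟨b, hb, hne⟩ : ∃ b ∈ E, b ≠ N :=
    Finset.exists_mem_ne (by rw [(mem_edges.1 (hS hE)).2]; norm_num) N
  obtain ⟨T, hT, hET⟩ := exists_element_of_edge (hS hE)
  refine ⟨b, hne, ?_, T, mem_adjacent.2 ⟨hT, hET hmem⟩, hET hb⟩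
  rw [hfS]
  refine (hull_mono fun x hx => ?_).trans (hull_subset_edgeUnion hE)
  rcases Finset.mem_insert.1 hx with rfl | hx
  · exact hmem
  · rwa [Finset.mem_singleton.1 hx]

lemma add_smul_mem_hull {T : Finset Plane} {N b : Plane} {c : ℝ} (hN : N ∈ hull T) (hb : b ∈ hull T)
    (hc0 : 0 ≤ c) (hc1 : c ≤ 1) : N + c • (b - N) ∈ hull T :=
  (convex_convexHull ℝ (T : Set Plane)).add_smul_sub_mem hN hb ⟨hc0, hc1⟩

/-- The Poincaré and the trace inequality in the part of the star of `N` in the disc of radius `r`,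
applied to the star part of a test function. If `N` is a boundary node, the constant is controlled
since the test function vanishes on a radius of the disc, namely on a boundary edge. -/
lemma exists_star_estimate (hΩ : IsOpen Ω) (hM : M.Triangulates Ω) {ρ H : ℝ} (hρ : 0 < ρ)
    (hfat : ∀ T ∈ M.elements, Fat ρ H T) {φ : Plane → ℝ} (hφ : IsTest Ω φ) {N : Plane} {r : ℝ}
    (hr : 0 < r) (hrρ : r ≤ ρ) :
    ∃ m : ℝ,
      (∀ T ∈ M.adjacent N, ∫⁻ x in hull T ∩ Metric.closedBall N r, ‖φ x - m‖ₑ ^ 2 ≤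
        ENNReal.ofReal (16 * r ^ 2) *
          ∫⁻ x in M.star N ∩ Metric.closedBall N r, ‖∇ φ x‖ₑ ^ 2) ∧
      (∀ T ∈ M.adjacent N, ∀ b ∈ T, b ≠ N →
        ∫⁻ s in Ioc (0 : ℝ) 1, ‖φ (N + s • (r / ‖b - N‖) • (b - N)) - m‖ₑ ^ 2 ≤
          52 * ∫⁻ x in M.star N ∩ Metric.closedBall N r, ‖∇ φ x‖ₑ ^ 2) ∧
      (N ∈ M.nodes → N ∈ frontier Ω →
        ‖m‖ₑ ^ 2 ≤ 52 * ∫⁻ x in M.star N ∩ Metric.closedBall N r, ‖∇ φ x‖ₑ ^ 2) := by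
  set u := M.starPart Ω N φ with hu
  set B := Metric.closedBall N r with hB
  have hBm : MeasurableSet B := Metric.isClosed_closedBall.measurableSet
  have hnear : ∀ p ∈ B, ‖N - p‖ < 2 * ρ := fun p hp => by
    rw [hB, mem_closedBall_iff_norm'] at hp
    linarith
  obtain ⟨m, hm1, hm2⟩ := exists_poincare_trace_closedBall hr (u := u)
    fun p hp => contDiffAt_starPart hΩ hM hρ hfat hφ (hnear p hp)
  have hI : ∫⁻ x in B, ‖∇ u x‖ₑ ^ 2 ≤ ∫⁻ x in M.star N ∩ B, ‖∇ φ x‖ₑ ^ 2 := by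
    rw [← setLIntegral_indicator (isCompact_star N).measurableSet]
    exact setLIntegral_mono' hBm fun p hp =>
      enorm_gradient_starPart_le hΩ hM hρ hfat hφ (hnear p hp)
  have hedge : ∀ T ∈ M.adjacent N, ∀ b ∈ T, b ≠ N →
      ∫⁻ s in Ioc (0 : ℝ) 1, ‖φ (N + s • (r / ‖b - N‖) • (b - N)) - m‖ₑ ^ 2 ≤
        52 * ∫⁻ x in M.star N ∩ B, ‖∇ φ x‖ₑ ^ 2 := by
    intro T hT b hb hne
    obtain ⟨hTe, hNT⟩ := mem_adjacent.1 hT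
    have hlen := (hfat T hTe).le_dist hρ (isTri hTe) hb hNT hne
    rw [dist_eq_norm] at hlen
    have hpos : 0 < ‖b - N‖ := by linarith
    have hn : ‖(r / ‖b - N‖) • (b - N)‖ = r := by
      rw [norm_smul, Real.norm_of_nonneg (by positivity)]
      field_simp
    refine le_trans (le_of_eq (setLIntegral_congr_fun measurableSet_Ioc fun s hs => ?_))
      ((hm2 _ hn).trans (by gcongr))
    have hmem : N + s • (r / ‖b - N‖) • (b - N) ∈ hull T := by
      rw [smul_smul]
      refine add_smul_mem_hull (subset_hull hNT) (subset_hull hb)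
        (mul_nonneg hs.1.le (by positivity)) ?_
      refine mul_le_one₀ hs.2 (by positivity) ?_
      rw [div_le_one hpos]
      linarith
    have hmemB : N + s • (r / ‖b - N‖) • (b - N) ∈ B := by
      rw [hB, mem_closedBall_iff_norm, add_sub_cancel_left, norm_smul, hn,
        Real.norm_of_nonneg hs.1.le]
      nlinarith [hs.2]
    rw [hu, starPart_eq hρ hfat hφ (hnear _ hmemB) (subset_star hT hmem)]
  refine ⟨m, fun T hT => ?_, hedge, fun hN hfr => ?_⟩
  · calc ∫⁻ x in hull T ∩ B, ‖φ x - m‖ₑ ^ 2 = ∫⁻ x in hull T ∩ B, ‖u x - m‖ₑ ^ 2 := by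
          refine setLIntegral_congr_fun ((isCompact_hull T).measurableSet.inter hBm) fun p hp => ?_
          rw [hu, starPart_eq hρ hfat hφ (hnear _ hp.2) (subset_star hT hp.1)]
      _ ≤ ∫⁻ x in B, ‖u x - m‖ₑ ^ 2 := lintegral_mono_set inter_subset_right
      _ ≤ _ := hm1.trans (by gcongr)
  · obtain ⟨b, hne, hsub, T, hT, hb⟩ := hM.exists_boundary_edge hN hfr
    obtain ⟨hTe, hNT⟩ := mem_adjacent.1 hT
    have hlen := (hfat T hTe).le_dist hρ (isTri hTe) hb hNT hne
    rw [dist_eq_norm] at hlen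
    have hpos : 0 < ‖b - N‖ := by linarith
    refine le_trans (le_of_eq ?_) (hedge T hT b hb hne)
    have hzero : ∀ s ∈ Ioc (0 : ℝ) 1, ‖m‖ₑ ^ 2 =
        ‖φ (N + s • (r / ‖b - N‖) • (b - N)) - m‖ₑ ^ 2 := by
      intro s hs
      have hmem : N + s • (r / ‖b - N‖) • (b - N) ∈ hull {N, b} := by
        rw [smul_smul]
        refine add_smul_mem_hull (subset_hull (by simp)) (subset_hull (by simp))
          (mul_nonneg hs.1.le (by positivity)) ?_
        refine mul_le_one₀ hs.2 (by positivity) ?_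
        rw [div_le_one hpos]
        linarith
      have hout : N + s • (r / ‖b - N‖) • (b - N) ∉ Ω := fun h =>
        (hΩ.frontier_eq ▸ hsub hmem).2 h
      rw [image_eq_zero_of_notMem_tsupport fun h => hout (hφ.2.2 h), zero_sub, enorm_neg]
    rw [← setLIntegral_congr_fun measurableSet_Ioc hzero]
    simp

end Triangulation

namespace Triangulation

/-! ### Nodal values of the interpolation of a test function -/

variable {M : Triangulation} {Ω : Set Plane} {EΓ : Finset (Finset Plane)}

lemma mem_fracAdjacent {N : Plane} {T : Finset Plane} :
    T ∈ M.fracAdjacent EΓ N ↔ T ∈ M.adjacent N ∧ ∃ E ∈ EΓ, N ∈ E ∧ E ⊆ T := by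
  simp [fracAdjacent]

lemma mem_freeNodes {N : Plane} : N ∈ M.freeNodes Ω ↔ N ∈ M.nodes ∧ N ∉ frontier Ω := by
  simp [freeNodes]

variable (M Ω EΓ) in
open Classical in
/-- The coefficient of the hat function of `N` in the interpolation; zero for fixed nodes. -/
def nodal (v : Plane → ℝ) (N : Plane) : ℝ :=
  if N ∈ M.freeNodes Ω then
    if (M.fracAdjacent EΓ N).Nonempty then
      (1 / ((M.fracAdjacent EΓ N).card : ℝ)) * ∑ T ∈ M.fracAdjacent EΓ N,
        ∫ y, M.dual (arcOn (edgeUnion EΓ ∩ hull T)) N y * v y ∂(arcOn (edgeUnion EΓ ∩ hull T))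
    else
      (1 / ((M.adjacent N).card : ℝ)) * ∑ T ∈ M.adjacent N,
        ∫ y, M.dual (areaOn T) N y * v y ∂(areaOn T)
  else 0

lemma interp_eq (v : Plane → ℝ) :
    interp M Ω EΓ v = fun x => ∑ N ∈ M.nodes, M.nodal Ω EΓ v N * M.hat N x := by
  classical
  funext x
  have hsub : M.freeNodes Ω ⊆ M.nodes := fun N hN => (mem_freeNodes.1 hN).1
  rw [← Finset.sum_subset hsub fun N _ hN => by rw [nodal, if_neg hN, zero_mul],
    ← Finset.sum_filter_add_sum_filter_not (M.freeNodes Ω)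
      fun N => (M.fracAdjacent EΓ N).Nonempty, interp]
  congr 1
  · refine Finset.sum_congr rfl fun N hN => ?_
    rw [Finset.mem_filter] at hN
    rw [nodal, if_pos hN.1, if_pos hN.2]
  · refine Finset.sum_congr rfl fun N hN => ?_
    rw [Finset.mem_filter] at hN
    rw [nodal, if_pos hN.1, if_neg hN.2]

/-- The interpolation on an element, as an affine function. -/
lemma interp_eqOn {T : Finset Plane} (hT : T ∈ M.elements) (v : Plane → ℝ) {x : Plane}
    (hx : x ∈ hull T) :
    interp M Ω EΓ v x = ∑ N ∈ T, M.nodal Ω EΓ v N * bary T N x := by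
  have hsub : T ⊆ M.nodes := fun N hN => mem_nodes_of_mem hT hN
  rw [interp_eq]
  rw [Finset.sum_subset hsub fun N _ hN => by rw [bary_of_notMem hN]; simp]
  exact Finset.sum_congr rfl fun N _ => by rw [hat_eq_bary hT N hx]

lemma enorm_average_sub_le {ι : Type*} {s : Finset ι} (hs : s.Nonempty) {x : ι → ℝ} {m : ℝ}
    {B : ℝ≥0∞} (h : ∀ i ∈ s, ‖x i - m‖ₑ ≤ B) :
    ‖(1 / (s.card : ℝ)) * ∑ i ∈ s, x i - m‖ₑ ≤ B := by
  have hc : (s.card : ℝ) ≠ 0 := by exact_mod_cast hs.card_pos.ne'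
  have h1 : (1 / (s.card : ℝ)) * ∑ i ∈ s, x i - m = (s.card : ℝ)⁻¹ * ∑ i ∈ s, (x i - m) := by
    rw [Finset.sum_sub_distrib, Finset.sum_const, nsmul_eq_mul]
    field_simp
  rw [h1, enorm_mul]
  calc ‖(s.card : ℝ)⁻¹‖ₑ * ‖∑ i ∈ s, (x i - m)‖ₑ ≤ ‖(s.card : ℝ)⁻¹‖ₑ * ∑ i ∈ s, B := by
        gcongr
        exact (enorm_sum_le _ _).trans (Finset.sum_le_sum h)
    _ = B := by
        rw [Finset.sum_const, nsmul_eq_mul, ← mul_assoc, enorm_inv hc]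
        have : ‖(s.card : ℝ)‖ₑ = (s.card : ℝ≥0∞) := by simp
        rw [this, ENNReal.inv_mul_cancel (by exact_mod_cast hs.card_pos.ne')
          (ENNReal.natCast_ne_top _), one_mul]

/-- A bound for the nodal value from bounds for the averages over the single elements. -/
lemma enorm_nodal_sub_le {v : Plane → ℝ} {N : Plane} (hN : N ∈ M.freeNodes Ω) {m : ℝ} {B : ℝ≥0∞}
    (h1 : ∀ T ∈ M.fracAdjacent EΓ N, ‖∫ y, M.dual (arcOn (edgeUnion EΓ ∩ hull T)) N y * v y
      ∂(arcOn (edgeUnion EΓ ∩ hull T)) - m‖ₑ ≤ B)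
    (h2 : ¬ (M.fracAdjacent EΓ N).Nonempty → ∀ T ∈ M.adjacent N,
      ‖∫ y, M.dual (areaOn T) N y * v y ∂(areaOn T) - m‖ₑ ≤ B) :
    ‖M.nodal Ω EΓ v N - m‖ₑ ≤ B := by
  rw [nodal, if_pos hN]
  split_ifs with hne
  · exact enorm_average_sub_le hne h1
  · obtain ⟨T, hT, hNT⟩ := exists_mem_of_mem_nodes (mem_freeNodes.1 hN).1
    exact enorm_average_sub_le ⟨T, mem_adjacent.2 ⟨hT, hNT⟩⟩ (h2 hne)

lemma _root_.FractureSZ.IsTest.memLp {φ : Plane → ℝ} (hφ : IsTest Ω φ) (μ : Measure Plane)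
    [IsFiniteMeasure μ] : MemLp φ 2 μ :=
  hφ.1.continuous.memLp_of_hasCompactSupport hφ.2.1

variable {ρ H : ℝ}

/-- On a single element, a test function and its averages are close to the same constant. -/
lemma exists_element_estimate (hE : EΓ ⊆ M.edges) (hρ : 0 < ρ)
    (hfat : ∀ T ∈ M.elements, Fat ρ H T) {φ : Plane → ℝ} (hφ : IsTest Ω φ) {T : Finset Plane}
    (hT : T ∈ M.elements) :
    ∃ m : ℝ,
      ∫⁻ x in hull T, ‖φ x - m‖ₑ ^ 2 ≤
        ENNReal.ofReal (4 * H ^ 2) * ∫⁻ x in hull T, ‖∇ φ x‖ₑ ^ 2 ∧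
      (∀ N ∈ T, ‖∫ y, M.dual (areaOn T) N y * φ y ∂(areaOn T) - m‖ₑ ^ 2 ≤
        ENNReal.ofReal (48 * (H / ρ) ^ 2) * ∫⁻ x in hull T, ‖∇ φ x‖ₑ ^ 2) ∧
      ∀ N, T ∈ M.fracAdjacent EΓ N → ‖∫ y, M.dual (arcOn (edgeUnion EΓ ∩ hull T)) N y * φ y
          ∂(arcOn (edgeUnion EΓ ∩ hull T)) - m‖ₑ ^ 2 ≤
        ENNReal.ofReal (30 * (H / ρ) ^ 3) * ∫⁻ x in hull T, ‖∇ φ x‖ₑ ^ 2 := by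
  have hF := hfat T hT
  have hH : 0 < H := by linarith [hF.radius_le hρ]
  obtain ⟨m, hm1, hm2⟩ := hF.exists_poincare_trace (isTri hT) hρ (u := φ)
    fun p _ => hφ.1.contDiffAt.of_le (by norm_num)
  refine ⟨m, hm1, fun N hN => ?_, fun N hN => ?_⟩
  · have hc := controls_areaOn hρ hF hN
    have := hc.finite
    refine (hc.enorm_integral_dual_sub_sq_le hT hN (hφ.memLp _) m).trans ?_
    refine (mul_le_mul_right hm1 _).trans ?_
    rw [← mul_assoc, ← ENNReal.ofReal_mul (by positivity)]
    refine mul_le_mul_left (ENNReal.ofReal_le_ofReal (le_of_eq ?_)) _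
    field_simp
    norm_num
  · obtain ⟨hadj, e, he, hNe, heT⟩ := mem_fracAdjacent.1 hN
    have hc := controls_arcOn hE hT hρ hF he hNe heT
    have := hc.finite
    refine (hc.enorm_integral_dual_sub_sq_le hT (heT hNe) (hφ.memLp _) m).trans ?_
    have hsum : ∫⁻ x, ‖φ x - m‖ₑ ^ 2 ∂(arcOn (edgeUnion EΓ ∩ hull T)) ≤
        3 * (ENNReal.ofReal (5 * H ^ 3 / ρ ^ 2) * ∫⁻ x in hull T, ‖∇ φ x‖ₑ ^ 2) := by
      refine (lintegral_arcOn_inter_le hE hT _).trans ?_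
      calc ∑ e ∈ fracEdges EΓ T, ∫⁻ x, ‖φ x - m‖ₑ ^ 2 ∂(arcOn (hull e))
          ≤ ∑ e ∈ fracEdges EΓ T,
              ENNReal.ofReal (5 * H ^ 3 / ρ ^ 2) * ∫⁻ x in hull T, ‖∇ φ x‖ₑ ^ 2 := by
            refine Finset.sum_le_sum fun e he => ?_
            obtain ⟨he1, he2⟩ := mem_fracEdges.1 he
            obtain ⟨a, b, hab, rfl⟩ := Finset.card_eq_two.1 (mem_edges.1 (hE he1)).2
            exact hm2 a (he2 (by simp)) b (he2 (by simp)) hab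
        _ ≤ _ := by
            rw [Finset.sum_const, nsmul_eq_mul]
            gcongr
            exact_mod_cast card_fracEdges_le hE hT
    refine (mul_le_mul_right hsum _).trans ?_
    rw [show (3 : ℝ≥0∞) = ENNReal.ofReal 3 by norm_num, ← mul_assoc, ← mul_assoc,
      ← ENNReal.ofReal_mul (by positivity), ← ENNReal.ofReal_mul (by positivity)]
    refine mul_le_mul_left (ENNReal.ofReal_le_ofReal (le_of_eq ?_)) _
    field_simp
    norm_num

lemma enorm_sub_sq_le_two (a b c : ℝ) : ‖a - b‖ₑ ^ 2 ≤ 2 * ‖c - a‖ₑ ^ 2 + 2 * ‖c - b‖ₑ ^ 2 := by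
  simp only [Real.enorm_eq_ofReal_abs, ← ENNReal.ofReal_pow (abs_nonneg _), sq_abs]
  rw [show (2 : ℝ≥0∞) = ENNReal.ofReal 2 by norm_num, ← ENNReal.ofReal_mul (by norm_num),
    ← ENNReal.ofReal_mul (by norm_num), ← ENNReal.ofReal_add (by positivity) (by positivity)]
  apply ENNReal.ofReal_le_ofReal
  nlinarith [sq_nonneg (c - a + (c - b))]

/-- A triangle fills a fixed portion of the disc of radius `ρ` about a vertex: it contains the
image of its inscribed disc under the homothety with center `N` and ratio `ρ / H`. -/
lemma _root_.FractureSZ.Fat.le_volume_inter (hρ : 0 < ρ) {T : Finset Plane} (hF : Fat ρ H T)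
    {N : Plane} (hN : N ∈ T) :
    ENNReal.ofReal (3 * (ρ ^ 2 / H) ^ 2) ≤ volume (hull T ∩ Metric.closedBall N ρ) := by
  have hH : 0 < H := by linarith [hF.radius_le hρ]
  obtain ⟨z, hz⟩ := hF.exists_ball
  refine (le_volume_closedBall (N + (ρ / H) • (z - N)) (by positivity)).trans (measure_mono ?_)
  intro y hy
  set y' : Plane := N + (H / ρ) • (y - N) with hy'
  have hyy : y = N + (ρ / H) • (y' - N) := by
    rw [hy', add_sub_cancel_left, smul_smul, show ρ / H * (H / ρ) = 1 by field_simp, one_smul,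
      add_sub_cancel]
  have hmem : y' ∈ hull T := by
    apply hz
    rw [mem_closedBall_iff_norm] at hy ⊢
    have : y' - z = (H / ρ) • (y - (N + (ρ / H) • (z - N))) := by
      rw [← sub_sub, smul_sub, smul_smul, show H / ρ * (ρ / H) = 1 by field_simp, one_smul, hy']
      module
    rw [this, norm_smul, Real.norm_of_nonneg (by positivity)]
    calc H / ρ * ‖y - (N + (ρ / H) • (z - N))‖ ≤ H / ρ * (ρ ^ 2 / H) := by gcongr
      _ = ρ := by field_simp
  have hratio : ρ / H ≤ 1 := by
    rw [div_le_one hH]; linarith [hF.radius_le hρ]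
  refine ⟨?_, ?_⟩
  · rw [hyy]
    exact add_smul_mem_hull (subset_hull hN) hmem (by positivity) hratio
  · rw [mem_closedBall_iff_norm, hyy, add_sub_cancel_left, norm_smul,
      Real.norm_of_nonneg (by positivity)]
    calc ρ / H * ‖y' - N‖ ≤ ρ / H * H := by
          gcongr
          exact hF.diam_le _ (subset_hull hN) _ hmem
      _ = ρ := by field_simp

/-- The constants that belong to an element and to the star of one of its vertices are close. -/
lemma enorm_sub_sq_le_of_estimates (hρ : 0 < ρ) (hfat : ∀ T ∈ M.elements, Fat ρ H T)
    {φ : Plane → ℝ} (hφ : IsTest Ω φ) {N : Plane} {T : Finset Plane} (hT : T ∈ M.adjacent N)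
    {m m' : ℝ}
    (hm : ∫⁻ x in hull T, ‖φ x - m‖ₑ ^ 2 ≤
      ENNReal.ofReal (4 * H ^ 2) * ∫⁻ x in hull T, ‖∇ φ x‖ₑ ^ 2)
    (hm' : ∫⁻ x in hull T ∩ Metric.closedBall N ρ, ‖φ x - m'‖ₑ ^ 2 ≤
      ENNReal.ofReal (16 * ρ ^ 2) *
        ∫⁻ x in M.star N ∩ Metric.closedBall N ρ, ‖∇ φ x‖ₑ ^ 2) :
    ‖m - m'‖ₑ ^ 2 ≤ ENNReal.ofReal (6 * (H / ρ) ^ 4) * ∫⁻ x in M.star N, ‖∇ φ x‖ₑ ^ 2 := by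
  obtain ⟨hTe, hN⟩ := mem_adjacent.1 hT
  have hF := hfat T hTe
  have h2ρ := hF.radius_le hρ
  have hH : 0 < H := by linarith
  set J := ∫⁻ x in M.star N, ‖∇ φ x‖ₑ ^ 2 with hJ
  set R := hull T ∩ Metric.closedBall N ρ with hR
  have hvol := hF.le_volume_inter hρ hN
  have hφm : Measurable φ := hφ.1.continuous.measurable
  have h1 : ‖m - m'‖ₑ ^ 2 * volume R ≤ ENNReal.ofReal (16 * H ^ 2) * J := by
    calc ‖m - m'‖ₑ ^ 2 * volume R = ∫⁻ x in R, ‖m - m'‖ₑ ^ 2 := by rw [setLIntegral_const]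
      _ ≤ ∫⁻ x in R, (2 * ‖φ x - m‖ₑ ^ 2 + 2 * ‖φ x - m'‖ₑ ^ 2) :=
          lintegral_mono fun x => enorm_sub_sq_le_two _ _ _
      _ = 2 * (∫⁻ x in R, ‖φ x - m‖ₑ ^ 2) + 2 * ∫⁻ x in R, ‖φ x - m'‖ₑ ^ 2 := by
          rw [lintegral_add_left (by fun_prop), lintegral_const_mul _ (by fun_prop),
            lintegral_const_mul _ (by fun_prop)]
      _ ≤ 2 * (ENNReal.ofReal (4 * H ^ 2) * J) + 2 * (ENNReal.ofReal (16 * ρ ^ 2) * J) := by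
          gcongr
          · refine (lintegral_mono_set inter_subset_left).trans (hm.trans ?_)
            gcongr
            exact lintegral_mono_set (subset_star hT)
          · exact hm'.trans (by gcongr; exact lintegral_mono_set inter_subset_left)
      _ = ENNReal.ofReal (2 * (4 * H ^ 2) + 2 * (16 * ρ ^ 2)) * J := by
          rw [ENNReal.ofReal_add (by positivity) (by positivity),
            ENNReal.ofReal_mul zero_le_two, ENNReal.ofReal_mul zero_le_two,
            show ENNReal.ofReal 2 = (2 : ℝ≥0∞) by norm_num]
          ring
      _ ≤ _ := by
          gcongr
          nlinarith
  have hpos : 0 < 3 * (ρ ^ 2 / H) ^ 2 := by positivity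
  have h2 : ENNReal.ofReal (3 * (ρ ^ 2 / H) ^ 2) * ‖m - m'‖ₑ ^ 2 ≤
      ENNReal.ofReal (3 * (ρ ^ 2 / H) ^ 2) * (ENNReal.ofReal (6 * (H / ρ) ^ 4) * J) := by
    calc ENNReal.ofReal (3 * (ρ ^ 2 / H) ^ 2) * ‖m - m'‖ₑ ^ 2
        ≤ ‖m - m'‖ₑ ^ 2 * volume R := by rw [mul_comm]; gcongr
      _ ≤ ENNReal.ofReal (16 * H ^ 2) * J := h1
      _ ≤ _ := by
          rw [← mul_assoc, ← ENNReal.ofReal_mul hpos.le]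
          refine mul_le_mul_left (ENNReal.ofReal_le_ofReal ?_) _
          rw [show 3 * (ρ ^ 2 / H) ^ 2 * (6 * (H / ρ) ^ 4) = 18 * H ^ 2 by field_simp; norm_num]
          nlinarith [sq_nonneg H]
  exact (ENNReal.mul_le_mul_iff_right
    (by rw [ne_eq, ENNReal.ofReal_eq_zero, not_le]; exact hpos) ENNReal.ofReal_ne_top).1 h2

lemma star_subset_patch {N : Plane} {T : Finset Plane} (hN : N ∈ T) : M.star N ⊆ M.patch T := by
  refine iUnion₂_subset fun T' hT' => ?_
  obtain ⟨hT'e, hNT'⟩ := mem_adjacent.1 hT'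
  exact subset_biUnion_of_mem (u := fun T => hull T)
    (show T' ∈ {T' | T' ∈ M.elements ∧ (hull T' ∩ hull T).Nonempty} from
      ⟨hT'e, N, subset_hull hNT', subset_hull hN⟩)

lemma subset_patch {T : Finset Plane} (hT : T ∈ M.elements) : hull T ⊆ M.patch T := by
  obtain ⟨N, hN⟩ := Finset.card_pos.1 (by rw [(mem_elements.1 hT).2]; norm_num : 0 < T.card)
  exact (subset_star (mem_adjacent.2 ⟨hT, hN⟩)).trans (star_subset_patch hN)

/-- Every test function is on each element close to a constant, and so are the nodal values of its
interpolation, including the zero values at the fixed nodes. -/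
lemma exists_test_estimate (hΩ : IsOpen Ω) (hM : M.Triangulates Ω) (hE : EΓ ⊆ M.edges) (hρ : 0 < ρ)
    (hfat : ∀ T ∈ M.elements, Fat ρ H T) {φ : Plane → ℝ} (hφ : IsTest Ω φ) {T : Finset Plane}
    (hT : T ∈ M.elements) :
    ∃ m : ℝ,
      eLpNorm (fun x => φ x - m) 2 (areaOn T) ≤
        ENNReal.ofReal (2 * H) * eLpNorm (∇ φ) 2 (volume.restrict (M.patch T)) ∧
      ∀ N ∈ T, ‖M.nodal Ω EΓ φ N - m‖ₑ ≤
        ENNReal.ofReal (24 * (H / ρ) ^ 2) * eLpNorm (∇ φ) 2 (volume.restrict (M.patch T)) := by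
  have h2ρ := (hfat T hT).radius_le hρ
  have hH : 0 < H := by linarith
  set K := H / ρ with hK
  have hK2 : 2 ≤ K := by rw [hK, le_div_iff₀ hρ]; exact h2ρ
  set A := eLpNorm (∇ φ) 2 (volume.restrict (M.patch T)) with hA
  have hAsq : A ^ 2 = ∫⁻ x in M.patch T, ‖∇ φ x‖ₑ ^ 2 := eLpNorm_two_sq _ _
  -- all squared estimates are used in the same weakened form
  have hweak : ∀ (x : ℝ) (c : ℝ) (S : Set Plane), S ⊆ M.patch T → c ≤ (8 * K ^ 2) ^ 2 →
      ‖x‖ₑ ^ 2 ≤ ENNReal.ofReal c * ∫⁻ x in S, ‖∇ φ x‖ₑ ^ 2 →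
      ‖x‖ₑ ≤ ENNReal.ofReal (8 * K ^ 2) * A := by
    intro x c S hS hc h
    rw [← ENNReal.pow_le_pow_left_iff two_ne_zero]
    refine h.trans ?_
    rw [mul_pow, ← ENNReal.ofReal_pow (by positivity), hAsq]
    gcongr
  have hself : hull T ⊆ M.patch T := subset_patch hT
  obtain ⟨m, hm, -⟩ := exists_element_estimate hE hρ hfat hφ hT
  have hKK : 4 ≤ K ^ 2 := by nlinarith
  have hc2 : 48 * K ^ 2 ≤ (8 * K ^ 2) ^ 2 := by nlinarith
  have hc3 : 30 * K ^ 3 ≤ (8 * K ^ 2) ^ 2 := by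
    have : 0 ≤ K ^ 3 * (64 * K - 30) := by
      apply mul_nonneg (by positivity); linarith
    nlinarith
  have hc4 : 6 * K ^ 4 ≤ (8 * K ^ 2) ^ 2 := by nlinarith [sq_nonneg (K ^ 2)]
  have hc0 : (52 : ℝ) ≤ (8 * K ^ 2) ^ 2 := by nlinarith
  refine ⟨m, ?_, fun N hN => ?_⟩
  · refine eLpNorm_two_le_of_sq_le ?_
    rw [mul_pow, ← ENNReal.ofReal_pow (by positivity), hAsq, mul_pow]
    norm_num only
    exact hm.trans (by gcongr)
  · obtain ⟨m', hm1, -, hm3⟩ := exists_star_estimate hΩ hM hρ hfat hφ (N := N) hρ le_rfl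
    have hadj := mem_adjacent.2 ⟨hT, hN⟩
    have hstar := star_subset_patch (M := M) hN
    have hnn : (0 : ℝ) ≤ 8 * K ^ 2 := by positivity
    have hmm' : ‖m - m'‖ₑ ≤ ENNReal.ofReal (8 * K ^ 2) * A :=
      hweak _ _ _ hstar hc4 (enorm_sub_sq_le_of_estimates hρ hfat hφ hadj hm (hm1 T hadj))
    have hsplit : ENNReal.ofReal (24 * K ^ 2) * A = ENNReal.ofReal (8 * K ^ 2) * A +
        (ENNReal.ofReal (8 * K ^ 2) * A + ENNReal.ofReal (8 * K ^ 2) * A) := by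
      rw [show 24 * K ^ 2 = 8 * K ^ 2 + (8 * K ^ 2 + 8 * K ^ 2) by ring,
        ENNReal.ofReal_add hnn (by positivity), ENNReal.ofReal_add hnn hnn]
      ring
    rw [hsplit]
    have htri : ∀ x y : ℝ, ‖x - m‖ₑ ≤ ‖x - y‖ₑ + (‖y - m'‖ₑ + ‖m - m'‖ₑ) := by
      intro x y
      have : x - m = (x - y) + ((y - m') - (m - m')) := by ring
      rw [this]
      exact (enorm_add_le _ _).trans (by gcongr; exact enorm_sub_le)
    by_cases hfree : N ∈ M.freeNodes Ω
    · have hcmp : ∀ T' ∈ M.adjacent N, ∀ x : ℝ, ∀ m'' : ℝ,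
          (∫⁻ x in hull T', ‖φ x - m''‖ₑ ^ 2 ≤
            ENNReal.ofReal (4 * H ^ 2) * ∫⁻ x in hull T', ‖∇ φ x‖ₑ ^ 2) →
          ∀ c, c ≤ (8 * K ^ 2) ^ 2 →
          ‖x - m''‖ₑ ^ 2 ≤ ENNReal.ofReal c * ∫⁻ x in hull T', ‖∇ φ x‖ₑ ^ 2 →
          ‖x - m‖ₑ ≤ ENNReal.ofReal (8 * K ^ 2) * A +
            (ENNReal.ofReal (8 * K ^ 2) * A + ENNReal.ofReal (8 * K ^ 2) * A) := by
        intro T' hT' x m'' hm'' c hc hx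
        refine (htri x m'').trans (add_le_add ?_ (add_le_add ?_ hmm'))
        · exact hweak _ _ _ ((subset_star hT').trans hstar) hc hx
        · exact hweak _ _ _ hstar hc4
            (enorm_sub_sq_le_of_estimates hρ hfat hφ hT' hm'' (hm1 T' hT'))
      refine enorm_nodal_sub_le hfree (fun T' hT' => ?_) (fun _ T' hT' => ?_)
      · have hadj' := (mem_fracAdjacent.1 hT').1
        obtain ⟨m'', h1, -, h3⟩ :=
          exists_element_estimate hE hρ hfat hφ (mem_adjacent.1 hadj').1
        exact hcmp T' hadj' _ m'' h1 _ hc3 (h3 N hT')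
      · obtain ⟨m'', h1, h2, -⟩ :=
          exists_element_estimate hE hρ hfat hφ (mem_adjacent.1 hT').1
        exact hcmp T' hT' _ m'' h1 _ hc2 (h2 N (mem_adjacent.1 hT').2)
    · have hnode := mem_nodes_of_mem hT hN
      have hfr : N ∈ frontier Ω := by
        by_contra h
        exact hfree (mem_freeNodes.2 ⟨hnode, h⟩)
      rw [nodal, if_neg hfree]
      refine (htri 0 0).trans (add_le_add ?_ (add_le_add ?_ hmm'))
      · simp
      · rw [zero_sub, enorm_neg]
        refine hweak m' 52 (M.star N) hstar hc0 ?_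
        rw [show ENNReal.ofReal 52 = (52 : ℝ≥0∞) by norm_num]
        exact (hm3 hnode hfr).trans (by gcongr; exact inter_subset_left)

end Triangulation

namespace Triangulation

/-! ### Passage to the limit and the estimates on the elements -/

variable {M : Triangulation} {Ω : Set Plane} {EΓ : Finset (Finset Plane)}

lemma _root_.FractureSZ.volume_hull_pair (a b : Plane) : volume (hull {a, b}) = 0 := by
  refine measure_mono_null (t := (affineSpan ℝ ({a, b} : Set Plane) : Set Plane)) ?_ ?_
  · rw [hull]
    simpa using convexHull_subset_affineSpan (𝕜 := ℝ) ({a, b} : Set Plane)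
  · refine Measure.addHaar_affineSubspace _ _ fun h => ?_
    have h1 := collinear_iff_finrank_le_one.1 (collinear_pair ℝ a b)
    rw [← direction_affineSpan, h, AffineSubspace.direction_top, finrank_top,
      finrank_euclideanSpace, Fintype.card_fin] at h1
    norm_num at h1

lemma Triangulates.volume_frontier (hM : M.Triangulates Ω) : volume (frontier Ω) = 0 := by
  obtain ⟨S, hS, hfr⟩ := hM.2
  rw [hfr, edgeUnion]
  refine (measure_biUnion_null_iff S.countable_toSet).2 fun e he => ?_
  obtain ⟨a, b, -, rfl⟩ := Finset.card_eq_two.1 (mem_edges.1 (hS he)).2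
  exact volume_hull_pair a b

/-- Since the boundary has measure zero, `L²(Ω)` estimates hold on subsets of the closure, such as
elements and patches. -/
lemma Triangulates.restrict_le (hM : M.Triangulates Ω) {s : Set Plane} (hs : s ⊆ closure Ω) :
    volume.restrict s ≤ (volume.restrict Ω : Measure Plane) := by
  refine (Measure.restrict_mono hs le_rfl).trans (Measure.restrict_mono_ae ?_)
  have h0 : ∀ᵐ x : Plane, x ∉ frontier Ω := measure_eq_zero_iff_ae_notMem.1 hM.volume_frontier
  filter_upwards [h0] with x hx hxc
  by_contra hxo
  exact hx ⟨hxc, fun hi => hxo (interior_subset hi)⟩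

lemma patch_subset_closure (hM : M.Triangulates Ω) (T : Finset Plane) : M.patch T ⊆ closure Ω :=
  iUnion₂_subset fun _ hT' => hull_subset_closure hM hT'.1

lemma memLp_arcOn (hE : EΓ ⊆ M.edges) {v : Plane → ℝ} (hv : ContinuousOn v (edgeUnion EΓ)) :
    MemLp v 2 (arcOn (edgeUnion EΓ)) := by
  have := arcOn_finite hE (Subset.refl (edgeUnion EΓ))
  have hc := isCompact_edgeUnion EΓ
  obtain ⟨C, hC⟩ := hc.exists_bound_of_continuousOn hv
  refine MemLp.of_bound (hv.aestronglyMeasurable hc.measurableSet) C ?_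
  filter_upwards [ae_restrict_mem (μ := (μH[1] : Measure Plane)) hc.measurableSet] with x hx
  exact hC x hx

lemma _root_.FractureSZ.Controls.tendsto_integral_dual {μ : Measure Plane} {T : Finset Plane}
    {N : Plane} {κ : ℝ} (h : Controls μ T N κ) (hT : T ∈ M.elements) (hN : N ∈ T)
    {φ : ℕ → Plane → ℝ} {v : Plane → ℝ} (hφ : ∀ n, MemLp (φ n) 2 μ) (hv : MemLp v 2 μ)
    (hlim : Tendsto (fun n => eLpNorm (φ n - v) 2 μ) atTop (𝓝 0)) :
    Tendsto (fun n => ∫ x, M.dual μ N x * φ n x ∂μ) atTop (𝓝 (∫ x, M.dual μ N x * v x ∂μ)) := by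
  rw [tendsto_iff_edist_tendsto_0]
  have hsq : Tendsto (fun n => ENNReal.ofReal (1 / κ) * eLpNorm (φ n - v) 2 μ ^ 2) atTop (𝓝 0) := by
    have h1 := ENNReal.Tendsto.const_mul (a := ENNReal.ofReal (1 / κ))
      (((ENNReal.continuous_pow 2).tendsto 0).comp hlim) (Or.inr ENNReal.ofReal_ne_top)
    simpa using h1
  have hsq' : Tendsto (fun n => (ENNReal.ofReal (1 / κ) * eLpNorm (φ n - v) 2 μ ^ 2) ^ (1 / 2 : ℝ))
      atTop (𝓝 0) := by
    have h1 := ((ENNReal.continuous_rpow_const (y := 1 / 2)).tendsto 0).comp hsq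
    rwa [ENNReal.zero_rpow_of_pos (by norm_num)] at h1
  refine tendsto_of_tendsto_of_tendsto_of_le_of_le tendsto_const_nhds hsq' (fun _ => zero_le)
    fun n => ?_
  have h2 := h.enorm_integral_dual_sub_sq_le hT hN ((hφ n).sub hv) 0
  have h3 : ∫ x, M.dual μ N x * (φ n - v) x ∂μ =
      ∫ x, M.dual μ N x * φ n x ∂μ - ∫ x, M.dual μ N x * v x ∂μ := by
    rw [← integral_sub (h.integrable_dual_mul hT hN (hφ n)) (h.integrable_dual_mul hT hN hv)]
    simp only [Pi.sub_apply, mul_sub]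
  rw [h3, sub_zero] at h2
  simp only [sub_zero] at h2
  rw [← eLpNorm_two_sq μ (φ n - v)] at h2
  calc edist (∫ x, M.dual μ N x * φ n x ∂μ) (∫ x, M.dual μ N x * v x ∂μ)
      = ‖∫ x, M.dual μ N x * φ n x ∂μ - ∫ x, M.dual μ N x * v x ∂μ‖ₑ := edist_eq_enorm_sub _ _
    _ = (‖∫ x, M.dual μ N x * φ n x ∂μ - ∫ x, M.dual μ N x * v x ∂μ‖ₑ ^ 2) ^ (1 / 2 : ℝ) := by
        rw [← ENNReal.rpow_natCast, ← ENNReal.rpow_mul]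
        norm_num
    _ ≤ _ := ENNReal.rpow_le_rpow h2 (by norm_num)

variable {ρ H : ℝ}

/-- The nodal values depend continuously on the function in `L²(Ω)` and `L²(Γ)`. -/
lemma tendsto_nodal (hM : M.Triangulates Ω) (hE : EΓ ⊆ M.edges) (hρ : 0 < ρ)
    (hfat : ∀ T ∈ M.elements, Fat ρ H T) {φ : ℕ → Plane → ℝ} {v : Plane → ℝ}
    (hφ : ∀ n, IsTest Ω (φ n)) (hv : MemLp v 2 (volume.restrict Ω))
    (hvc : ContinuousOn v (edgeUnion EΓ))
    (h1 : Tendsto (fun n => eLpNorm (φ n - v) 2 (volume.restrict Ω)) atTop (𝓝 0))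
    (h2 : Tendsto (fun n => eLpNorm (φ n - v) 2 (arcOn (edgeUnion EΓ))) atTop (𝓝 0)) (N : Plane) :
    Tendsto (fun n => M.nodal Ω EΓ (φ n) N) atTop (𝓝 (M.nodal Ω EΓ v N)) := by
  unfold nodal
  split_ifs with hfree hne
  · refine Tendsto.const_mul _ (tendsto_finsetSum _ fun T hT => ?_)
    obtain ⟨hadj, e, he, hNe, heT⟩ := mem_fracAdjacent.1 hT
    obtain ⟨hTe, hNT⟩ := mem_adjacent.1 hadj
    have hc := controls_arcOn hE hTe hρ (hfat T hTe) he hNe heT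
    have := hc.finite
    have hle : arcOn (edgeUnion EΓ ∩ hull T) ≤ arcOn (edgeUnion EΓ) := arcOn_mono inter_subset_left
    exact hc.tendsto_integral_dual hTe hNT (fun n => (hφ n).memLp _)
      ((memLp_arcOn hE hvc).mono_measure hle)
      (tendsto_of_tendsto_of_tendsto_of_le_of_le tendsto_const_nhds h2 (fun _ => zero_le)
        fun n => eLpNorm_mono_measure _ hle)
  · refine Tendsto.const_mul _ (tendsto_finsetSum _ fun T hT => ?_)
    obtain ⟨hTe, hNT⟩ := mem_adjacent.1 hT
    have hc := controls_areaOn hρ (hfat T hTe) hNT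
    have := hc.finite
    have hle := hM.restrict_le (hull_subset_closure hM hTe)
    exact hc.tendsto_integral_dual hTe hNT (fun n => (hφ n).memLp _) (hv.mono_measure hle)
      (tendsto_of_tendsto_of_tendsto_of_le_of_le tendsto_const_nhds h1 (fun _ => zero_le)
        fun n => eLpNorm_mono_measure _ hle)
  · exact tendsto_const_nhds

/-- On each element, a function in `V` and its nodal values are close to the same constants. -/
lemma exists_seq_estimate (hΩ : IsOpen Ω) (hM : M.Triangulates Ω) (hE : EΓ ⊆ M.edges) (hρ : 0 < ρ)
    (hfat : ∀ T ∈ M.elements, Fat ρ H T) {v : Plane → ℝ} {G g : Plane → Plane}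
    (hv : MemV Ω EΓ v G g) {T : Finset Plane} (hT : T ∈ M.elements) :
    ∃ (m : ℕ → ℝ) (ε : ℕ → ℝ≥0∞), Tendsto ε atTop (𝓝 0) ∧ ∀ n,
      eLpNorm (fun x => v x - m n) 2 (areaOn T) ≤
        ENNReal.ofReal (2 * H) * eLpNorm G 2 (volume.restrict (M.patch T)) + ε n ∧
      ∀ N ∈ T, ‖M.nodal Ω EΓ v N - m n‖ₑ ≤
        ENNReal.ofReal (24 * (H / ρ) ^ 2) * eLpNorm G 2 (volume.restrict (M.patch T)) + ε n := by
  obtain ⟨φ, hφ, h1, h2, h3⟩ := hv.approx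
  choose m hm1 hm2 using fun n => exists_test_estimate hΩ hM hE hρ hfat (hφ n) hT
  have hfin : IsFiniteMeasure (areaOn T) :=
    ⟨by rw [areaOn, Measure.restrict_apply_univ]; exact (isCompact_hull T).measure_lt_top⟩
  set A := eLpNorm G 2 (volume.restrict (M.patch T)) with hA
  set a : ℕ → ℝ≥0∞ := fun n => eLpNorm (φ n - v) 2 (volume.restrict Ω) with ha
  set b : ℕ → ℝ≥0∞ := fun n => eLpNorm (∇ (φ n) - G) 2 (volume.restrict Ω) with hb
  set c : ℕ → ℝ≥0∞ := fun n => ∑ N ∈ T, ‖M.nodal Ω EΓ (φ n) N - M.nodal Ω EΓ v N‖ₑ with hc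
  have hc0 : Tendsto c atTop (𝓝 0) := by
    rw [← Finset.sum_const_zero (s := T)]
    refine tendsto_finsetSum _ fun N _ => ?_
    have := tendsto_iff_edist_tendsto_0.1
      (tendsto_nodal hM hE hρ hfat hφ hv.memLp.1 hv.continuousOn h1 h3 N)
    simpa only [edist_eq_enorm_sub] using this
  have hgrad : ∀ n, eLpNorm (∇ (φ n)) 2 (volume.restrict (M.patch T)) ≤ A + b n := by
    intro n
    have hle := hM.restrict_le (patch_subset_closure hM T)
    have hGm := (hv.memLp.2.mono_measure hle).1
    have hdm : AEStronglyMeasurable (∇ (φ n)) (volume.restrict (M.patch T)) := by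
      have : Continuous (∇ (φ n)) := continuous_iff_continuousAt.2 fun x =>
        continuousAt_gradient ((hφ n).1.contDiffAt.of_le (by norm_num))
      exact this.aestronglyMeasurable
    have : ∇ (φ n) = G + (∇ (φ n) - G) := by abel
    rw [this]
    exact (eLpNorm_add_le hGm (hdm.sub hGm) (by norm_num)).trans
      (add_le_add le_rfl (eLpNorm_mono_measure _ hle))
  set ε : ℕ → ℝ≥0∞ := fun n => (a n + ENNReal.ofReal (2 * H) * b n) +
    (c n + ENNReal.ofReal (24 * (H / ρ) ^ 2) * b n) with hε
  have hε0 : Tendsto ε atTop (𝓝 0) := by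
    have := (h1.add (ENNReal.Tendsto.const_mul h2
      (Or.inr (ENNReal.ofReal_ne_top (r := 2 * H))))).add
      (hc0.add (ENNReal.Tendsto.const_mul h2
      (Or.inr (ENNReal.ofReal_ne_top (r := 24 * (H / ρ) ^ 2)))))
    simpa only [mul_zero, add_zero] using this
  refine ⟨m, ε, hε0, fun n => ⟨?_, fun N hN => ?_⟩⟩
  · have hle := hM.restrict_le (hull_subset_closure hM hT)
    have hvm : AEStronglyMeasurable v (areaOn T) := (hv.memLp.1.mono_measure hle).1
    have hφm := ((hφ n).memLp (areaOn T)).1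
    have hsplit : (fun x => v x - m n) = (v - φ n) + fun x => φ n x - m n := by
      funext x; simp
    rw [hsplit]
    calc eLpNorm ((v - φ n) + fun x => φ n x - m n) 2 (areaOn T)
        ≤ eLpNorm (v - φ n) 2 (areaOn T) + eLpNorm (fun x => φ n x - m n) 2 (areaOn T) :=
          eLpNorm_add_le (hvm.sub hφm) (hφm.sub aestronglyMeasurable_const) (by norm_num)
      _ ≤ a n + ENNReal.ofReal (2 * H) * (A + b n) := by
          refine add_le_add ?_ ((hm1 n).trans (mul_le_mul_right (hgrad n) _))
          rw [eLpNorm_sub_comm]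
          exact eLpNorm_mono_measure _ hle
      _ = ENNReal.ofReal (2 * H) * A + (a n + ENNReal.ofReal (2 * H) * b n) := by ring
      _ ≤ _ := add_le_add le_rfl le_self_add
  · calc ‖M.nodal Ω EΓ v N - m n‖ₑ
        = ‖(M.nodal Ω EΓ (φ n) N - m n) -
            (M.nodal Ω EΓ (φ n) N - M.nodal Ω EΓ v N)‖ₑ := by congr 1; ring
      _ ≤ ‖M.nodal Ω EΓ (φ n) N - m n‖ₑ + ‖M.nodal Ω EΓ (φ n) N - M.nodal Ω EΓ v N‖ₑ :=
          enorm_sub_le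
      _ ≤ ENNReal.ofReal (24 * (H / ρ) ^ 2) * (A + b n) + c n :=
          add_le_add ((hm2 n N hN).trans (mul_le_mul_right (hgrad n) _))
            (Finset.single_le_sum (f := fun N => ‖M.nodal Ω EΓ (φ n) N - M.nodal Ω EΓ v N‖ₑ)
              (fun _ _ => zero_le) hN)
      _ = ENNReal.ofReal (24 * (H / ρ) ^ 2) * A +
            (c n + ENNReal.ofReal (24 * (H / ρ) ^ 2) * b n) := by ring
      _ ≤ _ := add_le_add le_rfl le_add_self

lemma _root_.FractureSZ.Fat.eLpNorm_areaOn_le {T : Finset Plane} (hT : T ∈ M.elements)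
    (hF : Fat ρ H T) (hH : 0 < H)
    {F : Type*} [NormedAddCommGroup F] {f : Plane → F} {B : ℝ≥0∞}
    (h : ∀ x ∈ interior (hull T), ‖f x‖ₑ ≤ B) :
    eLpNorm f 2 (areaOn T) ≤ ENNReal.ofReal (2 * H) * B := by
  obtain ⟨N, hN⟩ := Finset.card_pos.1 (by rw [(mem_elements.1 hT).2]; norm_num : 0 < T.card)
  have hfr : ∀ᵐ x : Plane, x ∉ frontier (hull T) :=
    measure_eq_zero_iff_ae_notMem.1 ((convex_convexHull ℝ (T : Set Plane)).addHaar_frontier volume)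
  have hae : ∀ᵐ x ∂(areaOn T), ‖f x‖ₑ ≤ B := by
    rw [areaOn, ae_restrict_iff' (isCompact_hull T).measurableSet]
    filter_upwards [hfr] with x hx hxT
    refine h x ?_
    by_contra hi
    exact hx ⟨subset_closure hxT, hi⟩
  have hvol : volume (hull T) ≤ ENNReal.ofReal ((2 * H) ^ 2) := by
    have hsub : hull T ⊆ Metric.closedBall N H := fun x hx => by
      rw [mem_closedBall_iff_norm]
      exact hF.diam_le _ (subset_hull hN) _ hx
    refine (measure_mono hsub).trans ?_
    rw [EuclideanSpace.volume_closedBall_fin_two, ← ENNReal.ofReal_pow hH.le,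
      ← ENNReal.ofReal_mul (by positivity)]
    apply ENNReal.ofReal_le_ofReal
    nlinarith [Real.pi_le_four, sq_nonneg H]
  refine eLpNorm_two_le_of_sq_le ?_
  calc ∫⁻ x, ‖f x‖ₑ ^ 2 ∂(areaOn T) ≤ ∫⁻ _, B ^ 2 ∂(areaOn T) :=
        lintegral_mono_ae (hae.mono fun x hx => by gcongr)
    _ = B ^ 2 * volume (hull T) := by
        rw [lintegral_const, areaOn, Measure.restrict_apply_univ]
    _ ≤ B ^ 2 * ENNReal.ofReal ((2 * H) ^ 2) := by gcongr
    _ = _ := by rw [ENNReal.ofReal_pow (by positivity), mul_comm, ← mul_pow]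

lemma enorm_sum_bary_le {T : Finset Plane} (hT : T ∈ M.elements) {c : Plane → ℝ} {B : ℝ≥0∞}
    (hc : ∀ N ∈ T, ‖c N‖ₑ ≤ B) {t : Plane → ℝ} {L : ℝ} (ht : ∀ N ∈ T, |t N| ≤ L) :
    ‖∑ N ∈ T, c N * t N‖ₑ ≤ ENNReal.ofReal L * (3 * B) := by
  calc ‖∑ N ∈ T, c N * t N‖ₑ ≤ ∑ N ∈ T, ‖c N * t N‖ₑ := enorm_sum_le _ _
    _ ≤ ∑ N ∈ T, B * ENNReal.ofReal L := by
        refine Finset.sum_le_sum fun N hN => ?_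
        rw [enorm_mul]
        gcongr
        · exact hc N hN
        · rw [Real.enorm_eq_ofReal_abs]
          exact ENNReal.ofReal_le_ofReal (ht N hN)
    _ = _ := by
        rw [Finset.sum_const, (mem_elements.1 hT).2, nsmul_eq_mul]
        push_cast
        ring

lemma sum_bary_sub {T : Finset Plane} (hT : T ∈ M.elements) (c : Plane → ℝ) (m : ℝ) (x : Plane) :
    ∑ N ∈ T, c N * bary T N x = ∑ N ∈ T, (c N - m) * bary T N x + m := by
  simp_rw [sub_mul]
  rw [Finset.sum_sub_distrib, ← Finset.mul_sum, (isTri hT).sum_bary, mul_one, sub_add_cancel]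

lemma enorm_gradient_interp_le (hρ : 0 < ρ) {T : Finset Plane} (hT : T ∈ M.elements)
    (hF : Fat ρ H T) {v : Plane → ℝ} {m : ℝ} {B : ℝ≥0∞}
    (hB : ∀ N ∈ T, ‖M.nodal Ω EΓ v N - m‖ₑ ≤ B) {x : Plane} (hx : x ∈ interior (hull T)) :
    ‖∇ (interp M Ω EΓ v) x‖ₑ ≤ ENNReal.ofReal (1 / (2 * ρ)) * (3 * B) := by
  rcases eq_or_ne B ⊤ with rfl | hBt
  · rw [ENNReal.mul_top (by norm_num), ENNReal.mul_top
      (by rw [ne_eq, ENNReal.ofReal_eq_zero, not_le]; positivity)]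
    exact le_top
  set f : Plane → ℝ := fun x => ∑ N ∈ T, M.nodal Ω EΓ v N * bary T N x with hf
  have heq : interp M Ω EΓ v =ᶠ[𝓝 x] f := by
    filter_upwards [mem_interior_iff_mem_nhds.1 hx] with y hy using interp_eqOn hT v hy
  set L : ℝ≥0∞ := ENNReal.ofReal (1 / (2 * ρ)) * (3 * B) with hL
  have hLt : L ≠ ⊤ :=
    ENNReal.mul_ne_top ENNReal.ofReal_ne_top (ENNReal.mul_ne_top (by norm_num) hBt)
  have hlip : LipschitzWith L.toNNReal f := by
    intro y z
    rw [edist_eq_enorm_sub, ENNReal.coe_toNNReal hLt, hf]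
    simp only
    rw [sum_bary_sub hT _ m y, sum_bary_sub hT _ m z, add_sub_add_right_eq_sub,
      ← Finset.sum_sub_distrib]
    simp_rw [← mul_sub]
    refine (enorm_sum_bary_le hT hB
      fun N _ => hF.abs_bary_sub_le hρ (isTri hT) N y z).trans (le_of_eq ?_)
    rw [hL, edist_eq_enorm_sub, ← ofReal_norm, div_eq_mul_one_div,
      ENNReal.ofReal_mul (norm_nonneg _)]
    ring
  have h1 : ‖∇ (interp M Ω EΓ v) x‖ ≤ L.toNNReal := by
    rw [gradient, LinearIsometryEquiv.norm_map, heq.fderiv_eq]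
    exact norm_fderiv_le_of_lipschitz ℝ hlip
  rw [← ofReal_norm]
  refine (ENNReal.ofReal_le_ofReal h1).trans ?_
  rw [ENNReal.ofReal_coe_nnreal, ENNReal.coe_toNNReal hLt]

/-- The error and the stability estimate on an element. -/
lemma element_estimates (hΩ : IsOpen Ω) (hM : M.Triangulates Ω) (hE : EΓ ⊆ M.edges) (hρ : 0 < ρ)
    (hfat : ∀ T ∈ M.elements, Fat ρ H T) {v : Plane → ℝ} {G g : Plane → Plane}
    (hv : MemV Ω EΓ v G g) {T : Finset Plane} (hT : T ∈ M.elements) :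
    eLpNorm (v - interp M Ω EΓ v) 2 (areaOn T) ≤ ENNReal.ofReal ((2 + 144 * (H / ρ) ^ 2) * H) *
      eLpNorm G 2 (volume.restrict (M.patch T)) ∧
    eLpNorm (∇ (interp M Ω EΓ v)) 2 (areaOn T) ≤ ENNReal.ofReal (72 * (H / ρ) ^ 3) *
      eLpNorm G 2 (volume.restrict (M.patch T)) := by
  have hF := hfat T hT
  have hH : 0 < H := by linarith [hF.radius_le hρ]
  obtain ⟨m, ε, hε, hm⟩ := exists_seq_estimate hΩ hM hE hρ hfat hv hT
  set A := eLpNorm G 2 (volume.restrict (M.patch T)) with hA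
  set K := H / ρ with hK
  have hKpos : 0 < K := by positivity
  have h3 : (3 : ℝ≥0∞) = ENNReal.ofReal 3 := by norm_num
  constructor
  · have hlim : Tendsto (fun n => (ENNReal.ofReal (2 * H) * A + ε n) +
        ENNReal.ofReal (2 * H) * (3 * (ENNReal.ofReal (24 * K ^ 2) * A + ε n))) atTop
        (𝓝 ((ENNReal.ofReal (2 * H) * A + 0) +
          ENNReal.ofReal (2 * H) * (3 * (ENNReal.ofReal (24 * K ^ 2) * A + 0)))) :=
      (tendsto_const_nhds.add hε).add (ENNReal.Tendsto.const_mul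
        (ENNReal.Tendsto.const_mul (tendsto_const_nhds.add hε) (Or.inr (by norm_num)))
        (Or.inr ENNReal.ofReal_ne_top))
    have heq : (ENNReal.ofReal (2 * H) * A + 0) +
        ENNReal.ofReal (2 * H) * (3 * (ENNReal.ofReal (24 * K ^ 2) * A + 0)) =
        ENNReal.ofReal ((2 + 144 * K ^ 2) * H) * A := by
      rw [show (2 + 144 * K ^ 2) * H = 2 * H + (2 * H) * (3 * (24 * K ^ 2)) by ring,
        ENNReal.ofReal_add (by positivity) (by positivity), ENNReal.ofReal_mul (p := 2 * H)
        (by positivity), ENNReal.ofReal_mul (p := 3) (by norm_num), ← h3]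
      ring
    rw [heq] at hlim
    refine ge_of_tendsto' hlim fun n => ?_
    obtain ⟨h1, h2⟩ := hm n
    have hvm : AEStronglyMeasurable v (areaOn T) :=
      (hv.memLp.1.mono_measure (hM.restrict_le (hull_subset_closure hM hT))).1
    set w : Plane → ℝ := fun x => ∑ N ∈ T, (M.nodal Ω EΓ v N - m n) * bary T N x with hw
    have hwc : Continuous w := continuous_finsetSum _ fun N _ =>
      continuous_const.mul (bary T N).continuous_of_finiteDimensional
    have hsplit : v - interp M Ω EΓ v =ᵐ[areaOn T] (fun x => v x - m n) - w := by
      filter_upwards [ae_restrict_mem (isCompact_hull T).measurableSet] with x hx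
      simp only [Pi.sub_apply, hw]
      rw [interp_eqOn hT v hx, sum_bary_sub hT _ (m n)]
      ring
    rw [eLpNorm_congr_ae hsplit]
    refine (eLpNorm_sub_le (hvm.sub aestronglyMeasurable_const) hwc.aestronglyMeasurable
      (by norm_num)).trans (add_le_add h1 ?_)
    refine hF.eLpNorm_areaOn_le hT hH fun x hx => ?_
    refine (enorm_sum_bary_le hT h2 (L := 1) fun N hN => ?_).trans (by simp)
    have hx' := interior_subset hx
    rw [abs_of_nonneg ((isTri hT).bary_nonneg hx' N)]
    exact (isTri hT).bary_le_one hx' N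
  · have hlim : Tendsto (fun n => ENNReal.ofReal (2 * H) * (ENNReal.ofReal (1 / (2 * ρ)) *
        (3 * (ENNReal.ofReal (24 * K ^ 2) * A + ε n)))) atTop
        (𝓝 (ENNReal.ofReal (2 * H) * (ENNReal.ofReal (1 / (2 * ρ)) *
        (3 * (ENNReal.ofReal (24 * K ^ 2) * A + 0))))) :=
      ENNReal.Tendsto.const_mul (ENNReal.Tendsto.const_mul
        (ENNReal.Tendsto.const_mul (tendsto_const_nhds.add hε) (Or.inr (by norm_num)))
        (Or.inr ENNReal.ofReal_ne_top)) (Or.inr ENNReal.ofReal_ne_top)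
    have heq : ENNReal.ofReal (2 * H) * (ENNReal.ofReal (1 / (2 * ρ)) *
        (3 * (ENNReal.ofReal (24 * K ^ 2) * A + 0))) = ENNReal.ofReal (72 * K ^ 3) * A := by
      rw [show 72 * K ^ 3 = (2 * H) * ((1 / (2 * ρ)) * (3 * (24 * K ^ 2))) by
          rw [hK]; field_simp; ring,
        ENNReal.ofReal_mul (p := 2 * H) (by positivity), ENNReal.ofReal_mul (p := 1 / (2 * ρ))
        (by positivity), ENNReal.ofReal_mul (p := 3) (by norm_num), ← h3]
      ring
    rw [heq] at hlim
    refine ge_of_tendsto' hlim fun n => ?_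
    exact hF.eLpNorm_areaOn_le hT hH fun x hx => enorm_gradient_interp_le hρ hT hF (hm n).2 hx

end Triangulation

namespace Triangulation

/-! ### Vanishing trace at the boundary nodes of the fracture -/

variable {M : Triangulation} {Ω : Set Plane} {EΓ : Finset (Finset Plane)} {ρ H : ℝ}

/-- The trace of a test function on a short segment that starts at a boundary node. -/
lemma eLpNorm_radius_le (hΩ : IsOpen Ω) (hM : M.Triangulates Ω) (hρ : 0 < ρ)
    (hfat : ∀ T ∈ M.elements, Fat ρ H T) {φ : Plane → ℝ} (hφ : IsTest Ω φ) {a b : Plane}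
    {T : Finset Plane} (hT : T ∈ M.adjacent a) (hb : b ∈ T) (hab : b ≠ a)
    (hfr : a ∈ frontier Ω) {r : ℝ} (hr : 0 < r) (hrρ : r ≤ ρ) :
    eLpNorm φ 2 (arcOn (segment ℝ a (a + (r / ‖b - a‖) • (b - a)))) ≤
      ENNReal.ofReal √(208 * r) *
        eLpNorm (∇ φ) 2 ((volume.restrict Ω).restrict (Metric.closedBall a r)) := by
  obtain ⟨m, -, hm2, hm3⟩ := exists_star_estimate hΩ hM hρ hfat hφ (N := a) hr hrρ
  obtain ⟨hTe, haT⟩ := mem_adjacent.1 hT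
  have hm := hm3 (mem_nodes_of_mem hTe haT) hfr
  have hs := hm2 T hT b hb hab
  set J := ∫⁻ x in M.star a ∩ Metric.closedBall a r, ‖∇ φ x‖ₑ ^ 2 with hJ
  set c := a + (r / ‖b - a‖) • (b - a) with hc
  have hn : 0 < ‖b - a‖ := norm_pos_iff.2 (sub_ne_zero.2 hab)
  have hdist : dist a c = r := by
    rw [dist_comm, dist_eq_norm, hc, add_sub_cancel_left, norm_smul,
      Real.norm_of_nonneg (by positivity)]
    field_simp
  have hac : a ≠ c := by
    rw [← dist_pos, hdist]; exact hr
  have hφm : Measurable φ := hφ.1.continuous.measurable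
  have hline : ∀ s : ℝ, (AffineMap.lineMap a c s : Plane) =
      a + s • (r / ‖b - a‖) • (b - a) := by
    intro s
    rw [AffineMap.lineMap_apply_module', hc, add_sub_cancel_left, add_comm]
  have hJle : J ≤ eLpNorm (∇ φ) 2 ((volume.restrict Ω).restrict (Metric.closedBall a r)) ^ 2 := by
    rw [eLpNorm_two_sq, hJ, inter_comm,
      ← Measure.restrict_restrict Metric.isClosed_closedBall.measurableSet]
    refine lintegral_mono' (Measure.restrict_mono le_rfl (hM.restrict_le ?_)) le_rfl
    exact iUnion₂_subset fun T' hT' => hull_subset_closure hM (mem_adjacent.1 hT').1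
  refine eLpNorm_two_le_of_sq_le ?_
  rw [lintegral_arcOn_segment hac (by fun_prop), hdist, setLIntegral_congr Ioc_ae_eq_Icc.symm,
    mul_pow, ← ENNReal.ofReal_pow (Real.sqrt_nonneg _), Real.sq_sqrt (by positivity),
    mul_comm 208 r, ENNReal.ofReal_mul hr.le, mul_assoc]
  refine mul_le_mul_right ?_ _
  simp_rw [hline]
  calc ∫⁻ s in Ioc (0 : ℝ) 1, ‖φ (a + s • (r / ‖b - a‖) • (b - a))‖ₑ ^ 2
      ≤ ∫⁻ s in Ioc (0 : ℝ) 1,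
          (2 * ‖φ (a + s • (r / ‖b - a‖) • (b - a)) - m‖ₑ ^ 2 + 2 * ‖m‖ₑ ^ 2) := by
        refine lintegral_mono fun s => ?_
        have := enorm_sub_sq_le_two (φ (a + s • (r / ‖b - a‖) • (b - a))) 0 m
        rw [sub_zero, sub_zero] at this
        refine this.trans ?_
        rw [← enorm_neg, neg_sub]
    _ = 2 * (∫⁻ s in Ioc (0 : ℝ) 1, ‖φ (a + s • (r / ‖b - a‖) • (b - a)) - m‖ₑ ^ 2) +
          2 * ‖m‖ₑ ^ 2 := by
        rw [lintegral_add_right _ measurable_const, lintegral_const_mul _ (by fun_prop),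
          lintegral_const, Measure.restrict_apply_univ, Real.volume_Ioc]
        simp
    _ ≤ 2 * (52 * J) + 2 * (52 * J) := by gcongr
    _ = ENNReal.ofReal 208 * J := by
        rw [show ENNReal.ofReal 208 = (208 : ℝ≥0∞) by norm_num]
        ring
    _ ≤ _ := by gcongr

/-- The continuous representative of the trace on the fracture vanishes at the boundary nodes: on
short segments of length `r` its mean square is at most a multiple of the energy in a disc of
radius `r`, which tends to zero with `r`. -/
lemma eq_zero_of_mem_frontier (hΩ : IsOpen Ω) (hM : M.Triangulates Ω) (hE : EΓ ⊆ M.edges)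
    (hρ : 0 < ρ) (hfat : ∀ T ∈ M.elements, Fat ρ H T) {v : Plane → ℝ} {G g : Plane → Plane}
    (hv : MemV Ω EΓ v G g) {a : Plane} {e : Finset Plane} (he : e ∈ EΓ) (ha : a ∈ e)
    (hfr : a ∈ frontier Ω) : v a = 0 := by
  obtain ⟨b, hab, rfl⟩ := exists_eq_pair (hE he) ha
  obtain ⟨T, hT, heT⟩ := exists_element_of_edge (hE he)
  have haT : a ∈ T := heT (by simp)
  have hbT : b ∈ T := heT (by simp)
  have hlen := (hfat T hT).le_dist hρ (isTri hT) haT hbT hab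
  have hn : 0 < ‖b - a‖ := norm_pos_iff.2 (sub_ne_zero.2 hab.symm)
  rw [dist_comm, dist_eq_norm] at hlen
  obtain ⟨φ, hφ, h1, h2, h3⟩ := hv.approx
  set Γ := edgeUnion EΓ with hΓ
  set E : ℝ → ℝ≥0∞ := fun r => ∫⁻ x in Metric.closedBall a r, ‖G x‖ₑ ^ 2 ∂(volume.restrict Ω)
    with hEdef
  have hsub : ∀ r, 0 < r → r ≤ ρ →
      segment ℝ a (a + (r / ‖b - a‖) • (b - a)) ⊆ Γ ∩ Metric.closedBall a r := by
    intro r hr hrρ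
    have hle : r / ‖b - a‖ ≤ 1 := by rw [div_le_one hn]; linarith
    refine subset_inter ?_ ?_
    · refine Subset.trans ?_ (hull_subset_edgeUnion he)
      refine (convex_convexHull ℝ _).segment_subset (subset_hull (by simp)) ?_
      exact add_smul_mem_hull (subset_hull (by simp)) (subset_hull (by simp)) (by positivity) hle
    · refine (convex_closedBall a r).segment_subset (Metric.mem_closedBall_self hr.le) ?_
      rw [mem_closedBall_iff_norm, add_sub_cancel_left, norm_smul,
        Real.norm_of_nonneg (by positivity)]
      rw [div_mul_cancel₀ _ hn.ne']
  have key : ∀ r, 0 < r → r ≤ ρ →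
      ∫⁻ x, ‖v x‖ₑ ^ 2 ∂(arcOn (segment ℝ a (a + (r / ‖b - a‖) • (b - a)))) ≤
        ENNReal.ofReal (208 * r) * E r := by
    intro r hr hrρ
    set ν := arcOn (segment ℝ a (a + (r / ‖b - a‖) • (b - a))) with hν
    set μ := (volume.restrict Ω).restrict (Metric.closedBall a r) with hμ
    have hνle : ν ≤ arcOn Γ := arcOn_mono ((hsub r hr hrρ).trans inter_subset_left)
    have hμle : μ ≤ volume.restrict Ω := Measure.restrict_le_self
    have : IsFiniteMeasure ν := arcOn_finite hE ((hsub r hr hrρ).trans inter_subset_left)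
    have hvm : AEStronglyMeasurable v ν := ((memLp_arcOn hE hv.continuousOn).mono_measure hνle).1
    have hGm : AEStronglyMeasurable G μ := (hv.memLp.2.mono_measure hμle).1
    have hlim : Tendsto (fun n => eLpNorm (φ n - v) 2 (arcOn Γ) + ENNReal.ofReal √(208 * r) *
        (eLpNorm G 2 μ + eLpNorm (∇ (φ n) - G) 2 (volume.restrict Ω))) atTop
        (𝓝 (0 + ENNReal.ofReal √(208 * r) * (eLpNorm G 2 μ + 0))) :=
      h3.add (ENNReal.Tendsto.const_mul (tendsto_const_nhds.add h2)
        (Or.inr ENNReal.ofReal_ne_top))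
    rw [zero_add, add_zero] at hlim
    have hmain : eLpNorm v 2 ν ≤ ENNReal.ofReal √(208 * r) * eLpNorm G 2 μ := by
      refine ge_of_tendsto' hlim fun n => ?_
      have hφm : AEStronglyMeasurable (φ n) ν := ((hφ n).memLp ν).1
      have hdm : AEStronglyMeasurable (∇ (φ n)) μ := by
        have : Continuous (∇ (φ n)) := continuous_iff_continuousAt.2 fun x =>
          continuousAt_gradient ((hφ n).1.contDiffAt.of_le (by norm_num))
        exact this.aestronglyMeasurable
      calc eLpNorm v 2 ν = eLpNorm ((v - φ n) + φ n) 2 ν := by rw [sub_add_cancel]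
        _ ≤ eLpNorm (v - φ n) 2 ν + eLpNorm (φ n) 2 ν :=
            eLpNorm_add_le (hvm.sub hφm) hφm (by norm_num)
        _ ≤ _ := by
            refine add_le_add ?_ ?_
            · rw [eLpNorm_sub_comm]
              exact eLpNorm_mono_measure _ hνle
            · refine (eLpNorm_radius_le hΩ hM hρ hfat (hφ n) (mem_adjacent.2 ⟨hT, haT⟩) hbT
                hab.symm hfr hr hrρ).trans (mul_le_mul_right ?_ _)
              calc eLpNorm (∇ (φ n)) 2 μ = eLpNorm (G + (∇ (φ n) - G)) 2 μ := by
                    rw [add_sub_cancel]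
                _ ≤ eLpNorm G 2 μ + eLpNorm (∇ (φ n) - G) 2 μ :=
                    eLpNorm_add_le hGm (hdm.sub hGm) (by norm_num)
                _ ≤ _ := add_le_add le_rfl (eLpNorm_mono_measure _ hμle)
    rw [← eLpNorm_two_sq, hEdef]
    simp only
    rw [← eLpNorm_two_sq, show ENNReal.ofReal (208 * r) = ENNReal.ofReal √(208 * r) ^ 2 by
      rw [← ENNReal.ofReal_pow (Real.sqrt_nonneg _), Real.sq_sqrt (by positivity)], ← mul_pow]
    gcongr
  have hElim : Tendsto E (𝓝[>] 0) (𝓝 0) := by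
    refine tendsto_setLIntegral_zero ?_ ?_
    · rw [← eLpNorm_two_sq]
      exact (ENNReal.pow_lt_top hv.memLp.2.2).ne
    · have hball : Tendsto (fun r : ℝ => ENNReal.ofReal r ^ 2 * ENNReal.ofReal Real.pi) (𝓝[>] 0)
          (𝓝 0) := by
        have hcont : Continuous fun r : ℝ => ENNReal.ofReal r ^ 2 * ENNReal.ofReal Real.pi :=
          ENNReal.continuous_mul_const ENNReal.ofReal_ne_top |>.comp
            ((ENNReal.continuous_pow 2).comp ENNReal.continuous_ofReal)
        have := (hcont.tendsto 0).mono_left (nhdsWithin_le_nhds (s := Ioi 0))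
        simpa using this
      refine tendsto_of_tendsto_of_tendsto_of_le_of_le tendsto_const_nhds hball
        (fun _ => zero_le) fun r => ?_
      refine (Measure.restrict_apply_le _ _).trans (le_of_eq ?_)
      rw [EuclideanSpace.volume_closedBall_fin_two]
  by_contra hva
  set δ := |v a| / 2 with hδ
  have hδ0 : 0 < δ := by have := abs_pos.2 hva; positivity
  have hcont : ∀ᶠ x in 𝓝[Γ] a, δ < |v x| := by
    have h4 : ContinuousWithinAt (fun x => |v x|) Γ a :=
      (hv.continuousOn a (hull_subset_edgeUnion he (subset_hull (by simp)))).abs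
    refine h4.eventually (lt_mem_nhds ?_)
    rw [hδ]
    linarith [abs_pos.2 hva]
  obtain ⟨η, hη, hball⟩ := Metric.mem_nhdsWithin_iff.1 hcont
  have hElt : ∀ᶠ r in 𝓝[>] (0 : ℝ), 208 * E r < ENNReal.ofReal (δ ^ 2) := by
    have h5 : Tendsto (fun r => 208 * E r) (𝓝[>] 0) (𝓝 (208 * 0)) :=
      ENNReal.Tendsto.const_mul hElim (Or.inr (by norm_num))
    rw [mul_zero] at h5
    exact h5.eventually (gt_mem_nhds (ENNReal.ofReal_pos.2 (by positivity)))
  have hsmall : ∀ᶠ r in 𝓝[>] (0 : ℝ), r < min ρ η :=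
    (gt_mem_nhds (lt_min hρ hη)).filter_mono nhdsWithin_le_nhds
  obtain ⟨r, ⟨hr1, hr2⟩, hr0⟩ := ((hElt.and hsmall).and self_mem_nhdsWithin).exists
  have hr0 : 0 < r := hr0
  have hrρ : r ≤ ρ := (hr2.trans_le (min_le_left _ _)).le
  have hrη : r < η := hr2.trans_le (min_le_right _ _)
  have h6 := key r hr0 hrρ
  set c := a + (r / ‖b - a‖) • (b - a) with hc
  have h7 : ENNReal.ofReal (δ ^ 2) * ENNReal.ofReal r ≤
      ∫⁻ x, ‖v x‖ₑ ^ 2 ∂(arcOn (segment ℝ a c)) := by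
    have hlen' : arcOn (segment ℝ a c) univ = ENNReal.ofReal r := by
      rw [arcOn, Measure.restrict_apply_univ, hausdorffMeasure_segment, edist_comm,
        edist_eq_enorm_sub, hc, add_sub_cancel_left, ← ofReal_norm, norm_smul,
        Real.norm_of_nonneg (by positivity), div_mul_cancel₀ _ hn.ne']
    rw [← hlen', ← lintegral_const]
    have hms : MeasurableSet (segment ℝ a c) := by
      rw [← hull_pair]; exact (isCompact_hull _).measurableSet
    refine lintegral_mono_ae ?_
    filter_upwards [ae_restrict_mem (μ := (μH[1] : Measure Plane)) hms] with x hx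
    obtain ⟨hxΓ, hxb⟩ := hsub r hr0 hrρ hx
    have hδx : δ < |v x| := hball ⟨Metric.closedBall_subset_ball hrη hxb, hxΓ⟩
    rw [Real.enorm_eq_ofReal_abs, ← ENNReal.ofReal_pow (abs_nonneg _)]
    apply ENNReal.ofReal_le_ofReal
    gcongr
  have h8 := h7.trans h6
  rw [mul_comm, mul_comm 208 r, ENNReal.ofReal_mul hr0.le, mul_assoc,
    show ENNReal.ofReal 208 = (208 : ℝ≥0∞) by norm_num] at h8
  exact absurd ((ENNReal.mul_le_mul_iff_right (ENNReal.ofReal_pos.2 hr0).ne'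
    ENNReal.ofReal_ne_top).1 h8) (not_le.2 hr1)

end Triangulation

namespace Triangulation

/-! ### Estimates on the fracture -/

variable {M : Triangulation} {Ω : Set Plane} {EΓ : Finset (Finset Plane)} {ρ H : ℝ}

/-- A pointwise bound on the fracture edges of `T`, away from the vertices, bounds the integral over
the part of the fracture in `T`, whose length is at most `3 H`. -/
lemma lintegral_fracture_le (hE : EΓ ⊆ M.edges) {T : Finset Plane} (hT : T ∈ M.elements)
    (hF : Fat ρ H T) {f : Plane → ℝ≥0∞} {B : ℝ≥0∞}
    (h : ∀ e ∈ EΓ, e ⊆ T → ∀ x ∈ hull e, x ∉ e → f x ≤ B) :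
    ∫⁻ x, f x ∂(arcOn (edgeUnion EΓ ∩ hull T)) ≤ ENNReal.ofReal (3 * H) * B := by
  refine (lintegral_arcOn_inter_le hE hT f).trans ?_
  calc ∑ e ∈ fracEdges EΓ T, ∫⁻ x, f x ∂(arcOn (hull e))
      ≤ ∑ e ∈ fracEdges EΓ T, ENNReal.ofReal H * B := by
        refine Finset.sum_le_sum fun e he => ?_
        obtain ⟨he1, he2⟩ := mem_fracEdges.1 he
        have hnull : ∀ᵐ x ∂(μH[1] : Measure Plane), x ∉ (e : Set Plane) := by
          have := Measure.nullSingletonClass_hausdorff Plane (d := 1) one_pos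
          exact measure_eq_zero_iff_ae_notMem.1 (e.finite_toSet.measure_zero _)
        have hae : ∀ᵐ x ∂(arcOn (hull e)), f x ≤ B := by
          rw [arcOn, ae_restrict_iff' (isCompact_hull e).measurableSet]
          filter_upwards [hnull] with x hx hxe using h e he1 he2 x hxe hx
        refine (lintegral_mono_ae hae).trans ?_
        rw [lintegral_const, mul_comm]
        refine mul_le_mul_left ?_ _
        obtain ⟨a, b, -, rfl⟩ := Finset.card_eq_two.1 (mem_edges.1 (hE he1)).2
        rw [arcOn, Measure.restrict_apply_univ, hull_pair, hausdorffMeasure_segment, edist_dist]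
        exact ENNReal.ofReal_le_ofReal
          (hF.dist_le (subset_hull (he2 (by simp))) (subset_hull (he2 (by simp))))
    _ ≤ 3 * (ENNReal.ofReal H * B) := by
        rw [Finset.sum_const, nsmul_eq_mul]
        gcongr
        exact_mod_cast card_fracEdges_le hE hT
    _ = _ := by
        rw [ENNReal.ofReal_mul (by norm_num), show ENNReal.ofReal 3 = (3 : ℝ≥0∞) by norm_num,
          mul_assoc]

lemma exists_mem_inter {e e' T : Finset Plane} (he : e ∈ M.edges) (he' : e' ∈ M.edges)
    (hT : T ∈ M.elements) (heT : e ⊆ T) (heT' : e' ⊆ T) : ∃ p, p ∈ e ∧ p ∈ e' := by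
  classical
  have h1 := Finset.card_union_add_card_inter e e'
  have h2 := Finset.card_le_card (Finset.union_subset heT heT')
  rw [(mem_elements.1 hT).2] at h2
  rw [(mem_edges.1 he).2, (mem_edges.1 he').2] at h1
  obtain ⟨p, hp⟩ := Finset.card_pos.1 (show 0 < (e ∩ e').card by omega)
  exact ⟨p, Finset.mem_inter.1 hp⟩

/-- Oscillation along the fracture edges of the patch. -/
lemma enorm_sub_le_of_mem_patch (hE : EΓ ⊆ M.edges) (hfat : ∀ T ∈ M.elements, Fat ρ H T)
    {v : Plane → ℝ} {G g : Plane → Plane} (hv : MemV Ω EΓ v G g) {T T' e : Finset Plane}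
    (hT' : T' ∈ M.elements) (hTT' : (hull T' ∩ hull T).Nonempty) (he : e ∈ EΓ) (heT : e ⊆ T')
    {x y : Plane} (hx : x ∈ hull e) (hy : y ∈ hull e) :
    ‖v y - v x‖ₑ ≤
      ENNReal.ofReal √H * eLpNorm g 2 (arcOn (M.patch T ∩ edgeUnion EΓ)) := by
  obtain ⟨a, b, hab, rfl⟩ := Finset.card_eq_two.1 (mem_edges.1 (hE he)).2
  have hdist : dist a b ≤ H :=
    (hfat T' hT').dist_le (subset_hull (heT (by simp))) (subset_hull (heT (by simp)))
  have hH : 0 ≤ H := dist_nonneg.trans hdist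
  have h := hv.tangential.enorm_sub_sq_le hv.continuousOn he hab hx hy
  rw [← ENNReal.pow_le_pow_left_iff two_ne_zero, mul_pow, ← ENNReal.ofReal_pow (Real.sqrt_nonneg _),
    Real.sq_sqrt hH, eLpNorm_two_sq]
  refine h.trans (mul_le_mul' (ENNReal.ofReal_le_ofReal hdist)
    (lintegral_mono' (arcOn_mono (subset_inter ?_ (hull_subset_edgeUnion he))) le_rfl))
  exact (hull_mono heT).trans (subset_biUnion_of_mem (u := fun T => hull T)
    (show T' ∈ {T' | T' ∈ M.elements ∧ (hull T' ∩ hull T).Nonempty} from ⟨hT', hTT'⟩))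

/-- At the nodes of the fracture the interpolation is close to the function. -/
lemma enorm_nodal_sub_le_of_fracture (hΩ : IsOpen Ω) (hM : M.Triangulates Ω) (hE : EΓ ⊆ M.edges)
    (hρ : 0 < ρ) (hfat : ∀ T ∈ M.elements, Fat ρ H T) {v : Plane → ℝ} {G g : Plane → Plane}
    (hv : MemV Ω EΓ v G g) {T e : Finset Plane} (hT : T ∈ M.elements) (he : e ∈ EΓ) (heT : e ⊆ T)
    {a : Plane} (ha : a ∈ e) :
    ‖M.nodal Ω EΓ v a - v a‖ₑ ≤ ENNReal.ofReal (4 * (H / ρ)) *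
      (ENNReal.ofReal √H * eLpNorm g 2 (arcOn (M.patch T ∩ edgeUnion EΓ))) := by
  set S := ENNReal.ofReal √H * eLpNorm g 2 (arcOn (M.patch T ∩ edgeUnion EΓ)) with hS
  have h2ρ := (hfat T hT).radius_le hρ
  by_cases hfree : a ∈ M.freeNodes Ω
  · refine enorm_nodal_sub_le hfree (fun T' hT' => ?_) fun hne => absurd
      ⟨T, mem_fracAdjacent.2 ⟨mem_adjacent.2 ⟨hT, heT ha⟩, e, he, ha, heT⟩⟩ hne
    obtain ⟨hadj, e₀, he₀, hae₀, he₀T⟩ := mem_fracAdjacent.1 hT'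
    obtain ⟨hTe', haT'⟩ := mem_adjacent.1 hadj
    have hTT' : (hull T' ∩ hull T).Nonempty := ⟨a, subset_hull haT', subset_hull (heT ha)⟩
    have hc := controls_arcOn hE hTe' hρ (hfat T' hTe') he₀ hae₀ he₀T
    have hvm : MemLp v 2 (arcOn (edgeUnion EΓ ∩ hull T')) :=
      (memLp_arcOn hE hv.continuousOn).mono_measure (arcOn_mono inter_subset_left)
    have h1 := hc.enorm_integral_dual_sub_sq_le hTe' haT' hvm (v a)
    have h2 : ∫⁻ x, ‖v x - v a‖ₑ ^ 2 ∂(arcOn (edgeUnion EΓ ∩ hull T')) ≤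
        ENNReal.ofReal (3 * H) * (2 * S) ^ 2 := by
      refine lintegral_fracture_le hE hTe' (hfat T' hTe') fun e' he' heT' x hx _ => ?_
      -- the edges `e₀` and `e'` of one triangle have a common vertex
      obtain ⟨p, hp₀, hp'⟩ := exists_mem_inter (hE he₀) (hE he') hTe' he₀T heT'
      gcongr
      calc ‖v x - v a‖ₑ = ‖(v x - v p) + (v p - v a)‖ₑ := by rw [sub_add_sub_cancel]
        _ ≤ ‖v x - v p‖ₑ + ‖v p - v a‖ₑ := enorm_add_le _ _
        _ ≤ S + S := add_le_add
            (enorm_sub_le_of_mem_patch hE hfat hv hTe' hTT' he' heT' (subset_hull hp') hx)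
            (enorm_sub_le_of_mem_patch hE hfat hv hTe' hTT' he₀ he₀T (subset_hull hae₀)
              (subset_hull hp₀))
        _ = 2 * S := (two_mul S).symm
    rw [← ENNReal.pow_le_pow_left_iff two_ne_zero]
    refine (h1.trans (mul_le_mul_right h2 _)).trans ?_
    have hH : 0 < H := by linarith
    rw [mul_pow 2 S, mul_pow _ S, ← mul_assoc, ← mul_assoc, ← ENNReal.ofReal_mul (by positivity),
      show (2 : ℝ≥0∞) ^ 2 = ENNReal.ofReal 4 by norm_num, ← ENNReal.ofReal_mul (by positivity),
      ← ENNReal.ofReal_pow (by positivity)]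
    refine mul_le_mul_left (ENNReal.ofReal_le_ofReal ?_) _
    have hK : 2 ≤ H / ρ := by rw [le_div_iff₀ hρ]; exact h2ρ
    calc 1 / (ρ / 2) * (3 * H) * 4 = 24 * (H / ρ) := by field_simp; norm_num
      _ ≤ (4 * (H / ρ)) ^ 2 := by nlinarith
  · have hfr : a ∈ frontier Ω := by
      by_contra h
      exact hfree (mem_freeNodes.2 ⟨mem_nodes_of_mem hT (heT ha), h⟩)
    rw [eq_zero_of_mem_frontier hΩ hM hE hρ hfat hv he ha hfr, nodal, if_neg hfree]
    simp

/-- Pointwise error estimate on the fracture edges of an element. -/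
lemma enorm_interp_sub_le (hΩ : IsOpen Ω) (hM : M.Triangulates Ω) (hE : EΓ ⊆ M.edges)
    (hρ : 0 < ρ) (hfat : ∀ T ∈ M.elements, Fat ρ H T) {v : Plane → ℝ} {G g : Plane → Plane}
    (hv : MemV Ω EΓ v G g) {T e : Finset Plane} (hT : T ∈ M.elements) (he : e ∈ EΓ) (heT : e ⊆ T)
    {x : Plane} (hx : x ∈ hull e) :
    ‖interp M Ω EΓ v x - v x‖ₑ ≤ 3 * (ENNReal.ofReal (4 * (H / ρ) + 1) *
      (ENNReal.ofReal √H * eLpNorm g 2 (arcOn (M.patch T ∩ edgeUnion EΓ)))) := by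
  have hF := hfat T hT
  have hH : 0 < H := by linarith [hF.radius_le hρ]
  have hxT := hull_mono heT hx
  set S := ENNReal.ofReal √H * eLpNorm g 2 (arcOn (M.patch T ∩ edgeUnion EΓ)) with hS
  have hself : (hull T ∩ hull T).Nonempty := ⟨x, hxT, hxT⟩
  rw [interp_eqOn hT v hxT, sum_bary_sub hT _ (v x), add_sub_cancel_right]
  refine (enorm_sum_le _ _).trans ?_
  calc ∑ N ∈ T, ‖(M.nodal Ω EΓ v N - v x) * bary T N x‖ₑ
      ≤ ∑ N ∈ T, ENNReal.ofReal (4 * (H / ρ) + 1) * S := by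
        refine Finset.sum_le_sum fun N hN => ?_
        by_cases hNe : N ∈ e
        · have h1 : ‖bary T N x‖ₑ ≤ 1 := by
            rw [Real.enorm_eq_ofReal_abs, abs_of_nonneg ((isTri hT).bary_nonneg hxT N),
              ENNReal.ofReal_le_one]
            exact (isTri hT).bary_le_one hxT N
          rw [enorm_mul]
          calc ‖M.nodal Ω EΓ v N - v x‖ₑ * ‖bary T N x‖ₑ ≤ ‖M.nodal Ω EΓ v N - v x‖ₑ * 1 := by
                gcongr
            _ = ‖(M.nodal Ω EΓ v N - v N) + (v N - v x)‖ₑ := by rw [mul_one, sub_add_sub_cancel]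
            _ ≤ ‖M.nodal Ω EΓ v N - v N‖ₑ + ‖v N - v x‖ₑ := enorm_add_le _ _
            _ ≤ ENNReal.ofReal (4 * (H / ρ)) * S + S := add_le_add
                (enorm_nodal_sub_le_of_fracture hΩ hM hE hρ hfat hv hT he heT hNe)
                (enorm_sub_le_of_mem_patch hE hfat hv hT hself he heT hx (subset_hull hNe))
            _ = _ := by
                rw [ENNReal.ofReal_add (by positivity) zero_le_one, ENNReal.ofReal_one, add_mul,
                  one_mul]
        · rw [bary_eq_zero_of_mem_hull (isTri hT) heT hNe hx, mul_zero, enorm_zero]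
          exact zero_le
    _ = _ := by rw [Finset.sum_const, (mem_elements.1 hT).2, nsmul_eq_mul]; norm_num

/-- The error estimate on the fracture. -/
lemma fracture_error_le (hΩ : IsOpen Ω) (hM : M.Triangulates Ω) (hE : EΓ ⊆ M.edges)
    (hρ : 0 < ρ) (hfat : ∀ T ∈ M.elements, Fat ρ H T) {v : Plane → ℝ} {G g : Plane → Plane}
    (hv : MemV Ω EΓ v G g) {T : Finset Plane} (hT : T ∈ M.elements) :
    eLpNorm (v - interp M Ω EΓ v) 2 (arcOn (edgeUnion EΓ ∩ hull T)) ≤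
      ENNReal.ofReal (6 * (4 * (H / ρ) + 1) * H) *
        eLpNorm g 2 (arcOn (M.patch T ∩ edgeUnion EΓ)) := by
  have hF := hfat T hT
  have hH : 0 < H := by linarith [hF.radius_le hρ]
  set A := eLpNorm g 2 (arcOn (M.patch T ∩ edgeUnion EΓ)) with hA
  set κ := 4 * (H / ρ) + 1 with hκ
  have hκ0 : 0 ≤ κ := by positivity
  refine eLpNorm_two_le_of_sq_le ((lintegral_fracture_le hE hT hF
    (B := (3 * (ENNReal.ofReal κ * (ENNReal.ofReal √H * A))) ^ 2) fun e he heT x hx _ => ?_).trans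
    ?_)
  · gcongr
    rw [Pi.sub_apply, ← enorm_neg, neg_sub]
    exact enorm_interp_sub_le hΩ hM hE hρ hfat hv hT he heT hx
  · rw [show (3 : ℝ≥0∞) = ENNReal.ofReal 3 by norm_num, ← mul_assoc, ← mul_assoc,
      ← ENNReal.ofReal_mul (by norm_num), ← ENNReal.ofReal_mul (by positivity), mul_pow, mul_pow,
      ← mul_assoc, ← ENNReal.ofReal_pow (by positivity), ← ENNReal.ofReal_pow (by positivity),
      ← ENNReal.ofReal_mul (by positivity)]
    refine mul_le_mul_left (ENNReal.ofReal_le_ofReal ?_) _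
    rw [mul_pow (3 * κ), Real.sq_sqrt hH.le]
    nlinarith [mul_nonneg (sq_nonneg κ) (sq_nonneg H)]

/-! ### The tangential gradient of the interpolation -/

/-- The constant tangential gradient on the edge `e` of a function that is affine on `e`. The sum
over all pairs of vertices makes the formula independent of an orientation of the edge. -/
def edgeSlope (f : Plane → ℝ) (e : Finset Plane) : Plane :=
  (1 / 2 : ℝ) • ∑ p ∈ e, ∑ q ∈ e, ((f q - f p) / ‖q - p‖ ^ 2) • (q - p)

lemma edgeSlope_pair (f : Plane → ℝ) {a b : Plane} (hab : a ≠ b) :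
    edgeSlope f {a, b} = ((f b - f a) / ‖b - a‖ ^ 2) • (b - a) := by
  have h : ((f a - f b) / ‖a - b‖ ^ 2) • (a - b) = ((f b - f a) / ‖b - a‖ ^ 2) • (b - a) := by
    rw [norm_sub_rev, ← neg_sub b a, ← neg_sub (f b) (f a), neg_div, neg_smul_neg]
  rw [edgeSlope, Finset.sum_pair hab, Finset.sum_pair hab, Finset.sum_pair hab, sub_self a,
    sub_self b, smul_zero, smul_zero, zero_add, add_zero, h, ← two_smul ℝ, smul_smul]
  norm_num

/-- The piecewise constant tangential gradient along the edges in `EΓ`. -/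
def edgeGradient (EΓ : Finset (Finset Plane)) (f : Plane → ℝ) (x : Plane) : Plane :=
  ∑ e ∈ EΓ, (hull e).indicator (fun _ => edgeSlope f e) x

lemma edgeGradient_eq (hE : EΓ ⊆ M.edges) (f : Plane → ℝ) {e : Finset Plane} (he : e ∈ EΓ)
    {x : Plane} (hx : x ∈ hull e) (hxe : x ∉ e) : edgeGradient EΓ f x = edgeSlope f e := by
  rw [edgeGradient, Finset.sum_eq_single e, indicator_of_mem hx]
  · intro e' he' hne
    refine indicator_of_notMem (fun hx' => hxe ?_) _
    refine (mem_and_mem_of_not_subset (hE he) (mem_edges.1 (hE he')).1 (fun hsub => hne ?_) hx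
      hx').1
    refine (Finset.eq_of_subset_of_card_le hsub ?_).symm
    rw [(mem_edges.1 (hE he)).2, (mem_edges.1 (hE he')).2]
  · exact fun h => absurd he h

lemma hasTangentialGradient_edgeGradient (hE : EΓ ⊆ M.edges) {f : Plane → ℝ} (hf : M.IsP1 f) :
    HasTangentialGradient EΓ f (edgeGradient EΓ f) := by
  have hfin := arcOn_finite hE (Subset.refl (edgeUnion EΓ))
  refine ⟨?_, fun e he a ha b hb hab => ?_⟩
  · exact memLp_finsetSum _ fun e _ =>
      (memLp_const _).indicator (isCompact_hull e).measurableSet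
  obtain ⟨b', -, rfl⟩ := exists_eq_pair (hE he) ha
  obtain rfl : b = b' := by simpa [hab.symm] using hb
  have hn : ‖b - a‖ ≠ 0 := norm_ne_zero_iff.2 (sub_ne_zero.2 hab.symm)
  constructor
  · have hnull : ∀ᵐ x ∂(μH[1] : Measure Plane), x ∉ (({a, b} : Finset Plane) : Set Plane) := by
      have := Measure.nullSingletonClass_hausdorff Plane (d := 1) one_pos
      exact measure_eq_zero_iff_ae_notMem.1 ((Finset.finite_toSet _).measure_zero _)
    rw [arcOn, ae_restrict_iff' (isCompact_hull _).measurableSet]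
    filter_upwards [hnull] with x hx hxe
    rw [edgeGradient_eq hE f he hxe hx, edgeSlope_pair f hab]
    exact Submodule.smul_mem _ _ (Submodule.mem_span_singleton_self _)
  · intro φ hφ
    obtain ⟨T, hT, heT⟩ := exists_element_of_edge (hE he)
    obtain ⟨A, hA⟩ := hf.2 T hT
    set d := f b - f a with hd
    have hmem : ∀ s ∈ Icc (0 : ℝ) 1, (AffineMap.lineMap a b s : Plane) ∈ hull {a, b} := by
      intro s hs
      rw [hull_pair, segment_eq_image_lineMap]
      exact ⟨s, hs, rfl⟩
    have hfl : ∀ s ∈ Ioo (0 : ℝ) 1, f (AffineMap.lineMap a b s) = f a + s * d := by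
      intro s hs
      rw [hA (hull_mono heT (hmem s (Ioo_subset_Icc_self hs))), hd,
        hA (hull_mono heT (subset_hull (by simp)) : a ∈ hull T),
        hA (hull_mono heT (subset_hull (by simp)) : b ∈ hull T),
        AffineMap.apply_lineMap, AffineMap.lineMap_apply_module', smul_eq_mul, add_comm]
    have hgl : ∀ s ∈ Ioo (0 : ℝ) 1,
        inner ℝ (edgeGradient EΓ f (AffineMap.lineMap a b s)) (b - a) = d := by
      intro s hs
      have hne : (AffineMap.lineMap a b s : Plane) ∉ ({a, b} : Finset Plane) := by
        rw [Finset.mem_insert, Finset.mem_singleton, not_or]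
        constructor
        · rw [AffineMap.lineMap_eq_left_iff]
          exact fun h => h.elim hab hs.1.ne'
        · rw [AffineMap.lineMap_eq_right_iff]
          exact fun h => h.elim hab hs.2.ne
      rw [edgeGradient_eq hE f he (hmem s (Ioo_subset_Icc_self hs)) hne, edgeSlope_pair f hab,
        real_inner_smul_left, real_inner_self_eq_norm_sq]
      rw [div_mul_cancel₀ _ (pow_ne_zero 2 hn)]
    have hφ0 : ∀ s, s ∉ Ioo (0 : ℝ) 1 → φ s = 0 := fun s hs =>
      image_eq_zero_of_notMem_tsupport fun h => hs (hφ.2.2 h)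
    have hcd : Continuous (deriv φ) := hφ.1.continuous_deriv (by norm_num)
    have hparts := intervalIntegral.integral_mul_deriv_eq_deriv_mul (a := (0 : ℝ)) (b := 1)
      (u := fun s => f a + s * d) (u' := fun _ => d) (v := φ) (v' := deriv φ)
      (fun s _ => by simpa using ((hasDerivAt_id s).mul_const d).const_add (f a))
      (fun s _ => (hφ.1.differentiable (by norm_num) s).hasDerivAt)
      (continuous_const.intervalIntegrable _ _) (hcd.intervalIntegrable _ _)
    rw [hφ0 0 (by simp), hφ0 1 (by simp), mul_zero, mul_zero, sub_zero, zero_sub] at hparts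
    have hcongr : ∀ {p q : ℝ → ℝ}, (∀ s ∈ Ioo (0 : ℝ) 1, p s = q s) →
        ∫ s in (0 : ℝ)..1, p s = ∫ s in (0 : ℝ)..1, q s := by
      intro p q h
      rw [intervalIntegral.integral_of_le zero_le_one, intervalIntegral.integral_of_le zero_le_one,
        integral_Ioc_eq_integral_Ioo, integral_Ioc_eq_integral_Ioo]
      exact setIntegral_congr_fun measurableSet_Ioo h
    rw [hcongr (q := fun s => (f a + s * d) * deriv φ s) fun s hs => by rw [hfl s hs], hparts,
      neg_inj]
    exact (hcongr fun s hs => by rw [hgl s hs]).symm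

/-- The stability estimate on the fracture. -/
lemma fracture_stability_le (hΩ : IsOpen Ω) (hM : M.Triangulates Ω) (hE : EΓ ⊆ M.edges)
    (hρ : 0 < ρ) (hfat : ∀ T ∈ M.elements, Fat ρ H T) {v : Plane → ℝ} {G g : Plane → Plane}
    (hv : MemV Ω EΓ v G g) {T : Finset Plane} (hT : T ∈ M.elements) :
    eLpNorm (edgeGradient EΓ (interp M Ω EΓ v)) 2 (arcOn (edgeUnion EΓ ∩ hull T)) ≤
      ENNReal.ofReal ((H / ρ) * (24 * (H / ρ) + 7)) *
        eLpNorm g 2 (arcOn (M.patch T ∩ edgeUnion EΓ)) := by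
  have hF := hfat T hT
  have hH : 0 < H := by linarith [hF.radius_le hρ]
  set A := eLpNorm g 2 (arcOn (M.patch T ∩ edgeUnion EΓ)) with hA
  set κ := 24 * (H / ρ) + 7 with hκ
  have hκ0 : 0 ≤ κ := by positivity
  refine eLpNorm_two_le_of_sq_le ((lintegral_fracture_le hE hT hF
    (B := (ENNReal.ofReal (1 / (2 * ρ)) * (ENNReal.ofReal κ * (ENNReal.ofReal √H * A))) ^ 2)
    fun e he heT x hx hxe => ?_).trans ?_)
  · rw [edgeGradient_eq hE _ he hx hxe]
    gcongr
    obtain ⟨a, b, hab, rfl⟩ := Finset.card_eq_two.1 (mem_edges.1 (hE he)).2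
    have hlen := hF.le_dist hρ (isTri hT) (heT (by simp)) (heT (by simp)) hab
    rw [dist_comm, dist_eq_norm] at hlen
    have hn : 0 < ‖b - a‖ := by linarith
    have ha : a ∈ hull {a, b} := subset_hull (by simp)
    have hb : b ∈ hull {a, b} := subset_hull (by simp)
    set I := interp M Ω EΓ v with hI
    have h1 := enorm_interp_sub_le hΩ hM hE hρ hfat hv hT he heT ha
    have h2 := enorm_interp_sub_le hΩ hM hE hρ hfat hv hT he heT hb
    have h3 := enorm_sub_le_of_mem_patch hE hfat hv hT (T := T)
      ⟨a, hull_mono heT ha, hull_mono heT ha⟩ he heT ha hb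
    rw [← hI, ← hA] at h1 h2
    rw [← hA] at h3
    set S := ENNReal.ofReal √H * A with hS
    have h4 : ‖I b - I a‖ₑ ≤ ENNReal.ofReal κ * S := by
      calc ‖I b - I a‖ₑ = ‖((I b - v b) - (I a - v a)) + (v b - v a)‖ₑ := by congr 1; ring
        _ ≤ (‖I b - v b‖ₑ + ‖I a - v a‖ₑ) + ‖v b - v a‖ₑ :=
            (enorm_add_le _ _).trans (add_le_add enorm_sub_le le_rfl)
        _ ≤ (3 * (ENNReal.ofReal (4 * (H / ρ) + 1) * S) +
              3 * (ENNReal.ofReal (4 * (H / ρ) + 1) * S)) + S := by gcongr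
        _ = _ := by
            rw [hκ, show 24 * (H / ρ) + 7 = 6 * (4 * (H / ρ) + 1) + 1 by ring,
              ENNReal.ofReal_add (p := 6 * (4 * (H / ρ) + 1)) (by positivity) zero_le_one,
              ENNReal.ofReal_mul (p := 6) (by norm_num), ENNReal.ofReal_one,
              show ENNReal.ofReal 6 = (6 : ℝ≥0∞) by norm_num]
            ring
    have h5 : ‖edgeSlope I {a, b}‖ₑ = ENNReal.ofReal (1 / ‖b - a‖) * ‖I b - I a‖ₑ := by
      rw [edgeSlope_pair I hab, ← ofReal_norm, norm_smul, norm_div, norm_pow, norm_norm,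
        show ‖I b - I a‖ / ‖b - a‖ ^ 2 * ‖b - a‖ = 1 / ‖b - a‖ * ‖I b - I a‖ by field_simp,
        ENNReal.ofReal_mul (by positivity), ofReal_norm]
    rw [h5]
    exact mul_le_mul' (ENNReal.ofReal_le_ofReal (by gcongr)) h4
  · rw [← mul_assoc, ← mul_assoc, ← ENNReal.ofReal_mul (by positivity),
      ← ENNReal.ofReal_mul (by positivity), mul_pow, mul_pow, ← mul_assoc,
      ← ENNReal.ofReal_pow (by positivity), ← ENNReal.ofReal_pow (by positivity),
      ← ENNReal.ofReal_mul (by positivity)]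
    refine mul_le_mul_left (ENNReal.ofReal_le_ofReal ?_) _
    rw [mul_pow (1 / (2 * ρ) * κ), Real.sq_sqrt hH.le]
    calc 3 * H * ((1 / (2 * ρ) * κ) ^ 2 * H) = 3 / 4 * (H / ρ * κ) ^ 2 := by field_simp; ring
      _ ≤ _ := by nlinarith [sq_nonneg (H / ρ * κ)]

/-! ### The interpolation as a coarse function -/

lemma isVH_interp (hM : M.Triangulates Ω) (v : Plane → ℝ) : M.IsVH Ω (interp M Ω EΓ v) := by
  refine ⟨by rw [interp_eq]; exact isP1_sum_hat _ _, fun x hx => ?_⟩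
  obtain ⟨S, hS, hfr⟩ := hM.2
  obtain ⟨e, he, hxe⟩ : ∃ e ∈ S, x ∈ hull e := by
    rw [hfr, edgeUnion] at hx
    simpa using hx
  obtain ⟨T, hT, heT⟩ := exists_element_of_edge (hS he)
  rw [interp_eqOn hT v (hull_mono heT hxe)]
  refine Finset.sum_eq_zero fun N _ => ?_
  by_cases hN : N ∈ e
  · have hNfr : N ∈ frontier Ω := by
      rw [hfr]
      exact hull_subset_edgeUnion he (subset_hull hN)
    rw [nodal, if_neg fun h => (mem_freeNodes.1 h).2 hNfr, zero_mul]
  · rw [bary_eq_zero_of_mem_hull (isTri hT) heT hN hxe, mul_zero]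

end Triangulation

end FractureSZ

end

theorem lemma1 (γ : ℝ) :
    ∃ C : ℝ, 0 < C ∧
      ∀ (Ω : Set FractureSZ.Plane) (M : FractureSZ.Triangulation) (H : ℝ)
        (EΓ : Finset (Finset FractureSZ.Plane)),
        IsOpen Ω → IsConnected Ω → M.Triangulates Ω → M.QuasiUniform H γ → EΓ ⊆ M.edges →
        -- the dual basis functions that enter the operator are well defined
        (∀ N ∈ M.freeNodes Ω,
          (∀ T ∈ M.adjacent N, M.HasUniqueDual (FractureSZ.areaOn T) N) ∧
          (∀ T ∈ M.fracAdjacent EΓ N, M.HasUniqueDual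
            (FractureSZ.arcOn (FractureSZ.edgeUnion EΓ ∩ FractureSZ.hull T)) N)) ∧
        ∀ (v : FractureSZ.Plane → ℝ) (G g : FractureSZ.Plane → FractureSZ.Plane),
          FractureSZ.MemV Ω EΓ v G g →
          -- `I_H v` is a coarse function, with elementwise gradient and tangential gradient `gI`
          M.IsVH Ω (FractureSZ.interp M Ω EΓ v) ∧
          ∃ gI : FractureSZ.Plane → FractureSZ.Plane,
            FractureSZ.HasTangentialGradient EΓ (FractureSZ.interp M Ω EΓ v) gI ∧
            ∀ T ∈ M.elements,
              -- the error bound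
              eLpNorm (v - FractureSZ.interp M Ω EΓ v) 2 (FractureSZ.areaOn T) +
                eLpNorm (v - FractureSZ.interp M Ω EΓ v) 2
                  (FractureSZ.arcOn (FractureSZ.edgeUnion EΓ ∩ FractureSZ.hull T)) ≤
                ENNReal.ofReal (C * H) *
                  (eLpNorm G 2 (volume.restrict (M.patch T)) +
                    eLpNorm g 2
                      (FractureSZ.arcOn (M.patch T ∩ FractureSZ.edgeUnion EΓ))) ∧
              -- the stability bound
              eLpNorm (∇ (FractureSZ.interp M Ω EΓ v)) 2 (FractureSZ.areaOn T) +
                eLpNorm gI 2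
                  (FractureSZ.arcOn (FractureSZ.edgeUnion EΓ ∩ FractureSZ.hull T)) ≤
                ENNReal.ofReal C *
                  (eLpNorm G 2 (volume.restrict (M.patch T)) +
                    eLpNorm g 2
                      (FractureSZ.arcOn (M.patch T ∩ FractureSZ.edgeUnion EΓ))) := by
  -- `K` is the bound for `H / ρ`; the absolute value only matters if the mesh has no element
  set K : ℝ := 4 * |γ| with hK
  have hK0 : 0 ≤ K := by positivity
  refine ⟨2 + 144 * K ^ 2 + 6 * (4 * K + 1) + 72 * K ^ 3 + K * (24 * K + 7), by positivity,
    fun Ω M H EΓ hΩ _ hM hQ hE => ⟨fun N _ => ⟨fun T hT => ?_, fun T hT => ?_⟩,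
      fun v G g hv => ⟨FractureSZ.Triangulation.isVH_interp hM v, _,
        FractureSZ.Triangulation.hasTangentialGradient_edgeGradient hE
          (FractureSZ.Triangulation.isVH_interp hM v).1, fun T hT => ?_⟩⟩⟩
  · obtain ⟨hTe, hNT⟩ := FractureSZ.Triangulation.mem_adjacent.1 hT
    obtain ⟨hH, hγ⟩ := hQ.pos hTe
    exact (FractureSZ.controls_areaOn (by positivity) (hQ.fat hTe) hNT).hasUniqueDual hTe hNT
  · obtain ⟨hadj, e, he, hNe, heT⟩ := FractureSZ.Triangulation.mem_fracAdjacent.1 hT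
    obtain ⟨hTe, hNT⟩ := FractureSZ.Triangulation.mem_adjacent.1 hadj
    obtain ⟨hH, hγ⟩ := hQ.pos hTe
    exact (FractureSZ.Triangulation.controls_arcOn hE hTe (by positivity) (hQ.fat hTe) he hNe
      heT).hasUniqueDual hTe hNT
  · obtain ⟨hH, hγ⟩ := hQ.pos hT
    have hρ : 0 < H / (4 * γ) := by positivity
    have hfat : ∀ T ∈ M.elements, FractureSZ.Fat (H / (4 * γ)) H T := fun T hT => hQ.fat hT
    have hHρ : H / (H / (4 * γ)) = K := by
      rw [hK, abs_of_pos hγ]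
      field_simp
    obtain ⟨h1, h2⟩ := FractureSZ.Triangulation.element_estimates hΩ hM hE hρ hfat hv hT
    have h3 := FractureSZ.Triangulation.fracture_error_le hΩ hM hE hρ hfat hv hT
    have h4 := FractureSZ.Triangulation.fracture_stability_le hΩ hM hE hρ hfat hv hT
    rw [hHρ] at h1 h2 h3 h4
    have hp1 : 0 ≤ K ^ 2 := by positivity
    have hp2 : 0 ≤ K ^ 3 := by positivity
    have hp3 : 0 ≤ K * (24 * K + 7) := by positivity
    rw [mul_add (ENNReal.ofReal _), mul_add (ENNReal.ofReal _)]
    refine ⟨add_le_add (h1.trans ?_) (h3.trans ?_), add_le_add (h2.trans ?_) (h4.trans ?_)⟩ <;>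
    refine mul_le_mul_left (ENNReal.ofReal_le_ofReal ?_) _
    · exact mul_le_mul_of_nonneg_right (by linarith) hH.le
    · exact mul_le_mul_of_nonneg_right (by linarith) hH.le
    · linarith
    · linarith
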